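/- **Proposition 4.3.** Let $n,m,N\ge 1$ be integers and $0<\lambda,\Lambda<\infty$. There exist constants $C,c>0$, depending only on $n,m,N,\lambda,\Lambda$, such that the following holds. Let $A=(a^{i,j}_{\alpha,\beta})_{|\alpha|=|\beta|=m,\,1\le i,j\le N}$ be measurable complex coefficients on $(0,\infty)\times\mathbb R^n$ which satisfy the ellipticity estimates with constants $\lambda,\Lambda$: $|a_{\alpha,\beta}^{i,j}(t,x)|\le\Lambda$ for almost every $(t,x)$, and, for almost every $t>0$, $$\operatorname{Re}\sum_{|\alpha|=|\beta|=m}\ \sum_{1\le i,j\le N}\int_{\mathbb R^n}a^{i,j}_{\alpha,\beta}(t,x)\,\partial^\beta f_j(x)\,\overline{\partial^\alpha f_i(x)}\,dx\ \ge\ \lambda\,\|\nabla^m f\|_{L^2(\mathbb R^n)}^2$$ for all $f\in\mathscr D'(\mathbb R^n;\mathbb C^N)$ with $\nabla^m f=(\partial^\alpha f)_{|\alpha|=m}\in L^2(\mathbb R^n)$ (such $f$ are locally integrable). For $0\le s\le t$ and $h\in L^2(\mathbb R^n;\mathbb C^N)$ let $\Gamma(t,s)h=u(t,\cdot)$, where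 $u$ is the unique weak solution on $(s,\infty)\times\mathbb R^n$ of $$\partial_t u_i=-(-1)^m\sum_{|\alpha|=|\beta|=m}\ \sum_{1\le j\le N}\partial^\alpha\big(a^{i,j}_{\alpha,\beta}\,\partial^\beta u_j\big),\qquad 1\le i\le N,$$ with $\nabla^m u\in L^2((s,\infty)\times\mathbb R^n)$ and $u(t,\cdot)\to h$ in $L^1_{loc}(\mathbb R^n)$ as $t\downarrow s$. Here a weak solution is a function $u\in L^2_{loc}(s,\infty;H^m_{loc}(\mathbb R^n))$ that satisfies the equation when tested against $C_c^\infty((s,\infty)\times\mathbb R^n;\mathbb C^N)$, and $u(t,\cdot)$ is the value at time $t$ of its representative in $C((s,\infty);L^2_{loc}(\mathbb R^n))$, with $u(s,\cdot)=h$. Then for all closed sets $E,F\subseteq\mathbb R^n$, all $f\in L^2(\mathbb R^n;\mathbb C^N)$ and all $0\le s<t<\infty$, $$\|\mathbf 1_E\,\Gamma(t,s)(\mathbf 1_F f)\|_{L^2}\le C\exp\left\{-c\left(\frac{d(E,F)}{(t-s)^{1/(2m)}}\right)^{\frac{2m}{2m-1}}\right\}\|\mathbf 1_F f\|_{L^2},$$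 where $d(E,F)=\inf\{|x-y| : x\in E,\ y\in F\}$. -/

import Mathlib

open MeasureTheory Set Filter Topology
open scoped ContDiff ENNReal

namespace HigherOrderParabolic

/-- The space domain `ℝⁿ` with its Euclidean norm. -/
abbrev Space (n : ℕ) : Type := EuclideanSpace ℝ (Fin n)

/-- The target `ℂᴺ` with its Hermitian norm. -/
abbrev Target (N : ℕ) : Type := EuclideanSpace ℂ (Fin N)

/-- Multi-indices in `n` variables. -/
abbrev MultiIndex (n : ℕ) : Type := Fin n → ℕ

/-- The finite set of multi-indices of length exactly `m`. -/
def multiIndices (n m : ℕ) : Finset (MultiIndex n) :=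
  Finset.piAntidiag Finset.univ m

/-- The length `|α|` of a multi-index. -/
def MultiIndex.length {n : ℕ} (α : MultiIndex n) : ℕ := ∑ k, α k

theorem mem_multiIndices {n m : ℕ} {α : MultiIndex n} :
    α ∈ multiIndices n m ↔ α.length = m := by
  simp [multiIndices, MultiIndex.length, Finset.mem_piAntidiag]

/-- The classical partial derivative `∂ₖ g`. -/
noncomputable def partialDeriv {n : ℕ} {V : Type*} [NormedAddCommGroup V] [NormedSpace ℝ V]
    (k : Fin n) (g : Space n → V) : Space n → V :=
  fun x => fderiv ℝ g x (EuclideanSpace.single k (1 : ℝ))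

/-- The classical iterated partial derivative `∂^α g = ∂₀^{α₀} ⋯ ∂ₙ₋₁^{αₙ₋₁} g`
(used for smooth `g` only, where the order of differentiation is irrelevant). -/
noncomputable def multiDeriv {n : ℕ} {V : Type*} [NormedAddCommGroup V] [NormedSpace ℝ V]
    (α : MultiIndex n) (g : Space n → V) : Space n → V :=
  (List.finRange n).foldr (fun k h => (partialDeriv k)^[α k] h) g

/-- `g` is the weak (distributional) derivative `∂^α f` on `ℝⁿ`; both are locally integrable. -/
def IsWeakDeriv {n N : ℕ} (α : MultiIndex n) (f g : Space n → Target N) : Prop :=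
  LocallyIntegrable f volume ∧ LocallyIntegrable g volume ∧
    ∀ φ : Space n → ℝ, ContDiff ℝ ∞ φ → HasCompactSupport φ →
      ∫ x, multiDeriv α φ x • f x = (-1 : ℝ) ^ α.length • ∫ x, φ x • g x

/-- Coefficient matrices: `A t x α β i j` is `a_{α,β}^{i,j}(t,x)`. Only the entries with
`|α| = |β| = m` are ever used, and only for `t > 0`. -/
abbrev Coeff (n N : ℕ) : Type :=
  ℝ → Space n → MultiIndex n → MultiIndex n → Fin N → Fin N → ℂ

/-- The ellipticity estimates with constants `lam` (lower, in the sense of the strong Gårding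
inequality) and `Lam` (upper) for `L = (-1)^m div_m A ∇^m` on `(0,∞) × ℝⁿ`. -/
structure IsElliptic {n N : ℕ} (m : ℕ) (lam Lam : ℝ) (A : Coeff n N) : Prop where
  /-- The coefficients are measurable on the half-space. -/
  measurable : ∀ α ∈ multiIndices n m, ∀ β ∈ multiIndices n m, ∀ i j : Fin N,
    AEStronglyMeasurable (fun p : ℝ × Space n => A p.1 p.2 α β i j)
      (volume.restrict (Ioi (0 : ℝ) ×ˢ univ))
  /-- The coefficients are bounded by `Lam` almost everywhere. -/
  bounded : ∀ α ∈ multiIndices n m, ∀ β ∈ multiIndices n m, ∀ i j : Fin N,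
    ∀ᵐ p : ℝ × Space n ∂(volume.restrict (Ioi (0 : ℝ) ×ˢ univ)), ‖A p.1 p.2 α β i j‖ ≤ Lam
  /-- The strong Gårding inequality, for a.e. `t > 0` and all `f` whose weak derivatives of
  order `m` (here `g α = ∂^α f`) are square integrable. -/
  garding : ∀ᵐ t ∂(volume.restrict (Ioi (0 : ℝ))),
    ∀ (f : Space n → Target N) (g : MultiIndex n → Space n → Target N),
      (∀ α ∈ multiIndices n m, IsWeakDeriv α f (g α) ∧ MemLp (g α) 2 volume) →
      lam * ∑ α ∈ multiIndices n m, ∫ x, ‖g α x‖ ^ 2 ≤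
        (∑ α ∈ multiIndices n m, ∑ β ∈ multiIndices n m, ∑ i : Fin N, ∑ j : Fin N,
          ∫ x, A t x α β i j * g β x j * star (g α x i)).re

/-- `u` is the solution in the energy class on `(s,∞) × ℝⁿ` of the system
`∂ₜ u = -(-1)^m div_m A ∇^m u` with initial datum `f` at time `s`: a weak solution
`u ∈ L²_loc(s,∞; H^m_loc)` with `∇^m u ∈ L²((s,∞) × ℝⁿ)` and trace `f` at `t = s`.
The value `u t` at each time is that of the representative of `u` which is continuous in time with
values in `L²_loc`. Here `D α` is `∂^α u` (weak derivative in the space variable). -/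
def IsEnergySolution {n N : ℕ} (m : ℕ) (A : Coeff n N) (s : ℝ) (f : Space n → Target N)
    (u : ℝ → Space n → Target N) : Prop :=
  ∃ D : MultiIndex n → ℝ → Space n → Target N,
    -- `u` is measurable on `(s,∞) × ℝⁿ`
    AEStronglyMeasurable (fun p : ℝ × Space n => u p.1 p.2)
      (volume.restrict (Ioi s ×ˢ univ)) ∧
    -- `u ∈ L²_loc(s,∞; H^m_loc(ℝⁿ))`
    (∀ α : MultiIndex n, α.length ≤ m →
      (∀ᵐ t ∂(volume.restrict (Ioi s)), IsWeakDeriv α (u t) (D α t)) ∧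
      (∀ K : Set (ℝ × Space n), IsCompact K → K ⊆ Ioi s ×ˢ univ →
        MemLp (fun p : ℝ × Space n => D α p.1 p.2) 2 (volume.restrict K))) ∧
    -- `∇^m u ∈ L²((s,∞) × ℝⁿ)`
    (∀ α ∈ multiIndices n m,
      MemLp (fun p : ℝ × Space n => D α p.1 p.2) 2 (volume.restrict (Ioi s ×ˢ univ))) ∧
    -- the equation, tested with `φ ∈ C_c^∞((s,∞) × ℝⁿ; ℂᴺ)`
    (∀ φ : Fin N → ℝ × Space n → ℂ,
      (∀ i, ContDiff ℝ ∞ (φ i) ∧ HasCompactSupport (φ i) ∧ tsupport (φ i) ⊆ Ioi s ×ˢ univ) →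
      ∑ i : Fin N, ∫ p in Ioi s ×ˢ (univ : Set (Space n)),
          u p.1 p.2 i * star (deriv (fun r => φ i (r, p.2)) p.1) =
        ∑ α ∈ multiIndices n m, ∑ β ∈ multiIndices n m, ∑ i : Fin N, ∑ j : Fin N,
          ∫ p in Ioi s ×ˢ (univ : Set (Space n)),
            A p.1 p.2 α β i j * D β p.1 p.2 j *
              star (multiDeriv α (fun y => φ i (p.1, y)) p.2)) ∧
    -- `u ∈ C((s,∞); L²_loc(ℝⁿ))`
    (∀ K : Set (Space n), IsCompact K → ∀ t, s < t →
      MemLp (u t) 2 (volume.restrict K) ∧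
      Tendsto (fun r => eLpNorm (u r - u t) 2 (volume.restrict K)) (𝓝 t) (𝓝 0)) ∧
    -- `u` has trace `f` at time `s`, in the sense of `L¹_loc(ℝⁿ)`
    (∀ K : Set (Space n), IsCompact K →
      Tendsto (fun t => eLpNorm (u t - f) 1 (volume.restrict K)) (𝓝[>] s) (𝓝 0)) ∧
    u s =ᵐ[volume] f

open Classical in
/-- The propagator: `Γ(t,s) f = u(t,·)`, where `u` is the energy solution on `(s,∞) × ℝⁿ` with
datum `f ∈ L²` at time `s` (which exists and is unique for elliptic `A`, `s ≥ 0`). -/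
noncomputable def propagator {n N : ℕ} (m : ℕ) (A : Coeff n N) (t s : ℝ)
    (f : Space n → Target N) : Space n → Target N :=
  if h : ∃ u : ℝ → Space n → Target N, IsEnergySolution m A s f u then h.choose t else 0

/-- The distance `d(E,F) = inf {|x - y| : x ∈ E, y ∈ F}` of two sets. -/
noncomputable def setDist {n : ℕ} (E F : Set (Space n)) : ℝ :=
  sInf (image2 dist E F)

end HigherOrderParabolic

/-! The proof is Davies' method of exponential weights. Let `ψ` be smooth and bounded, with
derivatives of order `i ≤ m` at most `(κρ)^i`. Formally, for a solution `u` and `v = e^ψ u`, half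
the time derivative of `‖v‖²` is minus the real part of the form conjugated by `e^ψ`. Conjugation
changes `∂^α v` only by lower-order terms `(κρ)^i ∇^{m-i} v` with `i ≥ 1`
(`norm_conj_wordDeriv_sub_le`), and interpolation bounds these in `L²` by a small multiple of `‖∇^m
v‖` plus a multiple of `ρ^m ‖v‖` (`exists_integral_commutatorBound_le`). The Gårding inequality
absorbs the top order (`exists_energy_dissipation_const`), so `‖e^ψ u(t)‖²` grows at most like
`e^{Kρ^{2m}(t-s)}`.

To make this rigorous without any a priori global integrability of `u(t)` itself, the solution is
mollified in space. The time-integrated equation tested with `η(x - ·)` gives a pointwise formula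
for the mollified solution (`IsMildSolution.smoothing_eq`). In it all derivatives fall on `η` and
the flux is in `L²`, so the mollified solution lies in every Sobolev space and satisfies an exact
weighted energy identity. The mollified flux is not the flux of the mollified solution, but the
difference tends to zero in `L²` of space-time, with no regularity of the coefficients. Grönwall's
inequality and Fatou's lemma then give `exists_weighted_growth_const`.

The weight is `ρ min(d(·,F), d(E,F))` smoothed at length scale `1/ρ` (`exists_distance_weight`): up
to an additive constant it is at most `0` on `F` and at least `ρ d(E,F)` on `E`. The resulting
exponent `Kρ^{2m}(t-s) - 2ρ d(E,F)` is made negative enough by the choice of `ρ` in `exists_slope`;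
this produces the power `2m/(2m-1)`. -/

namespace HigherOrderParabolic

/-! ### Iterated partial derivatives along words, and their comparison with multi-indices -/

section Words

variable {n : ℕ} {V W : Type*} [NormedAddCommGroup V] [NormedSpace ℝ V]
  [NormedAddCommGroup W] [NormedSpace ℝ W]

/-- The iterated partial derivative along a word of coordinate directions. -/
noncomputable def wordDeriv (w : List (Fin n)) (g : Space n → V) : Space n → V :=
  w.foldr partialDeriv g

@[simp] theorem wordDeriv_nil (g : Space n → V) : wordDeriv [] g = g := rfl

@[simp] theorem wordDeriv_cons (k : Fin n) (w : List (Fin n)) (g : Space n → V) :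
    wordDeriv (k :: w) g = partialDeriv k (wordDeriv w g) := rfl

theorem wordDeriv_append (v w : List (Fin n)) (g : Space n → V) :
    wordDeriv (v ++ w) g = wordDeriv v (wordDeriv w g) := by
  simp [wordDeriv]

theorem contDiff_partialDeriv {g : Space n → V} (hg : ContDiff ℝ ∞ g) (k : Fin n) :
    ContDiff ℝ ∞ (partialDeriv k g) :=
  (hg.fderiv_right (m := ∞) (by simp)).clm_apply contDiff_const

theorem contDiff_wordDeriv {g : Space n → V} (hg : ContDiff ℝ ∞ g) (w : List (Fin n)) :
    ContDiff ℝ ∞ (wordDeriv w g) := by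
  induction w with
  | nil => exact hg
  | cons k w ih => exact contDiff_partialDeriv ih k

theorem partialDeriv_comm {g : Space n → V} (hg : ContDiff ℝ ∞ g) (k l : Fin n) :
    partialDeriv k (partialDeriv l g) = partialDeriv l (partialDeriv k g) := by
  funext x
  have hd : DifferentiableAt ℝ (fderiv ℝ g) x :=
    ((hg.fderiv_right (m := ∞) (by simp)).differentiable (by simp)) x
  have hsym : IsSymmSndFDerivAt ℝ g x :=
    (hg.contDiffAt).isSymmSndFDerivAt
      (by simpa using WithTop.coe_le_coe.2 (le_top : (2 : ℕ∞) ≤ ⊤))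
  have key : ∀ a b : Fin n, partialDeriv a (partialDeriv b g) x =
      fderiv ℝ (fderiv ℝ g) x (EuclideanSpace.single a 1) (EuclideanSpace.single b 1) := by
    intro a b
    change fderiv ℝ (fun y => fderiv ℝ g y (EuclideanSpace.single b 1)) x _ = _
    rw [fderiv_clm_apply hd (differentiableAt_const _)]
    simp
  rw [key, key, hsym.eq]

theorem wordDeriv_perm {g : Space n → V} (hg : ContDiff ℝ ∞ g) {v w : List (Fin n)}
    (h : v.Perm w) : wordDeriv v g = wordDeriv w g := by
  induction h with
  | nil => rfl
  | cons k _ ih => simp [ih]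
  | swap k l u => exact partialDeriv_comm (contDiff_wordDeriv hg u) _ _
  | trans _ _ ih₁ ih₂ => exact ih₁.trans ih₂

/-- The nondecreasing word with the letter counts prescribed by a multi-index. -/
def indexWord (α : MultiIndex n) : List (Fin n) :=
  (List.finRange n).flatMap fun k => List.replicate (α k) k

theorem multiDeriv_eq_wordDeriv (α : MultiIndex n) (g : Space n → V) :
    multiDeriv α g = wordDeriv (indexWord α) g := by
  unfold multiDeriv indexWord
  induction List.finRange n with
  | nil => rfl
  | cons k l ih =>
    rw [List.foldr_cons, ih, List.flatMap_cons, wordDeriv_append]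
    generalize wordDeriv _ g = G
    induction α k with
    | zero => rfl
    | succ j ih => rw [Function.iterate_succ_apply', ih, List.replicate_succ, wordDeriv_cons]

theorem length_indexWord (α : MultiIndex n) : (indexWord α).length = α.length := by
  simp [indexWord, List.length_flatMap, MultiIndex.length, List.sum_ofFn, ← List.ofFn_eq_map]

theorem count_indexWord (α : MultiIndex n) (k : Fin n) : (indexWord α).count k = α k := by
  simp only [indexWord, List.count_flatMap, List.count_replicate, Function.comp_def,
    ← List.ofFn_eq_map, List.sum_ofFn]
  simp

/-- Mixed partial derivatives commute, so only the letter counts matter. Inductions are run on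
words, one letter at a time, and their results transferred to multi-indices by this identity. -/
theorem wordDeriv_eq_multiDeriv {g : Space n → V} (hg : ContDiff ℝ ∞ g) (w : List (Fin n)) :
    wordDeriv w g = multiDeriv (fun k => w.count k) g := by
  rw [multiDeriv_eq_wordDeriv]
  exact wordDeriv_perm hg (List.perm_iff_count.2 fun k => by rw [count_indexWord])

theorem count_mem_multiIndices (w : List (Fin n)) :
    (fun k => w.count k) ∈ multiIndices n w.length := by
  rw [mem_multiIndices, MultiIndex.length]
  have := List.sum_toFinset_count_eq_length w
  rw [← this]
  symm
  apply Finset.sum_subset (Finset.subset_univ _)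
  intro k _ hk
  simpa [List.count_eq_zero] using hk

theorem partialDeriv_comp_clm {g : Space n → V} (hg : ContDiff ℝ ∞ g) (T : V →L[ℝ] W)
    (k : Fin n) : partialDeriv k (fun x => T (g x)) = fun x => T (partialDeriv k g x) := by
  funext x
  have := (T.hasFDerivAt (x := g x)).comp x ((hg.differentiable (by simp)) x).hasFDerivAt
  change fderiv ℝ (T ∘ g) x _ = _
  rw [this.fderiv]
  rfl

theorem wordDeriv_comp_clm {g : Space n → V} (hg : ContDiff ℝ ∞ g) (T : V →L[ℝ] W)
    (w : List (Fin n)) : wordDeriv w (fun x => T (g x)) = fun x => T (wordDeriv w g x) := by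
  induction w with
  | nil => rfl
  | cons k w ih =>
    rw [wordDeriv_cons, ih, partialDeriv_comp_clm (contDiff_wordDeriv hg w)]
    rfl

theorem wordDeriv_sub {f g : Space n → V} (hf : ContDiff ℝ ∞ f) (hg : ContDiff ℝ ∞ g)
    (w : List (Fin n)) :
    wordDeriv w (fun x => f x - g x) = fun x => wordDeriv w f x - wordDeriv w g x := by
  induction w with
  | nil => rfl
  | cons k w ih =>
    rw [wordDeriv_cons, ih]
    funext x
    simp only [wordDeriv_cons, partialDeriv]
    rw [fderiv_fun_sub ((contDiff_wordDeriv hf w).differentiable (by simp) x)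
      ((contDiff_wordDeriv hg w).differentiable (by simp) x)]
    rfl

/-- Differentiation commutes with affine changes of variables `y ↦ a + r • y`. -/
theorem wordDeriv_comp_affine {g : Space n → V} (hg : ContDiff ℝ ∞ g) (a : Space n) (r : ℝ)
    (w : List (Fin n)) :
    wordDeriv w (fun y => g (a + r • y)) = fun y => r ^ w.length • wordDeriv w g (a + r • y) := by
  induction w with
  | nil => simp
  | cons k w ih =>
    rw [wordDeriv_cons, ih]
    funext y
    have h1 : HasFDerivAt (fun y : Space n => a + r • y) (r • ContinuousLinearMap.id ℝ (Space n)) y :=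
      ((hasFDerivAt_id y).const_smul r).const_add a
    have h2 := (((contDiff_wordDeriv hg w).differentiable (by simp) (a + r • y)).hasFDerivAt.comp y
      h1).const_smul (r ^ w.length)
    simp only [partialDeriv, wordDeriv_cons]
    change fderiv ℝ (r ^ w.length • (wordDeriv w g ∘ fun y => a + r • y)) y _ = _
    rw [h2.fderiv]
    simp [pow_succ, smul_smul]

theorem norm_iteratedFDeriv_partialDeriv_le {g : Space n → V} (hg : ContDiff ℝ ∞ g) (k : Fin n)
    (j : ℕ) (x : Space n) :
    ‖iteratedFDeriv ℝ j (partialDeriv k g) x‖ ≤ ‖iteratedFDeriv ℝ (j + 1) g x‖ := by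
  let T : (Space n →L[ℝ] V) →L[ℝ] V :=
    ContinuousLinearMap.apply ℝ V (EuclideanSpace.single k (1 : ℝ))
  have hT : ‖T‖ ≤ 1 := ContinuousLinearMap.opNorm_le_bound _ zero_le_one fun f => by
    have := f.le_opNorm (EuclideanSpace.single k (1 : ℝ))
    simpa [T] using this
  have h := T.norm_iteratedFDeriv_comp_left (n := j) (N := ∞) (x := x)
    (hg.fderiv_right (m := ∞) (by simp)).contDiffAt (by exact_mod_cast le_top)
  rw [norm_iteratedFDeriv_fderiv] at h
  exact h.trans (mul_le_of_le_one_left (norm_nonneg _) hT)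

theorem norm_iteratedFDeriv_wordDeriv_le {g : Space n → V} (hg : ContDiff ℝ ∞ g)
    (w : List (Fin n)) (j : ℕ) (x : Space n) :
    ‖iteratedFDeriv ℝ j (wordDeriv w g) x‖ ≤ ‖iteratedFDeriv ℝ (j + w.length) g x‖ := by
  induction w generalizing j with
  | nil => simp
  | cons k w ih =>
    refine (norm_iteratedFDeriv_partialDeriv_le (contDiff_wordDeriv hg w) k j x).trans ?_
    refine (ih (j + 1)).trans (le_of_eq ?_)
    rw [List.length_cons, show j + 1 + w.length = j + (w.length + 1) by ring]

theorem norm_wordDeriv_le {g : Space n → V} (hg : ContDiff ℝ ∞ g)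
    (w : List (Fin n)) (x : Space n) :
    ‖wordDeriv w g x‖ ≤ ‖iteratedFDeriv ℝ w.length g x‖ := by
  have := norm_iteratedFDeriv_wordDeriv_le hg w 0 x
  rwa [zero_add, norm_iteratedFDeriv_zero] at this

theorem fderiv_eq_sum_partialDeriv (g : Space n → V) (x : Space n) :
    fderiv ℝ g x = ∑ k, (EuclideanSpace.proj k : Space n →L[ℝ] ℝ).smulRight (partialDeriv k g x) := by
  ext v
  conv_lhs => rw [← (EuclideanSpace.basisFun (Fin n) ℝ).sum_repr v]
  simp [partialDeriv]

/-- The Fréchet derivative is the sum over `k` of the `k`-th coordinate functional tensored with `∂ₖ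
g`, and each of these tensoring maps has norm at most one. -/
theorem norm_iteratedFDeriv_succ_le {g : Space n → V} (hg : ContDiff ℝ ∞ g) (j : ℕ)
    (x : Space n) :
    ‖iteratedFDeriv ℝ (j + 1) g x‖ ≤ ∑ k, ‖iteratedFDeriv ℝ j (partialDeriv k g) x‖ := by
  rw [← norm_iteratedFDeriv_fderiv]
  let T : Fin n → V →L[ℝ] (Space n →L[ℝ] V) := fun k =>
    ContinuousLinearMap.smulRightL ℝ (Space n) V (EuclideanSpace.proj k : Space n →L[ℝ] ℝ)
  have hT : ∀ k, ‖T k‖ ≤ 1 := fun k =>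
    ContinuousLinearMap.opNorm_le_bound _ zero_le_one fun v => by
      refine ContinuousLinearMap.opNorm_le_bound _ (by positivity) fun y => ?_
      simp only [T, ContinuousLinearMap.smulRightL_apply_apply, ContinuousLinearMap.smulRight_apply,
        norm_smul, one_mul]
      rw [mul_comm]
      gcongr
      exact PiLp.norm_apply_le y k
  have hs : fderiv ℝ g = fun x => ∑ k, (T k ∘ partialDeriv k g) x := by
    funext x
    exact fderiv_eq_sum_partialDeriv g x
  rw [hs, iteratedFDeriv_fun_sum_apply fun k _ =>
    ((T k).contDiff.comp ((contDiff_partialDeriv hg k).of_le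
      (by exact_mod_cast le_top))).contDiffAt]
  refine (norm_sum_le _ _).trans (Finset.sum_le_sum fun k _ => ?_)
  refine ((T k).norm_iteratedFDeriv_comp_left (N := ∞) (contDiff_partialDeriv hg k).contDiffAt
    (by exact_mod_cast le_top)).trans ?_
  exact mul_le_of_le_one_left (norm_nonneg _) (hT k)

/-- The sum of the squares of all partial derivatives of order `j`, over words of length `j`. -/
noncomputable def derivSq : ℕ → (Space n → V) → Space n → ℝ
  | 0, g => fun x => ‖g x‖ ^ 2
  | j + 1, g => fun x => ∑ k, derivSq j (partialDeriv k g) x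

theorem derivSq_nonneg (j : ℕ) (g : Space n → V) (x : Space n) : 0 ≤ derivSq j g x := by
  induction j generalizing g with
  | zero => exact sq_nonneg _
  | succ j ih => exact Finset.sum_nonneg fun k _ => ih _

theorem sq_norm_iteratedFDeriv_le_derivSq {g : Space n → V} (hg : ContDiff ℝ ∞ g) (j : ℕ)
    (x : Space n) : ‖iteratedFDeriv ℝ j g x‖ ^ 2 ≤ (n : ℝ) ^ j * derivSq j g x := by
  induction j generalizing g with
  | zero => simp [derivSq]
  | succ j ih =>
    calc ‖iteratedFDeriv ℝ (j + 1) g x‖ ^ 2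
        ≤ (∑ k, ‖iteratedFDeriv ℝ j (partialDeriv k g) x‖) ^ 2 := by
          gcongr; exact norm_iteratedFDeriv_succ_le hg j x
      _ ≤ n * ∑ k, ‖iteratedFDeriv ℝ j (partialDeriv k g) x‖ ^ 2 := by
          simpa using sq_sum_le_card_mul_sum_sq (s := (Finset.univ : Finset (Fin n)))
            (f := fun k => ‖iteratedFDeriv ℝ j (partialDeriv k g) x‖)
      _ ≤ n * ∑ k, (n : ℝ) ^ j * derivSq j (partialDeriv k g) x := by
          gcongr with k
          exact ih (contDiff_partialDeriv hg k)
      _ = (n : ℝ) ^ (j + 1) * derivSq (j + 1) g x := by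
          rw [derivSq, ← Finset.mul_sum, pow_succ]; ring

theorem derivSq_le_sq_norm_iteratedFDeriv {g : Space n → V} (hg : ContDiff ℝ ∞ g) (j : ℕ)
    (x : Space n) : derivSq j g x ≤ (n : ℝ) ^ j * ‖iteratedFDeriv ℝ j g x‖ ^ 2 := by
  induction j generalizing g with
  | zero => simp [derivSq]
  | succ j ih =>
    calc derivSq (j + 1) g x
        ≤ ∑ k : Fin n, (n : ℝ) ^ j * ‖iteratedFDeriv ℝ (j + 1) g x‖ ^ 2 := by
          refine Finset.sum_le_sum fun k _ => ?_
          refine (ih (contDiff_partialDeriv hg k)).trans ?_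
          gcongr
          exact norm_iteratedFDeriv_partialDeriv_le hg k j x
      _ = (n : ℝ) ^ (j + 1) * ‖iteratedFDeriv ℝ (j + 1) g x‖ ^ 2 := by
          simp [pow_succ]; ring

/-- There are `n ^ j` ways to prolong `w` by `j` letters. Each resulting word has length `m`, hence
is one term of the multi-index sum. -/
theorem derivSq_wordDeriv_le {g : Space n → V} (hg : ContDiff ℝ ∞ g) {m : ℕ} (x : Space n)
    (j : ℕ) (w : List (Fin n)) (hw : j + w.length = m) :
    derivSq j (wordDeriv w g) x ≤ (n : ℝ) ^ j * ∑ α ∈ multiIndices n m, ‖multiDeriv α g x‖ ^ 2 := by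
  induction j generalizing w with
  | zero =>
    rw [pow_zero, one_mul, derivSq, wordDeriv_eq_multiDeriv hg w]
    refine Finset.single_le_sum (f := fun α => ‖multiDeriv α g x‖ ^ 2)
      (fun _ _ => sq_nonneg _) ?_
    rw [← hw, zero_add]
    exact count_mem_multiIndices w
  | succ j ih =>
    calc derivSq (j + 1) (wordDeriv w g) x
        ≤ ∑ k : Fin n, (n : ℝ) ^ j * ∑ α ∈ multiIndices n m, ‖multiDeriv α g x‖ ^ 2 := by
          refine Finset.sum_le_sum fun k _ => ?_
          exact ih (k :: w) (by simp; omega)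
      _ = _ := by simp [pow_succ]; ring

theorem contDiff_multiDeriv {g : Space n → V} (hg : ContDiff ℝ ∞ g) (α : MultiIndex n) :
    ContDiff ℝ ∞ (multiDeriv α g) := by
  rw [multiDeriv_eq_wordDeriv]; exact contDiff_wordDeriv hg _

theorem hasCompactSupport_partialDeriv {g : Space n → V} (hg : HasCompactSupport g) (k : Fin n) :
    HasCompactSupport (partialDeriv k g) :=
  (hg.fderiv ℝ).comp_left (g := fun T : Space n →L[ℝ] V => T (EuclideanSpace.single k 1)) rfl

theorem hasCompactSupport_wordDeriv {g : Space n → V} (hg : HasCompactSupport g)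
    (w : List (Fin n)) : HasCompactSupport (wordDeriv w g) := by
  induction w with
  | nil => exact hg
  | cons k w ih => exact hasCompactSupport_partialDeriv ih k

theorem hasCompactSupport_multiDeriv {g : Space n → V} (hg : HasCompactSupport g)
    (α : MultiIndex n) : HasCompactSupport (multiDeriv α g) := by
  rw [multiDeriv_eq_wordDeriv]; exact hasCompactSupport_wordDeriv hg _

end Words
-- Smooth functions with square integrable derivatives; integration by parts
section Sobolev

variable {n : ℕ} {V W X : Type*} [NormedAddCommGroup V] [NormedSpace ℝ V]
  [NormedAddCommGroup W] [NormedSpace ℝ W] [NormedAddCommGroup X] [NormedSpace ℝ X]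

/-- Smooth functions all of whose derivatives are square integrable. -/
structure IsSobolev (g : Space n → V) : Prop where
  smooth : ContDiff ℝ ∞ g
  memLp : ∀ j : ℕ, MemLp (fun x => iteratedFDeriv ℝ j g x) 2 volume

theorem continuous_iteratedFDeriv_of_smooth {g : Space n → V} (hg : ContDiff ℝ ∞ g) (j : ℕ) :
    Continuous fun x => iteratedFDeriv ℝ j g x :=
  hg.continuous_iteratedFDeriv (by exact_mod_cast le_top)

theorem IsSobolev.memLp_wordDeriv {g : Space n → V} (hg : IsSobolev g) (w : List (Fin n)) :
    MemLp (wordDeriv w g) 2 volume :=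
  (hg.memLp w.length).norm.mono' (contDiff_wordDeriv hg.smooth w).continuous.aestronglyMeasurable
    (Eventually.of_forall fun x => norm_wordDeriv_le hg.smooth w x)

theorem IsSobolev.memLp_two {g : Space n → V} (hg : IsSobolev g) : MemLp g 2 volume :=
  hg.memLp_wordDeriv []

theorem IsSobolev.partialDeriv {g : Space n → V} (hg : IsSobolev g) (k : Fin n) :
    IsSobolev (partialDeriv k g) where
  smooth := contDiff_partialDeriv hg.smooth k
  memLp j := (hg.memLp (j + 1)).norm.mono'
    (continuous_iteratedFDeriv_of_smooth (contDiff_partialDeriv hg.smooth k) j).aestronglyMeasurable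
    (Eventually.of_forall fun x => norm_iteratedFDeriv_partialDeriv_le hg.smooth k j x)

theorem IsSobolev.wordDeriv {g : Space n → V} (hg : IsSobolev g) (w : List (Fin n)) :
    IsSobolev (wordDeriv w g) := by
  induction w with
  | nil => exact hg
  | cons k w ih => exact ih.partialDeriv k

theorem IsSobolev.multiDeriv {g : Space n → V} (hg : IsSobolev g) (α : MultiIndex n) :
    IsSobolev (multiDeriv α g) := by
  rw [multiDeriv_eq_wordDeriv]; exact hg.wordDeriv _

theorem isSobolev_of_wordDeriv {g : Space n → V} (hg : ContDiff ℝ ∞ g)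
    (h : ∀ w : List (Fin n), MemLp (wordDeriv w g) 2 volume) : IsSobolev g where
  smooth := hg
  memLp := by
    have key : ∀ (j : ℕ) (w : List (Fin n)),
        MemLp (fun x => iteratedFDeriv ℝ j (HigherOrderParabolic.wordDeriv w g) x) 2 volume := by
      intro j
      induction j with
      | zero =>
        intro w
        refine (h w).norm.mono' (continuous_iteratedFDeriv_of_smooth
          (contDiff_wordDeriv hg w) 0).aestronglyMeasurable (Eventually.of_forall fun x => ?_)
        rw [norm_iteratedFDeriv_zero]
      | succ j ih =>
        intro w
        have hs := memLp_finsetSum (Finset.univ : Finset (Fin n)) fun k _ => (ih (k :: w)).norm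
        exact hs.mono' (continuous_iteratedFDeriv_of_smooth
          (contDiff_wordDeriv hg w) _).aestronglyMeasurable
          (Eventually.of_forall fun x => norm_iteratedFDeriv_succ_le (contDiff_wordDeriv hg w) j x)
    exact fun j => key j []

theorem isSobolev_of_hasCompactSupport {g : Space n → V} (hg : ContDiff ℝ ∞ g)
    (hs : HasCompactSupport g) : IsSobolev g where
  smooth := hg
  memLp j := (continuous_iteratedFDeriv_of_smooth hg j).memLp_of_hasCompactSupport
    (hs.iteratedFDeriv j)

theorem integrable_bilin {B : V →L[ℝ] W →L[ℝ] X} {α : Type*} [MeasurableSpace α] {μ : Measure α}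
    {f : α → V} {g : α → W} (hf : MemLp f 2 μ) (hg : MemLp g 2 μ) :
    Integrable (fun x => B (f x) (g x)) μ := by
  have h : Integrable (fun x => ‖B‖ * (‖f x‖ * ‖g x‖)) μ :=
    (MemLp.integrable_mul hf.norm hg.norm).const_mul _
  refine h.mono' (B.aestronglyMeasurable_comp₂ hf.1 hg.1) (Eventually.of_forall fun x => ?_)
  refine (B.le_opNorm₂ _ _).trans (le_of_eq (by ring))

/-- Products of two `L²` factors are integrable, so no boundary terms arise. A general bilinear `B`
covers both the real inner product of the energy method and the scalar multiplication of the weak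
derivative. -/
theorem integral_bilin_partialDeriv (B : V →L[ℝ] W →L[ℝ] X) {f : Space n → V} {g : Space n → W}
    (hf : IsSobolev f) (hg : IsSobolev g) (k : Fin n) :
    ∫ x, B (f x) (partialDeriv k g x) = - ∫ x, B (partialDeriv k f x) (g x) :=
  integral_bilinear_fderiv_right_eq_neg_left_of_integrable
    (integrable_bilin (hf.partialDeriv k).memLp_two hg.memLp_two)
    (integrable_bilin hf.memLp_two (hg.partialDeriv k).memLp_two)
    (integrable_bilin hf.memLp_two hg.memLp_two)
    (fun x _ => hf.smooth.differentiable (by simp) x)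
    (fun x _ => hg.smooth.differentiable (by simp) x)

theorem integral_bilin_wordDeriv (B : V →L[ℝ] W →L[ℝ] X) {f : Space n → V} {g : Space n → W}
    (hf : IsSobolev f) (hg : IsSobolev g) (w : List (Fin n)) :
    ∫ x, B (f x) (wordDeriv w g x) = (-1 : ℝ) ^ w.length • ∫ x, B (wordDeriv w f x) (g x) := by
  induction w generalizing f with
  | nil => simp
  | cons k w ih =>
    rw [wordDeriv_cons, integral_bilin_partialDeriv B hf (hg.wordDeriv w) k,
      ih (hf.partialDeriv k), ← wordDeriv_perm hf.smooth (List.perm_append_singleton k w),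
      wordDeriv_append, List.length_cons, pow_succ]
    simp

theorem integral_bilin_multiDeriv (B : V →L[ℝ] W →L[ℝ] X) {f : Space n → V} {g : Space n → W}
    (hf : IsSobolev f) (hg : IsSobolev g) (α : MultiIndex n) :
    ∫ x, B (f x) (multiDeriv α g x) = (-1 : ℝ) ^ α.length • ∫ x, B (multiDeriv α f x) (g x) := by
  rw [multiDeriv_eq_wordDeriv, multiDeriv_eq_wordDeriv, ← length_indexWord]
  exact integral_bilin_wordDeriv B hf hg _

theorem IsSobolev.isWeakDeriv {N : ℕ} {g : Space n → Target N} (hg : IsSobolev g)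
    (α : MultiIndex n) : IsWeakDeriv α g (HigherOrderParabolic.multiDeriv α g) := by
  refine ⟨hg.smooth.continuous.locallyIntegrable,
    (hg.multiDeriv α).smooth.continuous.locallyIntegrable, fun φ hφ hc => ?_⟩
  have h := integral_bilin_multiDeriv (ContinuousLinearMap.lsmul ℝ ℝ : ℝ →L[ℝ] Target N →L[ℝ] _)
    (isSobolev_of_hasCompactSupport hφ hc) hg α
  simp only [ContinuousLinearMap.lsmul_apply] at h
  rw [h, smul_smul, ← mul_pow]
  simp

theorem continuous_derivSq {g : Space n → V} (hg : ContDiff ℝ ∞ g) (j : ℕ) :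
    Continuous (derivSq j g) := by
  induction j generalizing g with
  | zero => exact (hg.continuous.norm.pow 2)
  | succ j ih => exact continuous_finsetSum _ fun k _ => ih (contDiff_partialDeriv hg k)

theorem IsSobolev.integrable_sq_norm_iteratedFDeriv {g : Space n → V} (hg : IsSobolev g) (j : ℕ) :
    Integrable fun x => ‖iteratedFDeriv ℝ j g x‖ ^ 2 :=
  (hg.memLp j).integrable_norm_pow two_ne_zero

theorem IsSobolev.integrable_derivSq {g : Space n → V} (hg : IsSobolev g) (j : ℕ) :
    Integrable (derivSq j g) := by
  refine ((hg.integrable_sq_norm_iteratedFDeriv j).const_mul ((n : ℝ) ^ j)).mono'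
    (continuous_derivSq hg.smooth j).aestronglyMeasurable (Eventually.of_forall fun x => ?_)
  rw [Real.norm_of_nonneg (derivSq_nonneg j g x)]
  exact derivSq_le_sq_norm_iteratedFDeriv hg.smooth j x

/-- The squared `L²` norm of all partial derivatives of order `j`. -/
noncomputable def derivEnergy (j : ℕ) (g : Space n → V) : ℝ := ∫ x, derivSq j g x

theorem derivEnergy_zero (g : Space n → V) : derivEnergy 0 g = ∫ x, ‖g x‖ ^ 2 := rfl

theorem derivEnergy_succ {g : Space n → V} (hg : IsSobolev g) (j : ℕ) :
    derivEnergy (j + 1) g = ∑ k, derivEnergy j (partialDeriv k g) :=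
  integral_finsetSum _ fun k _ => (hg.partialDeriv k).integrable_derivSq j

theorem derivEnergy_nonneg (g : Space n → V) (j : ℕ) : 0 ≤ derivEnergy j g :=
  integral_nonneg fun x => derivSq_nonneg j g x

end Sobolev

/-! ### Interpolation of intermediate derivatives -/

section Interpolation

variable {n : ℕ} {V : Type*} [NormedAddCommGroup V] [InnerProductSpace ℝ V]

/-- Integration by parts gives `‖∂ₖg‖² = -⟨g, ∂ₖ²g⟩`, and Young's inequality splits the product. -/
theorem integral_sq_partialDeriv_le {g : Space n → V} (hg : IsSobolev g) (k : Fin n) {η : ℝ}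
    (hη : 0 < η) :
    ∫ x, ‖partialDeriv k g x‖ ^ 2 ≤
      η * (∫ x, ‖partialDeriv k (partialDeriv k g) x‖ ^ 2) + 1 / (4 * η) * ∫ x, ‖g x‖ ^ 2 := by
  have hk := hg.partialDeriv k
  have hkk := hk.partialDeriv k
  have h := integral_bilin_partialDeriv (innerSL ℝ : V →L[ℝ] V →L[ℝ] ℝ) hg hk k
  have e1 : ∫ x, ‖partialDeriv k g x‖ ^ 2
      = -∫ x, inner ℝ (g x) (partialDeriv k (partialDeriv k g) x) := by
    have h' : ∫ x, inner ℝ (g x) (partialDeriv k (partialDeriv k g) x) =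
        -∫ x, inner ℝ (partialDeriv k g x) (partialDeriv k g x) := h
    rw [h', neg_neg]
    simp only [real_inner_self_eq_norm_sq]
  rw [e1, ← integral_neg, ← integral_const_mul, ← integral_const_mul, ← integral_add]
  · refine integral_mono (integrable_bilin (B := innerSL ℝ) hg.memLp_two hkk.memLp_two).neg ?_ ?_
    · exact ((hkk.memLp_two.integrable_norm_pow two_ne_zero).const_mul _).add
        ((hg.memLp_two.integrable_norm_pow two_ne_zero).const_mul _)
    · intro x
      have hc := abs_real_inner_le_norm (g x) (partialDeriv k (partialDeriv k g) x)
      have h1 : -inner ℝ (g x) (partialDeriv k (partialDeriv k g) x) ≤ ‖g x‖ *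
        ‖partialDeriv k (partialDeriv k g) x‖ := (neg_le_abs _).trans hc
      refine h1.trans ?_
      set a := ‖g x‖
      set b := ‖partialDeriv k (partialDeriv k g) x‖
      have : 0 ≤ (2 * η * b - a) ^ 2 / (4 * η) := by positivity
      have e : (2 * η * b - a) ^ 2 / (4 * η) = η * b ^ 2 + 1 / (4 * η) * a ^ 2 - a * b := by
        field_simp; ring
      linarith
  · exact (hkk.memLp_two.integrable_norm_pow two_ne_zero).const_mul _
  · exact (hg.memLp_two.integrable_norm_pow two_ne_zero).const_mul _

theorem derivEnergy_succ_le {g : Space n → V} (hg : IsSobolev g) (j : ℕ) {η : ℝ}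
    (hη : 0 < η) :
    derivEnergy (j + 1) g ≤
      η * derivEnergy (j + 2) g + n / (4 * η) * derivEnergy j g := by
  induction j generalizing g with
  | zero =>
    rw [derivEnergy_succ hg 0]
    calc ∑ k, derivEnergy 0 (partialDeriv k g)
        ≤ ∑ k : Fin n, (η * derivEnergy 1 (partialDeriv k g)
            + 1 / (4 * η) * ∫ x, ‖g x‖ ^ 2) := by
          refine Finset.sum_le_sum fun k _ => ?_
          refine (integral_sq_partialDeriv_le hg k hη).trans ?_
          gcongr
          rw [derivEnergy_succ (hg.partialDeriv k) 0]
          exact Finset.single_le_sum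
            (f := fun l => derivEnergy 0 (partialDeriv l (partialDeriv k g)))
            (fun l _ => derivEnergy_nonneg _ _) (Finset.mem_univ k)
      _ = _ := by
          rw [derivEnergy_succ hg 1, Finset.sum_add_distrib, ← Finset.mul_sum]
          simp [derivEnergy_zero]; ring
  | succ j ih =>
    rw [derivEnergy_succ hg (j + 1), derivEnergy_succ hg (j + 2),
      derivEnergy_succ hg j, Finset.mul_sum, Finset.mul_sum, ← Finset.sum_add_distrib]
    exact Finset.sum_le_sum fun k _ => ih (hg.partialDeriv k)

/-- Intermediate terms of a sequence satisfying quadratic interpolation inequalities. -/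
theorem exists_interpolation_const (K : ℝ) (hK : 0 < K) (m : ℕ) :
    ∀ δ : ℝ, 0 < δ → ∃ C : ℝ, 0 ≤ C ∧ ∀ a : ℕ → ℝ, (∀ j, 0 ≤ a j) →
      (∀ (j : ℕ) (η : ℝ), 0 < η → a (j + 1) ≤ η * a (j + 2) + K / η * a j) →
      ∀ j < m, a j ≤ δ * a m + C * a 0 := by
  induction m with
  | zero => exact fun δ _ => ⟨0, le_rfl, fun a _ _ j hj => absurd hj (by omega)⟩
  | succ m ih =>
    intro δ hδ
    rcases Nat.eq_zero_or_pos m with rfl | hm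
    · refine ⟨1, zero_le_one, fun a ha _ j hj => ?_⟩
      obtain rfl : j = 0 := by omega
      nlinarith [mul_nonneg hδ.le (ha (0 + 1))]
    obtain ⟨C₁, hC₁, h₁⟩ := ih 1 one_pos
    -- The hypothesis will be used with `η = δ / 2`, so `a (m - 1)` enters with factor `2K/δ`. This
    -- parameter turns the resulting coefficient of `a m` into `1/2`, which is absorbed on the left.
    obtain ⟨C₂, hC₂, h₂⟩ := ih (δ / (4 * K)) (by positivity)
    refine ⟨C₁ + 4 * K / δ * C₂, by positivity, fun a ha hint j hj => ?_⟩
    have hlast : a m ≤ δ * a (m + 1) + 4 * K / δ * C₂ * a 0 := by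
      have e1 := hint (m - 1) (δ / 2) (by positivity)
      rw [show m - 1 + 1 = m by omega, show m - 1 + 2 = m + 1 by omega] at e1
      have e2 := h₂ a ha hint (m - 1) (by omega)
      have e3 : K / (δ / 2) * a (m - 1) ≤ K / (δ / 2) * (δ / (4 * K) * a m + C₂ * a 0) := by
        gcongr
      have e4 : K / (δ / 2) * (δ / (4 * K) * a m + C₂ * a 0)
          = a m / 2 + 2 * K / δ * C₂ * a 0 := by
        field_simp; ring
      have e5 : 4 * K / δ * C₂ * a 0 = 2 * (2 * K / δ * C₂ * a 0) := by ring
      linarith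
    have h0 := mul_nonneg hC₁ (ha 0)
    have h0' : 0 ≤ 4 * K / δ * C₂ * a 0 := mul_nonneg (by positivity) (ha 0)
    rw [add_mul]
    rcases Nat.lt_succ_iff_lt_or_eq.1 hj with hj | rfl
    · have := h₁ a ha hint j hj
      linarith
    · linarith

/-- The rescaled energies `ρ^{-2j} E_j` satisfy the same quadratic inequalities with the constant
`n/4`, upon replacing `η` by `η/ρ²`. Hence `C` does not depend on `ρ`. -/
theorem exists_derivSq_interpolation (hn : 1 ≤ n) (m : ℕ) {δ : ℝ} (hδ : 0 < δ) :
    ∃ C : ℝ, 0 ≤ C ∧ ∀ (ρ : ℝ), 0 < ρ → ∀ g : Space n → V, IsSobolev g → ∀ j < m,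
      ρ ^ (2 * (m - j)) * derivEnergy j g ≤
        δ * derivEnergy m g + C * ρ ^ (2 * m) * derivEnergy 0 g := by
  obtain ⟨C, hC, h⟩ := exists_interpolation_const (n / 4) (by positivity) m δ hδ
  refine ⟨C, hC, fun ρ hρ g hg j hj => ?_⟩
  have key := h (fun j => (ρ ^ (2 * j))⁻¹ * derivEnergy j g)
    (fun j => mul_nonneg (by positivity) (derivEnergy_nonneg g j)) ?_ j hj
  · have := mul_le_mul_of_nonneg_left key (show 0 ≤ ρ ^ (2 * m) by positivity)
    have e : ρ ^ (2 * m) = ρ ^ (2 * (m - j)) * ρ ^ (2 * j) := by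
      rw [← pow_add]; congr 1; omega
    have e1 : ρ ^ (2 * m) * ((ρ ^ (2 * j))⁻¹ * derivEnergy j g)
        = ρ ^ (2 * (m - j)) * derivEnergy j g := by
      rw [e]; field_simp
    rw [e1] at this
    refine this.trans (le_of_eq ?_)
    simp only [mul_zero, pow_zero]
    field_simp
  · intro j η hη
    have := derivEnergy_succ_le hg j (η := η / ρ ^ 2) (by positivity)
    have := mul_le_mul_of_nonneg_left this (show 0 ≤ (ρ ^ (2 * (j + 1)))⁻¹ by positivity)
    refine this.trans (le_of_eq ?_)
    field_simp
    ring

end Interpolation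
-- Exponential weights and their commutators with derivatives
section Weights

variable {n : ℕ} {V : Type*} [NormedAddCommGroup V] [NormedSpace ℝ V]

/-- Smooth real functions which are bounded together with each of their derivatives. -/
structure IsBoundedSmooth (b : Space n → ℝ) : Prop where
  smooth : ContDiff ℝ ∞ b
  bounded : ∀ j : ℕ, ∃ C : ℝ, ∀ x, ‖iteratedFDeriv ℝ j b x‖ ≤ C

theorem norm_iteratedFDeriv_exp (i : ℕ) (s : ℝ) : ‖iteratedFDeriv ℝ i Real.exp s‖ = Real.exp s := by
  rw [norm_iteratedFDeriv_eq_norm_iteratedDeriv, iteratedDeriv_eq_iterate, Real.iter_deriv_exp,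
    Real.norm_of_nonneg (Real.exp_nonneg s)]

theorem IsBoundedSmooth.const_mul {b : Space n → ℝ} (hb : IsBoundedSmooth b) (c : ℝ) :
    IsBoundedSmooth fun x => c * b x where
  smooth := contDiff_const.mul hb.smooth
  bounded j := by
    obtain ⟨C, hC⟩ := hb.bounded j
    refine ⟨|c| * C, fun x => ?_⟩
    have : (fun x => c * b x) = c • b := rfl
    rw [this, iteratedFDeriv_const_smul_apply (hb.smooth.of_le
      (by exact_mod_cast le_top)).contDiffAt, norm_smul, Real.norm_eq_abs]
    gcongr
    exact hC x

theorem IsBoundedSmooth.exp {b : Space n → ℝ} (hb : IsBoundedSmooth b) :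
    IsBoundedSmooth fun x => Real.exp (b x) where
  smooth := Real.contDiff_exp.comp hb.smooth
  bounded j := by
    choose C hC using hb.bounded
    -- The bound for derivatives of a composition asks for one number whose `i`-th power dominates
    -- the inner derivative of order `i`. Since `D ≥ 1`, a common upper bound suffices.
    set D : ℝ := 1 + ∑ i ∈ Finset.range (j + 1), |C i|
    have hD : ∀ i ≤ j, C i ≤ D := fun i hi => (le_abs_self _).trans
      ((Finset.single_le_sum (f := fun i => |C i|) (fun _ _ => abs_nonneg _)
        (Finset.mem_range.2 (Nat.lt_succ_of_le hi))).trans (by simp [D]))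
    have hD1 : 1 ≤ D := by
      have : 0 ≤ ∑ i ∈ Finset.range (j + 1), |C i| := Finset.sum_nonneg fun _ _ => abs_nonneg _
      simpa [D] using this
    refine ⟨j.factorial * Real.exp (C 0) * D ^ j, fun x => ?_⟩
    refine norm_iteratedFDeriv_comp_le (N := ∞) Real.contDiff_exp hb.smooth
      (by exact_mod_cast le_top) x (fun i _ => ?_) fun i hi hij => ?_
    · rw [norm_iteratedFDeriv_exp]
      have := hC 0 x
      rw [norm_iteratedFDeriv_zero] at this
      exact Real.exp_le_exp.2 ((le_abs_self _).trans this)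
    · exact ((hC i x).trans (hD i hij)).trans (le_self_pow₀ hD1 (by omega))

theorem IsSobolev.smul {b : Space n → ℝ} (hb : IsBoundedSmooth b) {g : Space n → V}
    (hg : IsSobolev g) : IsSobolev fun x => b x • g x where
  smooth := hb.smooth.smul hg.smooth
  memLp j := by
    choose C hC using hb.bounded
    have hs := memLp_finsetSum (Finset.range (j + 1)) fun i _ =>
      ((hg.memLp (j - i)).norm.const_mul ((j.choose i : ℝ) * C i))
    refine hs.mono' (continuous_iteratedFDeriv_of_smooth
      (hb.smooth.smul hg.smooth) j).aestronglyMeasurable (Eventually.of_forall fun x => ?_)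
    refine (norm_iteratedFDeriv_smul_le hb.smooth hg.smooth x (by exact_mod_cast le_top)).trans ?_
    refine Finset.sum_le_sum fun i _ => ?_
    gcongr
    exact hC i x

/-- The pointwise size of the commutator of derivatives of order `m` with exponential weights
whose derivatives of order `i` are at most `μ ^ i`. -/
noncomputable def commutatorBound (m : ℕ) (μ : ℝ) (v : Space n → V) (x : Space n) : ℝ :=
  ∑ i ∈ Finset.range m, (m.choose (i + 1) * (i + 1).factorial : ℝ) * μ ^ (i + 1) *
    ‖iteratedFDeriv ℝ (m - (i + 1)) v x‖

/-- With `x` frozen, the factor `e^{ψ(x)}` moves inside the derivative, and the difference is the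
derivative at `y = x` of `(e^{ψ(x)-ψ(y)} - 1) v(y)`. The scalar factor vanishes there, so Leibniz'
rule leaves only terms with at least one derivative on it. No size of `e^ψ` survives in the bound.
-/
theorem norm_conj_wordDeriv_sub_le {ψ : Space n → ℝ} (hψ : ContDiff ℝ ∞ ψ) {v : Space n → V}
    (hv : ContDiff ℝ ∞ v) {μ : ℝ} (w : List (Fin n)) (x : Space n)
    (hD : ∀ i, 1 ≤ i → i ≤ w.length → ‖iteratedFDeriv ℝ i ψ x‖ ≤ μ ^ i) :
    ‖Real.exp (ψ x) • wordDeriv w (fun y => Real.exp (-ψ y) • v y) x - wordDeriv w v x‖ ≤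
      commutatorBound w.length μ v x := by
  set b : Space n → ℝ := fun y => Real.exp (ψ x - ψ y) - 1 with hb
  have hexp : ContDiff ℝ ∞ fun s : ℝ => Real.exp (ψ x - s) :=
    Real.contDiff_exp.comp (contDiff_const.sub contDiff_id)
  have hbe : ContDiff ℝ ∞ fun y => Real.exp (ψ x - ψ y) := hexp.comp hψ
  have hbs : ContDiff ℝ ∞ b := hbe.sub contDiff_const
  have hv' : ContDiff ℝ ∞ fun y => Real.exp (-ψ y) • v y :=
    (Real.contDiff_exp.comp hψ.neg).smul hv
  have e1 : Real.exp (ψ x) • wordDeriv w (fun y => Real.exp (-ψ y) • v y) x - wordDeriv w v x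
      = wordDeriv w (fun y => b y • v y) x := by
    have h1 := congrFun (wordDeriv_comp_clm hv' (Real.exp (ψ x) • ContinuousLinearMap.id ℝ V) w) x
    have h2 := congrFun (wordDeriv_sub (f := fun y => Real.exp (ψ x - ψ y) • v y)
      (hbe.smul hv) hv w) x
    have e2 : (fun y => b y • v y) = fun y => Real.exp (ψ x - ψ y) • v y - v y := by
      funext y; simp [hb, sub_smul]
    rw [e2, h2]
    congr 1
    rw [show (fun y => Real.exp (ψ x - ψ y) • v y) = fun y =>
      (Real.exp (ψ x) • ContinuousLinearMap.id ℝ V) (Real.exp (-ψ y) • v y) by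
        funext y; simp [smul_smul, ← Real.exp_add, sub_eq_add_neg, add_comm], h1]
    rfl
  rw [e1]
  refine (norm_wordDeriv_le (hbs.smul hv) w x).trans ?_
  refine (norm_iteratedFDeriv_smul_le hbs hv x (by exact_mod_cast le_top)).trans ?_
  rw [Finset.sum_range_succ']
  have hb0 : b x = 0 := by simp [hb]
  simp only [norm_iteratedFDeriv_zero, hb0, norm_zero, mul_zero, zero_mul, add_zero]
  refine Finset.sum_le_sum fun i hi => ?_
  have hi' := Finset.mem_range.1 hi
  have hbi : ‖iteratedFDeriv ℝ (i + 1) b x‖ ≤ (i + 1).factorial * μ ^ (i + 1) := by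
    have e3 : iteratedFDeriv ℝ (i + 1) b x
        = iteratedFDeriv ℝ (i + 1) (fun y => Real.exp (ψ x - ψ y)) x := by
      change iteratedFDeriv ℝ (i + 1) ((fun y => Real.exp (ψ x - ψ y)) - fun _ => 1) x = _
      rw [iteratedFDeriv_sub_apply (hbe.of_le (by exact_mod_cast le_top)).contDiffAt
        contDiffAt_const, iteratedFDeriv_const_of_ne (by omega)]
      simp
    rw [e3]
    -- The outer function `s ↦ e^{ψ(x)-s}` has all derivatives of modulus one at `s = ψ(x)`, hence
    -- `C := 1`.
    have := norm_iteratedFDeriv_comp_le (n := i + 1) (N := ∞) (C := 1) (D := μ) hexp hψ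
      (by exact_mod_cast le_top) x (fun k _ => ?_) fun k hk hk' => hD k hk (by omega)
    · rw [mul_one] at this
      exact this
    · rw [norm_iteratedFDeriv_eq_norm_iteratedDeriv, iteratedDeriv_comp_const_sub k Real.exp (ψ x),
        iteratedDeriv_eq_iterate, Real.iter_deriv_exp]
      simp
  calc (w.length.choose (i + 1) : ℝ) * ‖iteratedFDeriv ℝ (i + 1) b x‖ *
        ‖iteratedFDeriv ℝ (w.length - (i + 1)) v x‖
      ≤ (w.length.choose (i + 1) : ℝ) * ((i + 1).factorial * μ ^ (i + 1)) *
        ‖iteratedFDeriv ℝ (w.length - (i + 1)) v x‖ := by gcongr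
    _ = _ := by ring

theorem norm_conj_multiDeriv_sub_le {ψ : Space n → ℝ} (hψ : ContDiff ℝ ∞ ψ) {v : Space n → V}
    (hv : ContDiff ℝ ∞ v) {μ : ℝ} {m : ℕ} {α : MultiIndex n} (hα : α ∈ multiIndices n m)
    (x : Space n) (hD : ∀ i, 1 ≤ i → i ≤ m → ‖iteratedFDeriv ℝ i ψ x‖ ≤ μ ^ i) :
    ‖Real.exp (ψ x) • multiDeriv α (fun y => Real.exp (-ψ y) • v y) x - multiDeriv α v x‖ ≤
      commutatorBound m μ v x := by
  rw [mem_multiIndices, ← length_indexWord] at hα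
  subst hα
  rw [multiDeriv_eq_wordDeriv, multiDeriv_eq_wordDeriv]
  exact norm_conj_wordDeriv_sub_le hψ hv _ x hD

theorem IsSobolev.memLp_commutatorBound {v : Space n → V} (hv : IsSobolev v) (m : ℕ) (μ : ℝ) :
    MemLp (commutatorBound m μ v) 2 volume :=
  memLp_finsetSum _ fun i _ => (hv.memLp (m - (i + 1))).norm.const_mul _

end Weights

/-! ### Absorbing the commutator into the top-order energy -/

section

variable {n : ℕ} {V : Type*} [NormedAddCommGroup V] [InnerProductSpace ℝ V]

/-- The square of each term is a constant times `ρ^{2(m-j)} ‖∇^j v‖²` with `j = m - (i+1) < m`,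
which is exactly the scale-invariant quantity that interpolation controls. -/
theorem exists_integral_commutatorBound_le (hn : 1 ≤ n) (m : ℕ) (κ : ℝ) {δ : ℝ}
    (hδ : 0 < δ) :
    ∃ C : ℝ, 0 ≤ C ∧ ∀ (ρ : ℝ), 0 < ρ → ∀ v : Space n → V, IsSobolev v →
      ∫ x, commutatorBound m (κ * ρ) v x ^ 2 ≤
        δ * (∑ α ∈ multiIndices n m, ∫ x, ‖multiDeriv α v x‖ ^ 2)
          + C * ρ ^ (2 * m) * ∫ x, ‖v x‖ ^ 2 := by
  have hn0 : (0 : ℝ) < n := by exact_mod_cast hn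
  set c : ℕ → ℝ := fun i => (m.choose (i + 1) * (i + 1).factorial : ℝ) * κ ^ (i + 1) with hc
  set D : ℝ := m * ∑ i ∈ Finset.range m, c i ^ 2 * (n : ℝ) ^ (m - (i + 1)) with hDdef
  have hD0 : 0 ≤ D := by positivity
  -- The factor `n ^ m` pays for passing from words to multi-indices, and `D + 1` for the sum of all
  -- the terms; the added one keeps the denominator positive when `D = 0`.
  obtain ⟨C, hC0, hC⟩ := exists_derivSq_interpolation (V := V) hn m
    (δ := δ / ((D + 1) * (n : ℝ) ^ m)) (by positivity)
  refine ⟨D * C, by positivity, fun ρ hρ v hv => ?_⟩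
  have hpt : ∀ x, commutatorBound m (κ * ρ) v x ^ 2 ≤
      m * ∑ i ∈ Finset.range m, c i ^ 2 * (n : ℝ) ^ (m - (i + 1)) *
        (ρ ^ (2 * (m - (m - (i + 1)))) * derivSq (m - (i + 1)) v x) := by
    intro x
    have h1 := sq_sum_le_card_mul_sum_sq (s := Finset.range m) (f := fun i =>
      (m.choose (i + 1) * (i + 1).factorial : ℝ) * (κ * ρ) ^ (i + 1) *
        ‖iteratedFDeriv ℝ (m - (i + 1)) v x‖)
    rw [Finset.card_range] at h1
    refine h1.trans ?_
    gcongr with i hi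
    have hi' := Finset.mem_range.1 hi
    have e : m - (m - (i + 1)) = i + 1 := by omega
    rw [e]
    calc _ = c i ^ 2 * ρ ^ (2 * (i + 1)) * ‖iteratedFDeriv ℝ (m - (i + 1)) v x‖ ^ 2 := by
            simp only [hc, mul_pow]; ring
      _ ≤ c i ^ 2 * ρ ^ (2 * (i + 1)) * ((n : ℝ) ^ (m - (i + 1)) * derivSq (m - (i + 1)) v x) := by
            gcongr
            exact sq_norm_iteratedFDeriv_le_derivSq hv.smooth _ x
      _ = _ := by ring
  have hint : ∀ i ∈ Finset.range m, Integrable (fun x => c i ^ 2 * (n : ℝ) ^ (m - (i + 1)) *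
        (ρ ^ (2 * (m - (m - (i + 1)))) * derivSq (m - (i + 1)) v x)) := fun i _ =>
    ((hv.integrable_derivSq _).const_mul _).const_mul _
  have htop : derivEnergy m v ≤ (n : ℝ) ^ m *
      ∑ α ∈ multiIndices n m, ∫ x, ‖multiDeriv α v x‖ ^ 2 := by
    rw [← integral_finsetSum _ fun α _ =>
      ((hv.multiDeriv α).memLp_two.integrable_norm_pow two_ne_zero), ← integral_const_mul]
    refine integral_mono (hv.integrable_derivSq m) ?_ fun x =>
      derivSq_wordDeriv_le hv.smooth x m [] (by simp)
    exact (integrable_finsetSum _ fun α _ =>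
      ((hv.multiDeriv α).memLp_two.integrable_norm_pow two_ne_zero)).const_mul _
  set S := ∑ α ∈ multiIndices n m, ∫ x, ‖multiDeriv α v x‖ ^ 2
  have hS : 0 ≤ S := Finset.sum_nonneg fun α _ => integral_nonneg fun x => sq_nonneg _
  have hE0 : 0 ≤ derivEnergy 0 v := derivEnergy_nonneg v 0
  have hE : ∀ i ∈ Finset.range m, ρ ^ (2 * (m - (m - (i + 1)))) * derivEnergy (m - (i + 1)) v ≤
      δ / (D + 1) * S + C * ρ ^ (2 * m) * derivEnergy 0 v := by
    intro i hi
    refine (hC ρ hρ v hv (m - (i + 1)) (by have := Finset.mem_range.1 hi; omega)).trans ?_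
    have : δ / ((D + 1) * (n : ℝ) ^ m) * derivEnergy m v ≤ δ / ((D + 1) * (n : ℝ) ^ m) *
      ((n : ℝ) ^ m * S) := by gcongr
    have e : δ / ((D + 1) * (n : ℝ) ^ m) * ((n : ℝ) ^ m * S) = δ / (D + 1) * S := by
      field_simp
    linarith
  calc ∫ x, commutatorBound m (κ * ρ) v x ^ 2
      ≤ ∫ x, m * ∑ i ∈ Finset.range m, c i ^ 2 * (n : ℝ) ^ (m - (i + 1)) *
        (ρ ^ (2 * (m - (m - (i + 1)))) * derivSq (m - (i + 1)) v x) := by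
        refine integral_mono (hv.memLp_commutatorBound m _).integrable_sq ?_ hpt
        exact (integrable_finsetSum _ hint).const_mul _
    _ = m * ∑ i ∈ Finset.range m, c i ^ 2 * (n : ℝ) ^ (m - (i + 1)) *
        (ρ ^ (2 * (m - (m - (i + 1)))) * derivEnergy (m - (i + 1)) v) := by
        rw [integral_const_mul, integral_finsetSum _ hint]
        simp only [integral_const_mul, derivEnergy]
    _ ≤ m * ∑ i ∈ Finset.range m, c i ^ 2 * (n : ℝ) ^ (m - (i + 1)) *
        (δ / (D + 1) * S + C * ρ ^ (2 * m) * derivEnergy 0 v) := by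
        gcongr with i hi
        exact hE i hi
    _ = D * (δ / (D + 1) * S + C * ρ ^ (2 * m) * derivEnergy 0 v) := by
        rw [← Finset.sum_mul, hDdef]; ring
    _ ≤ δ * S + D * C * ρ ^ (2 * m) * derivEnergy 0 v := by
        have : D * (δ / (D + 1) * S) ≤ δ * S := by
          have e : D * (δ / (D + 1) * S) = D / (D + 1) * (δ * S) := by ring
          rw [e]
          refine mul_le_of_le_one_left (by positivity) ?_
          rw [div_le_one (by positivity)]; linarith
        linarith [show D * (C * ρ ^ (2 * m) * derivEnergy 0 v)
          = D * C * ρ ^ (2 * m) * derivEnergy 0 v by ring]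

end
-- The elliptic form conjugated by an exponential weight
section Form

variable {n N : ℕ}

/-- The flux `(∑_{β,j} a_{α,β}^{i,j} X_{β,j})_{α,i}` produced by a coefficient array. -/
noncomputable def coeffApply (m : ℕ) (a : MultiIndex n → MultiIndex n → Fin N → Fin N → ℂ)
    (X : MultiIndex n → Target N) (α : MultiIndex n) : Target N :=
  WithLp.toLp 2 fun i => ∑ β ∈ multiIndices n m, ∑ j, a α β i j * X β j

theorem norm_le_sum_norm (v : Target N) : ‖v‖ ≤ ∑ i, ‖v i‖ := by
  have h := (EuclideanSpace.basisFun (Fin N) ℂ).sum_repr v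
  calc ‖v‖ = ‖∑ i, v i • EuclideanSpace.single i (1 : ℂ)‖ := by
        conv_lhs => rw [← h]
        simp
    _ ≤ ∑ i, ‖v i • EuclideanSpace.single i (1 : ℂ)‖ := norm_sum_le _ _
    _ = ∑ i, ‖v i‖ := by simp [norm_smul]

theorem norm_coeffApply_le {m : ℕ} {a : MultiIndex n → MultiIndex n → Fin N → Fin N → ℂ}
    {Lam : ℝ} {α : MultiIndex n}
    (ha : ∀ β ∈ multiIndices n m, ∀ i j, ‖a α β i j‖ ≤ Lam) (X : MultiIndex n → Target N) :
    ‖coeffApply m a X α‖ ≤ N * (Lam * N) * ∑ β ∈ multiIndices n m, ‖X β‖ := by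
  calc ‖coeffApply m a X α‖ ≤ ∑ i, ‖coeffApply m a X α i‖ := norm_le_sum_norm _
    _ ≤ ∑ _i : Fin N, ∑ β ∈ multiIndices n m, ∑ _j : Fin N, Lam * ‖X β‖ := by
        refine Finset.sum_le_sum fun i _ => ?_
        refine (norm_sum_le _ _).trans (Finset.sum_le_sum fun β hβ => ?_)
        refine (norm_sum_le _ _).trans (Finset.sum_le_sum fun j _ => ?_)
        rw [norm_mul]
        have h0 : 0 ≤ Lam := (norm_nonneg _).trans (ha β hβ i j)
        gcongr
        · exact ha β hβ i j
        · exact PiLp.norm_apply_le (X β) j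
    _ = _ := by
        simp only [Finset.sum_const, Finset.card_univ, Fintype.card_fin, nsmul_eq_mul,
          Finset.mul_sum]
        refine Finset.sum_congr rfl fun β _ => by ring

theorem coeffApply_sub (m : ℕ) (a : MultiIndex n → MultiIndex n → Fin N → Fin N → ℂ)
    (X Y : MultiIndex n → Target N) (α : MultiIndex n) :
    coeffApply m a X α - coeffApply m a Y α = coeffApply m a (fun β => X β - Y β) α := by
  ext i
  simp [coeffApply, mul_sub, Finset.sum_sub_distrib]

theorem coeffApply_smul (m : ℕ) (a : MultiIndex n → MultiIndex n → Fin N → Fin N → ℂ)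
    (r : ℝ) (X : MultiIndex n → Target N) (α : MultiIndex n) :
    coeffApply m a (fun β => r • X β) α = r • coeffApply m a X α := by
  ext i
  simp [coeffApply, Finset.mul_sum, mul_left_comm]

/-- Only real parts enter the energy method, so `ℂᴺ` is treated as a real inner product space
throughout. -/
theorem real_inner_eq_re (v w : Target N) : inner ℝ v w = ∑ i, (w i * star (v i)).re := by
  simp [PiLp.inner_apply, Complex.inner, mul_comm]

theorem aestronglyMeasurable_coeffApply {Ω : Type*} [MeasurableSpace Ω] {μ : Measure Ω} {m : ℕ}
    {a : Ω → MultiIndex n → MultiIndex n → Fin N → Fin N → ℂ} {X : Ω → MultiIndex n → Target N}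
    {α : MultiIndex n}
    (ha : ∀ β ∈ multiIndices n m, ∀ i j, AEStronglyMeasurable (fun x => a x α β i j) μ)
    (hX : ∀ β ∈ multiIndices n m, AEStronglyMeasurable (fun x => X x β) μ) :
    AEStronglyMeasurable (fun x => coeffApply m (a x) (X x) α) μ := by
  refine (PiLp.continuous_toLp 2 fun _ : Fin N => ℂ).comp_aestronglyMeasurable
    (AEMeasurable.aestronglyMeasurable (aemeasurable_pi_lambda _ fun i =>
      AEStronglyMeasurable.aemeasurable ?_))
  refine Finset.aestronglyMeasurable_fun_sum _ fun β hβ => ?_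
  refine Finset.aestronglyMeasurable_fun_sum _ fun j _ => ?_
  exact (ha β hβ i j).mul
    ((PiLp.continuous_apply 2 (fun _ : Fin N => ℂ) j).comp_aestronglyMeasurable (hX β hβ))

theorem memLp_coeffApply {Ω : Type*} [MeasurableSpace Ω] {μ : Measure Ω} {m : ℕ}
    {a : Ω → MultiIndex n → MultiIndex n → Fin N → Fin N → ℂ} {X : Ω → MultiIndex n → Target N}
    {α : MultiIndex n} {Lam : ℝ}
    (ha : ∀ β ∈ multiIndices n m, ∀ i j, AEStronglyMeasurable (fun x => a x α β i j) μ)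
    (hb : ∀ᵐ x ∂μ, ∀ β ∈ multiIndices n m, ∀ i j, ‖a x α β i j‖ ≤ Lam)
    (hX : ∀ β ∈ multiIndices n m, MemLp (fun x => X x β) 2 μ) :
    MemLp (fun x => coeffApply m (a x) (X x) α) 2 μ := by
  have hs := (memLp_finsetSum _ fun β hβ => (hX β hβ).norm).const_mul ((N : ℝ) * (Lam * N))
  refine hs.mono' (aestronglyMeasurable_coeffApply ha fun β hβ => (hX β hβ).1) ?_
  filter_upwards [hb] with x hx using norm_coeffApply_le hx (X x)

/-- The properties of the coefficients at a fixed time that the energy method uses. -/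
structure IsEllipticSlice (m : ℕ) (lam Lam : ℝ)
    (a : Space n → MultiIndex n → MultiIndex n → Fin N → Fin N → ℂ) : Prop where
  measurable : ∀ α ∈ multiIndices n m, ∀ β ∈ multiIndices n m, ∀ i j,
    AEStronglyMeasurable (fun x => a x α β i j) volume
  bounded : ∀ᵐ x, ∀ α ∈ multiIndices n m, ∀ β ∈ multiIndices n m, ∀ i j, ‖a x α β i j‖ ≤ Lam
  garding : ∀ v : Space n → Target N, IsSobolev v →
    lam * ∑ α ∈ multiIndices n m, ∫ x, ‖multiDeriv α v x‖ ^ 2 ≤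
      ∑ α ∈ multiIndices n m, ∫ x, inner ℝ (multiDeriv α v x)
        (coeffApply m (a x) (fun β => multiDeriv β v x) α)

theorem young_mul_le {θ : ℝ} (hθ : 0 < θ) (a b : ℝ) : a * b ≤ θ * a ^ 2 + 1 / (4 * θ) * b ^ 2 := by
  have : 0 ≤ (2 * θ * a - b) ^ 2 / (4 * θ) := by positivity
  have e : (2 * θ * a - b) ^ 2 / (4 * θ) = θ * a ^ 2 + 1 / (4 * θ) * b ^ 2 - a * b := by
    field_simp; ring
  linarith

/-- Pointwise comparison of the conjugated form with the unweighted one. -/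
theorem neg_inner_conj_le {V : Type*} [NormedAddCommGroup V] [InnerProductSpace ℝ V]
    {T P AT AQ F : V} {E L S B Y M θ : ℝ} (hE0 : 0 < E) (hE : E ≤ L) (hθ : 0 < θ)
    (hP : ‖P - T‖ ≤ S) (hAT : ‖AT‖ ≤ B * Y) (hAQ : ‖AQ - AT‖ ≤ B * (M * S)) :
    -inner ℝ (E⁻¹ • AQ + F) (E • P) ≤ -inner ℝ T AT + (θ * Y ^ 2 + 2 * θ * ‖T‖ ^ 2)
      + ((B ^ 2 + (B * M) ^ 2) / (4 * θ) + |B * M| + 1) * S ^ 2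
      + (L ^ 2 / (4 * θ) + L ^ 2) * ‖F‖ ^ 2 := by
  have hS : 0 ≤ S := (norm_nonneg _).trans hP
  have hPn : ‖P‖ ≤ ‖T‖ + S := by
    calc ‖P‖ = ‖T + (P - T)‖ := by simp
      _ ≤ ‖T‖ + ‖P - T‖ := norm_add_le _ _
      _ ≤ ‖T‖ + S := by gcongr
  -- In the application `E = e^ψ`, `T = ∂^α v`, `P = e^{-ψ} ∂^α(e^ψ v)`, `AT` is the flux of `∇^m
  -- v`, `AQ` that of `e^ψ ∇^m u`, and `F` is the flux defect. The weights cancel except on `F`.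
  -- Beside the term `⟨T, AT⟩` for Gårding, every remaining product contains `P - T`, `AQ - AT` or
  -- `F`.
  have e : -inner ℝ (E⁻¹ • AQ + F) (E • P)
      = -inner ℝ T AT - inner ℝ AT (P - T) - inner ℝ (AQ - AT) P - E * inner ℝ F P := by
    simp only [inner_add_left, inner_smul_left, inner_smul_right, inner_sub_right, inner_sub_left,
      real_inner_comm T AT]
    simp only [conj_trivial]
    field_simp
    ring
  have h1 : -inner ℝ AT (P - T) ≤ Y * (B * S) :=
    (neg_le_abs _).trans ((abs_real_inner_le_norm _ _).trans
      ((mul_le_mul hAT hP (norm_nonneg _) ((norm_nonneg _).trans hAT)).trans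
        (le_of_eq (by ring))))
  have h2 : -inner ℝ (AQ - AT) P ≤ ‖T‖ * (B * M * S) + B * M * S ^ 2 :=
    (neg_le_abs _).trans ((abs_real_inner_le_norm _ _).trans
      ((mul_le_mul hAQ hPn (norm_nonneg _) ((norm_nonneg _).trans hAQ)).trans
        (le_of_eq (by ring))))
  have h3 : -(E * inner ℝ F P) ≤ ‖T‖ * (L * ‖F‖) + S * (L * ‖F‖) := by
    have h := (neg_le_abs _).trans (abs_real_inner_le_norm F P)
    calc -(E * inner ℝ F P) = E * -inner ℝ F P := by ring
      _ ≤ E * (‖F‖ * ‖P‖) := by gcongr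
      _ ≤ L * (‖F‖ * (‖T‖ + S)) := by
        have : 0 ≤ L := hE0.le.trans hE
        gcongr
      _ = _ := by ring
  have y1 := young_mul_le hθ Y (B * S)
  have y2 := young_mul_le hθ ‖T‖ (B * M * S)
  have y3 := young_mul_le hθ ‖T‖ (L * ‖F‖)
  have y4 := young_mul_le one_pos S (L * ‖F‖)
  have y5 : B * M * S ^ 2 ≤ |B * M| * S ^ 2 := by gcongr; exact le_abs_self _
  have y6 : 0 ≤ (L * ‖F‖) ^ 2 := sq_nonneg _
  rw [e]
  have e2 : ((B ^ 2 + (B * M) ^ 2) / (4 * θ) + |B * M| + 1) * S ^ 2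
      + (L ^ 2 / (4 * θ) + L ^ 2) * ‖F‖ ^ 2 = 1 / (4 * θ) * (B * S) ^ 2
      + 1 / (4 * θ) * (B * M * S) ^ 2 + |B * M| * S ^ 2 + S ^ 2
      + 1 / (4 * θ) * (L * ‖F‖) ^ 2 + (L * ‖F‖) ^ 2 := by ring
  linarith

/-- Applied to `v = e^ψ u`, Gårding provides `-lam ‖∇^m v‖²`. One half pays for the Young terms of
`neg_inner_conj_le`, the other for the top-order part of the interpolated commutator; what remains
is `ρ^{2m} ‖v‖²` and the defect between `W` and the true flux of `u`. The order of quantifiers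
matters: `K` is fixed before the bound `L` on the weight, and only the constant in front of the
defect, which later tends to zero, depends on `L`. -/
theorem exists_energy_dissipation_const (hn : 1 ≤ n) (m : ℕ) {lam : ℝ} (hlam : 0 < lam) (Lam : ℝ)
    {κ : ℝ} (hκ : 0 ≤ κ) :
    ∃ K : ℝ, 0 < K ∧ ∀ L : ℝ, ∃ C : ℝ, 0 ≤ C ∧ ∀ ρ : ℝ, 0 < ρ →
      ∀ a : Space n → MultiIndex n → MultiIndex n → Fin N → Fin N → ℂ,
      IsEllipticSlice m lam Lam a →
      ∀ ψ : Space n → ℝ, IsBoundedSmooth ψ → (∀ x, Real.exp (ψ x) ≤ L) →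
      (∀ i, 1 ≤ i → i ≤ m → ∀ x, ‖iteratedFDeriv ℝ i ψ x‖ ≤ (κ * ρ) ^ i) →
      ∀ (u : Space n → Target N) (W : MultiIndex n → Space n → Target N), IsSobolev u →
      (∀ α ∈ multiIndices n m, MemLp (W α) 2 volume) →
      -∑ α ∈ multiIndices n m, ∫ x, inner ℝ (W α x)
          (multiDeriv α (fun y => Real.exp (2 * ψ y) • u y) x) ≤
        K * ρ ^ (2 * m) * (∫ x, ‖Real.exp (ψ x) • u x‖ ^ 2) +
        C * ∑ α ∈ multiIndices n m,
          ∫ x, ‖W α x - coeffApply m (a x) (fun β => multiDeriv β u x) α‖ ^ 2 := by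
  obtain ⟨M, hM⟩ : ∃ M : ℝ, M = (multiIndices n m).card := ⟨_, rfl⟩
  have hM0 : 0 ≤ M := hM ▸ Nat.cast_nonneg _
  obtain ⟨B, hB⟩ : ∃ B : ℝ, B = N * (Lam * N) := ⟨_, rfl⟩
  -- Summing the Young terms over the `M` multi-indices gives `θ (M² + 2)` times the top-order
  -- energy, and this `θ` makes it `lam / 2`.
  obtain ⟨θ, hθdef⟩ : ∃ θ : ℝ, θ = lam / (2 * (M ^ 2 + 2)) := ⟨_, rfl⟩
  have hθ : 0 < θ := by rw [hθdef]; positivity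
  obtain ⟨C₁, hC₁⟩ : ∃ C₁ : ℝ, C₁ = (B ^ 2 + (B * M) ^ 2) / (4 * θ) + |B * M| + 1 := ⟨_, rfl⟩
  have hC₁0 : 0 < C₁ := by rw [hC₁]; positivity
  -- The commutator is counted `M` times with weight `C₁`, so this `δ` costs at most `lam / 2` of
  -- the top-order energy.
  obtain ⟨C₀, hC₀, hint⟩ := exists_integral_commutatorBound_le (n := n) (V := Target N) hn m κ
    (δ := lam / (2 * (M + 1) * C₁)) (by positivity)
  refine ⟨M * C₁ * C₀ + 1, by positivity, fun L => ⟨L ^ 2 / (4 * θ) + L ^ 2, by positivity, ?_⟩⟩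
  intro ρ hρ a ha ψ hψ hL hD u W hu hW
  have hμ : 0 ≤ κ * ρ := by positivity
  set v : Space n → Target N := fun x => Real.exp (ψ x) • u x with hvdef
  have hv : IsSobolev v := hu.smul hψ.exp
  set S := commutatorBound m (κ * ρ) v with hS
  have huv : u = fun y => Real.exp (-ψ y) • v y := by
    funext y; simp [hvdef, smul_smul, ← Real.exp_add]
  have huv2 : (fun y => Real.exp (2 * ψ y) • u y) = fun y => Real.exp (-(-ψ y)) • v y := by
    funext y; simp [hvdef, smul_smul, ← Real.exp_add, two_mul]
  have hsum : ∀ α ∈ multiIndices n m, MemLp (multiDeriv α v) 2 volume := fun α _ =>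
    (hv.multiDeriv α).memLp_two
  have hAT : ∀ α ∈ multiIndices n m,
      MemLp (fun x => coeffApply m (a x) (fun β => multiDeriv β v x) α) 2 volume := fun α hα =>
    memLp_coeffApply (fun β hβ i j => ha.measurable α hα β hβ i j)
      (ha.bounded.mono fun x hx => hx α hα) fun β hβ => hsum β hβ
  have hAu : ∀ α ∈ multiIndices n m,
      MemLp (fun x => coeffApply m (a x) (fun β => multiDeriv β u x) α) 2 volume := fun α hα =>
    memLp_coeffApply (fun β hβ i j => ha.measurable α hα β hβ i j)
      (ha.bounded.mono fun x hx => hx α hα) fun β _ => (hu.multiDeriv β).memLp_two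
  have hF : ∀ α ∈ multiIndices n m, MemLp
      (fun x => W α x - coeffApply m (a x) (fun β => multiDeriv β u x) α) 2 volume :=
    fun α hα => (hW α hα).sub (hAu α hα)
  have hSm : MemLp S 2 volume := hv.memLp_commutatorBound m _
  have h2u : IsSobolev fun y => Real.exp (2 * ψ y) • u y := hu.smul (hψ.const_mul 2).exp
  have hpt : ∀ᵐ x, ∀ α ∈ multiIndices n m,
      -inner ℝ (W α x) (multiDeriv α (fun y => Real.exp (2 * ψ y) • u y) x) ≤
      -inner ℝ (multiDeriv α v x) (coeffApply m (a x) (fun β => multiDeriv β v x) α)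
      + (θ * (M * ∑ β ∈ multiIndices n m, ‖multiDeriv β v x‖ ^ 2)
        + 2 * θ * ‖multiDeriv α v x‖ ^ 2) + C₁ * S x ^ 2
      + (L ^ 2 / (4 * θ) + L ^ 2) *
        ‖W α x - coeffApply m (a x) (fun β => multiDeriv β u x) α‖ ^ 2 := by
    filter_upwards [ha.bounded] with x hx α hα
    set E := Real.exp (ψ x) with hE
    have hEpos : 0 < E := Real.exp_pos _
    set P := E⁻¹ • multiDeriv α (fun y => Real.exp (2 * ψ y) • u y) x with hP
    set Q : MultiIndex n → Target N := fun β => E • multiDeriv β u x with hQ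
    have hQv : ∀ β ∈ multiIndices n m, ‖Q β - multiDeriv β v x‖ ≤ S x := by
      intro β hβ
      have := norm_conj_multiDeriv_sub_le hψ.smooth hv.smooth hβ x
        (fun i h1 h2 => hD i h1 h2 x)
      rwa [← huv] at this
    have hPv : ‖P - multiDeriv α v x‖ ≤ S x := by
      -- The test function carries the opposite conjugation: `e^{-ψ} ∂^α(e^{2ψ} u) = e^{-ψ} ∂^α(e^ψ
      -- v)`.
      have := norm_conj_multiDeriv_sub_le (ψ := fun y => -ψ y) hψ.smooth.neg hv.smooth hα x
        (μ := κ * ρ) (fun i h1 h2 => by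
          have e : (fun y => -ψ y) = -ψ := rfl
          rw [e, iteratedFDeriv_neg_apply, norm_neg]
          exact hD i h1 h2 x)
      rw [← huv2, Real.exp_neg] at this
      exact this
    have key := neg_inner_conj_le (T := multiDeriv α v x) (P := P)
      (AT := coeffApply m (a x) (fun β => multiDeriv β v x) α) (AQ := coeffApply m (a x) Q α)
      (F := W α x - coeffApply m (a x) (fun β => multiDeriv β u x) α) (E := E) (L := L)
      (S := S x) (B := B) (Y := ∑ β ∈ multiIndices n m, ‖multiDeriv β v x‖) (M := M) hEpos (hL x)
      hθ hPv (hB ▸ norm_coeffApply_le (hx α hα) _) (by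
        rw [coeffApply_sub]
        refine (norm_coeffApply_le (hx α hα) _).trans ?_
        rw [← hB]
        -- The sign of `Lam` is read off from the bound on one coefficient, which exists unless `N =
        -- 0`; in that case `B = 0`.
        have hB0 : 0 ≤ B := by
          by_cases hN : N = 0
          · simp [hB, hN]
          · have i0 : Fin N := ⟨0, Nat.pos_of_ne_zero hN⟩
            have := (norm_nonneg _).trans (hx α hα α hα i0 i0)
            rw [hB]; positivity
        refine mul_le_mul_of_nonneg_left ?_ hB0
        refine (Finset.sum_le_sum hQv).trans (le_of_eq ?_)
        simp [hM])
    have eW : E⁻¹ • coeffApply m (a x) Q α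
        + (W α x - coeffApply m (a x) (fun β => multiDeriv β u x) α) = W α x := by
      rw [hQ, coeffApply_smul, smul_smul, inv_mul_cancel₀ hEpos.ne', one_smul]
      abel
    have eP : E • P = multiDeriv α (fun y => Real.exp (2 * ψ y) • u y) x := by
      rw [hP, smul_smul, mul_inv_cancel₀ hEpos.ne', one_smul]
    rw [eW, eP, ← hC₁] at key
    have hY : (∑ β ∈ multiIndices n m, ‖multiDeriv β v x‖) ^ 2 ≤
        M * ∑ β ∈ multiIndices n m, ‖multiDeriv β v x‖ ^ 2 := hM ▸ sq_sum_le_card_mul_sum_sq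
    have hY' := mul_le_mul_of_nonneg_left hY hθ.le
    linarith
  have hI2 : ∀ {f : Space n → Target N}, MemLp f 2 volume → Integrable fun x => ‖f x‖ ^ 2 :=
    fun h => h.integrable_norm_pow two_ne_zero
  have hStep : ∀ α ∈ multiIndices n m,
      -∫ x, inner ℝ (W α x) (multiDeriv α (fun y => Real.exp (2 * ψ y) • u y) x) ≤
      -(∫ x, inner ℝ (multiDeriv α v x) (coeffApply m (a x) (fun β => multiDeriv β v x) α))
      + (θ * (M * ∑ β ∈ multiIndices n m, ∫ x, ‖multiDeriv β v x‖ ^ 2)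
        + 2 * θ * ∫ x, ‖multiDeriv α v x‖ ^ 2) + C₁ * (∫ x, S x ^ 2)
      + (L ^ 2 / (4 * θ) + L ^ 2) *
        ∫ x, ‖W α x - coeffApply m (a x) (fun β => multiDeriv β u x) α‖ ^ 2 := by
    intro α hα
    have i1 : Integrable fun x => -inner ℝ (multiDeriv α v x)
        (coeffApply m (a x) (fun β => multiDeriv β v x) α) :=
      (integrable_bilin (B := innerSL ℝ) (hsum α hα) (hAT α hα)).neg
    have i2 : Integrable fun x => ∑ β ∈ multiIndices n m, ‖multiDeriv β v x‖ ^ 2 :=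
      integrable_finsetSum _ fun β hβ => hI2 (hsum β hβ)
    have i3 := hI2 (hsum α hα)
    have i4 := hSm.integrable_sq
    have i5 := hI2 (hF α hα)
    have i2' := (i2.const_mul M).const_mul θ
    have i3' := i3.const_mul (2 * θ)
    have i4' := i4.const_mul C₁
    have i5' := i5.const_mul (L ^ 2 / (4 * θ) + L ^ 2)
    have h := integral_mono_ae
      (integrable_bilin (B := innerSL ℝ) (hW α hα) (h2u.multiDeriv α).memLp_two).neg
      (((i1.add (i2'.add i3')).add i4').add i5') (hpt.mono fun x hx => hx α hα)
    have e1 : ∫ x, (-fun x => (innerSL ℝ (W α x))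
        (multiDeriv α (fun y => Real.exp (2 * ψ y) • u y) x)) x
        = -∫ x, inner ℝ (W α x) (multiDeriv α (fun y => Real.exp (2 * ψ y) • u y) x) :=
      integral_neg _
    rw [e1] at h
    refine h.trans (le_of_eq ?_)
    rw [integral_add' ((i1.add (i2'.add i3')).add i4') i5', integral_add' (i1.add (i2'.add i3')) i4',
      integral_add' i1 (i2'.add i3'), integral_add' i2' i3']
    simp only [integral_const_mul, integral_neg]
    rw [integral_finsetSum _ fun β hβ => hI2 (hsum β hβ)]
  have hTot := Finset.sum_le_sum hStep
  simp only [Finset.sum_add_distrib, Finset.sum_neg_distrib, ← Finset.mul_sum, Finset.sum_const,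
    nsmul_eq_mul, ← hM] at hTot
  have hG := ha.garding v hv
  have hC := hint ρ hρ v hv
  generalize hGdef : ∑ α ∈ multiIndices n m, ∫ x, ‖multiDeriv α v x‖ ^ 2 = G at *
  have hG0 : 0 ≤ G := hGdef ▸ Finset.sum_nonneg fun α _ => integral_nonneg fun x => sq_nonneg _
  generalize hZ : ∫ x, ‖v x‖ ^ 2 = Z at *
  have hZ0 : 0 ≤ Z := hZ ▸ integral_nonneg fun x => sq_nonneg _
  have b1 : θ * (M * G) * M + 2 * θ * G = lam / 2 * G := by
    rw [hθdef]; field_simp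
  have b2 : M * (C₁ * ∫ x, S x ^ 2) ≤ lam / 2 * G + M * C₁ * C₀ * ρ ^ (2 * m) * Z := by
    have c1 : M * (C₁ * ∫ x, S x ^ 2) ≤ M * (C₁ * (lam / (2 * (M + 1) * C₁) * G
        + C₀ * ρ ^ (2 * m) * Z)) := by gcongr
    have c2 : M * (C₁ * (lam / (2 * (M + 1) * C₁) * G)) = M / (M + 1) * (lam / 2 * G) := by
      field_simp
    have c3 : M / (M + 1) * (lam / 2 * G) ≤ lam / 2 * G := by
      refine mul_le_of_le_one_left (by positivity) ?_
      rw [div_le_one (by positivity)]; linarith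
    linarith
  have b3 : 0 ≤ ρ ^ (2 * m) * Z := by positivity
  have b4 : (M * C₁ * C₀ + 1) * ρ ^ (2 * m) * Z
      = M * C₁ * C₀ * ρ ^ (2 * m) * Z + ρ ^ (2 * m) * Z := by ring
  rw [b4]
  linarith

end Form
-- Convolution with smooth compactly supported kernels
section Smoothing

variable {n : ℕ} {V : Type*} [NormedAddCommGroup V] [NormedSpace ℝ V]

/-- Weighted Cauchy–Schwarz inequality. -/
theorem sq_integral_mul_le {Ω : Type*} [MeasurableSpace Ω] {μ : Measure Ω} {w G : Ω → ℝ}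
    (hw0 : ∀ x, 0 ≤ w x) (hw : Integrable w μ) (hG : AEStronglyMeasurable G μ)
    (hwG2 : Integrable (fun x => w x * G x ^ 2) μ) :
    Integrable (fun x => w x * G x) μ ∧
      (∫ x, w x * G x ∂μ) ^ 2 ≤ (∫ x, w x ∂μ) * ∫ x, w x * G x ^ 2 ∂μ := by
  have hwG : Integrable (fun x => w x * G x) μ := by
    refine (hw.add hwG2).mono' (hw.1.mul hG) (Eventually.of_forall fun x => ?_)
    rw [norm_mul, Real.norm_of_nonneg (hw0 x), Real.norm_eq_abs, Pi.add_apply]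
    have : |G x| ≤ 1 + G x ^ 2 := by
      rw [← sq_abs]; nlinarith [sq_nonneg (|G x| - 1), abs_nonneg (G x)]
    calc w x * |G x| ≤ w x * (1 + G x ^ 2) := mul_le_mul_of_nonneg_left this (hw0 x)
      _ = _ := by ring
  refine ⟨hwG, ?_⟩
  -- Discriminant argument: a nonnegative quadratic in `c`, to be evaluated at its minimum `I / J`.
  have hq : ∀ c : ℝ, 0 ≤ (∫ x, w x * G x ^ 2 ∂μ) - 2 * c * (∫ x, w x * G x ∂μ)
      + c ^ 2 * ∫ x, w x ∂μ := by
    intro c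
    have h0 : 0 ≤ ∫ x, w x * (G x - c) ^ 2 ∂μ :=
      integral_nonneg fun x => mul_nonneg (hw0 x) (sq_nonneg _)
    have e : (fun x => w x * (G x - c) ^ 2)
        = fun x => (w x * G x ^ 2 - 2 * c * (w x * G x)) + c ^ 2 * w x := by
      funext x; ring
    have i1 := hwG.const_mul (2 * c)
    have i2 := hw.const_mul (c ^ 2)
    have i3 : Integrable (fun x => w x * G x ^ 2 - 2 * c * (w x * G x)) μ := hwG2.sub i1
    rwa [e, integral_add i3 i2, integral_sub hwG2 i1, integral_const_mul,
      integral_const_mul] at h0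
  set I := ∫ x, w x * G x ∂μ
  set J := ∫ x, w x ∂μ with hJ
  set Q := ∫ x, w x * G x ^ 2 ∂μ
  have hJ0 : 0 ≤ J := integral_nonneg hw0
  rcases hJ0.eq_or_lt with h0 | h0
  · have hw' : w =ᵐ[μ] 0 := (integral_eq_zero_iff_of_nonneg hw0 hw).1 h0.symm
    have : I = 0 := by
      refine integral_eq_zero_of_ae ?_
      filter_upwards [hw'] with x hx
      simp [hx]
    rw [this, ← h0]; simp
  · have := hq (I / J)
    have e : Q - 2 * (I / J) * I + (I / J) ^ 2 * J = Q - I ^ 2 / J := by field_simp; ring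
    rw [e, sub_nonneg, div_le_iff₀ h0] at this
    linarith

/-- The convolution of a vector-valued function with a scalar kernel. -/
noncomputable def smoothing (η : Space n → ℝ) (g : Space n → V) : Space n → V :=
  convolution η g (ContinuousLinearMap.lsmul ℝ ℝ) volume

theorem smoothing_apply (η : Space n → ℝ) (g : Space n → V) (x : Space n) :
    smoothing η g x = ∫ y, η (x - y) • g y :=
  convolution_eq_swap _

theorem smoothing_apply' (η : Space n → ℝ) (g : Space n → V) (x : Space n) :
    smoothing η g x = ∫ y, η y • g (x - y) := rfl

variable {η : Space n → ℝ} {g : Space n → V}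

theorem contDiff_smoothing (hη : ContDiff ℝ ∞ η) (hc : HasCompactSupport η)
    (hg : LocallyIntegrable g volume) : ContDiff ℝ ∞ (smoothing η g) :=
  hc.contDiff_convolution_left _ hη hg

theorem partialDeriv_smoothing (hη : ContDiff ℝ ∞ η) (hc : HasCompactSupport η)
    (hg : LocallyIntegrable g volume) (k : Fin n) :
    partialDeriv k (smoothing η g) = smoothing (partialDeriv k η) g := by
  funext x
  have h := hc.hasFDerivAt_convolution_left (ContinuousLinearMap.lsmul ℝ ℝ)
    (hη.of_le (by exact_mod_cast le_top)) hg x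
  change fderiv ℝ (convolution η g (ContinuousLinearMap.lsmul ℝ ℝ) volume) x _ = _
  rw [h.fderiv, convolution_def, ContinuousLinearMap.integral_apply]
  · rfl
  · exact HasCompactSupport.convolutionExists_left _ (hc.fderiv ℝ)
      (hη.continuous_fderiv (by simp)) hg x

theorem wordDeriv_smoothing (hη : ContDiff ℝ ∞ η) (hc : HasCompactSupport η)
    (hg : LocallyIntegrable g volume) (w : List (Fin n)) :
    wordDeriv w (smoothing η g) = smoothing (wordDeriv w η) g := by
  induction w with
  | nil => rfl
  | cons k w ih =>
    rw [wordDeriv_cons, ih, partialDeriv_smoothing (contDiff_wordDeriv hη w)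
      (hasCompactSupport_wordDeriv hc w) hg, wordDeriv_cons]

theorem multiDeriv_smoothing (hη : ContDiff ℝ ∞ η) (hc : HasCompactSupport η)
    (hg : LocallyIntegrable g volume) (α : MultiIndex n) :
    multiDeriv α (smoothing η g) = smoothing (multiDeriv α η) g := by
  rw [multiDeriv_eq_wordDeriv, multiDeriv_eq_wordDeriv, wordDeriv_smoothing hη hc hg]

theorem integrable_smoothing_integrand (hη : Continuous η) (hc : HasCompactSupport η)
    (hg : LocallyIntegrable g volume) (x : Space n) :
    Integrable (fun y => η (x - y) • g y) := by
  have h : ConvolutionExistsAt η g x (ContinuousLinearMap.lsmul ℝ ℝ) volume :=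
    hc.convolutionExists_left _ hη hg x
  exact h.integrable_swap

/-- Cauchy–Schwarz with respect to the weight `|η(x - y)|`. The right side is a convolution of two
integrable functions, so integrating it in `x` gives Young's inequality together with the
integrability of the left side. -/
theorem sq_norm_smoothing_le (hη : Continuous η) (hc : HasCompactSupport η)
    (hg : MemLp g 2 volume) (x : Space n) :
    ‖smoothing η g x‖ ^ 2 ≤
      (∫ y, |η y|) * smoothing (fun y => |η y|) (fun y => ‖g y‖ ^ 2) x := by
  have hca : HasCompactSupport fun y => |η y| := hc.comp_left (g := fun s : ℝ => |s|) abs_zero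
  have hg1 : LocallyIntegrable g volume := hg.locallyIntegrable (by norm_num)
  have hg2 : LocallyIntegrable (fun y => ‖g y‖ ^ 2) volume :=
    (hg.integrable_norm_pow two_ne_zero).locallyIntegrable
  have hw : Integrable fun y => |η (x - y)| :=
    (hη.abs.integrable_of_hasCompactSupport hca).comp_sub_left x
  have hwG := integrable_smoothing_integrand hη.abs hca hg2 x
  have h := (sq_integral_mul_le (fun y => abs_nonneg (η (x - y))) hw hg.1.norm hwG).2
  have e : ∫ y, |η (x - y)| = ∫ y, |η y| := integral_sub_left_eq_self (fun y => |η y|) volume x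
  rw [e] at h
  rw [smoothing_apply, smoothing_apply]
  refine le_trans ?_ h
  gcongr
  refine (norm_integral_le_integral_norm _).trans (le_of_eq ?_)
  simp only [norm_smul, Real.norm_eq_abs]

theorem integrable_sq_norm_smoothing_bound {V : Type*} [NormedAddCommGroup V] {g : Space n → V}
    (hη : Continuous η) (hc : HasCompactSupport η)
    (hg : MemLp g 2 volume) :
    Integrable (smoothing (fun y => |η y|) (fun y => ‖g y‖ ^ 2)) :=
  (hη.abs.integrable_of_hasCompactSupport
    (hc.comp_left (g := fun s : ℝ => |s|) abs_zero)).integrable_convolution _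
    (hg.integrable_norm_pow two_ne_zero)

theorem memLp_smoothing (hη : ContDiff ℝ ∞ η) (hc : HasCompactSupport η)
    (hg : MemLp g 2 volume) : MemLp (smoothing η g) 2 volume := by
  have hcont := (contDiff_smoothing hη hc (hg.locallyIntegrable (by norm_num))).continuous
  rw [memLp_two_iff_integrable_sq_norm hcont.aestronglyMeasurable]
  refine ((integrable_sq_norm_smoothing_bound hη.continuous hc hg).const_mul (∫ y, |η y|)).mono'
    (hcont.norm.pow 2).aestronglyMeasurable (Eventually.of_forall fun x => ?_)
  rw [Real.norm_of_nonneg (sq_nonneg _)]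
  exact sq_norm_smoothing_le hη.continuous hc hg x

theorem isSobolev_smoothing (hη : ContDiff ℝ ∞ η) (hc : HasCompactSupport η)
    (hg : MemLp g 2 volume) : IsSobolev (smoothing η g) := by
  have hl := hg.locallyIntegrable (by norm_num)
  refine isSobolev_of_wordDeriv (contDiff_smoothing hη hc hl) fun w => ?_
  rw [wordDeriv_smoothing hη hc hl]
  exact memLp_smoothing (contDiff_wordDeriv hη w) (hasCompactSupport_wordDeriv hc w) hg

/-- Young's convolution inequality `L¹ * L² ⊆ L²`. -/
theorem integral_sq_norm_smoothing_le (hη : ContDiff ℝ ∞ η) (hc : HasCompactSupport η)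
    (hg : MemLp g 2 volume) :
    ∫ x, ‖smoothing η g x‖ ^ 2 ≤ (∫ y, |η y|) ^ 2 * ∫ y, ‖g y‖ ^ 2 := by
  have hi := integrable_sq_norm_smoothing_bound hη.continuous hc hg
  calc ∫ x, ‖smoothing η g x‖ ^ 2
      ≤ ∫ x, (∫ y, |η y|) * smoothing (fun y => |η y|) (fun y => ‖g y‖ ^ 2) x :=
        integral_mono ((memLp_smoothing hη hc hg).integrable_norm_pow two_ne_zero)
          (hi.const_mul _) fun x => sq_norm_smoothing_le hη.continuous hc hg x
    _ = (∫ y, |η y|) * ((∫ y, |η y|) * ∫ y, ‖g y‖ ^ 2) := by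
        rw [integral_const_mul]
        congr 1
        exact integral_convolution (ContinuousLinearMap.lsmul ℝ ℝ)
          (hη.continuous.abs.integrable_of_hasCompactSupport
            (hc.comp_left (g := fun s : ℝ => |s|) abs_zero)) (hg.integrable_norm_pow two_ne_zero)
    _ = _ := by ring

theorem stronglyMeasurable_smoothing (hη : Continuous η) {G : ℝ × Space n → V}
    (hG : StronglyMeasurable G) :
    StronglyMeasurable fun p : ℝ × Space n => smoothing η (fun y => G (p.1, y)) p.2 := by
  simp only [smoothing_apply]
  refine StronglyMeasurable.integral_prod_right (f := fun (p : ℝ × Space n) y =>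
    η (p.2 - y) • G (p.1, y)) ?_
  refine StronglyMeasurable.smul ?_ ?_
  · exact (hη.comp ((continuous_snd.comp continuous_fst).sub continuous_snd)).stronglyMeasurable
  · exact hG.comp_measurable (by fun_prop)

end Smoothing

/-! ### Mollifiers and convergence in `L²` -/

section Mollifier

variable {n : ℕ} {V : Type*} [NormedAddCommGroup V] [InnerProductSpace ℝ V]

/-- Bump functions concentrating at the origin. -/
noncomputable def mollifierBump (n k : ℕ) : ContDiffBump (0 : Space n) where
  rIn := 1 / (2 * (k + 1))
  rOut := 1 / (k + 1)
  rIn_pos := by positivity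
  rIn_lt_rOut := by
    apply one_div_lt_one_div_of_lt <;> [positivity; linarith [Nat.cast_nonneg (α := ℝ) k]]

/-- A sequence of mollifiers. -/
noncomputable def mollifier (n k : ℕ) : Space n → ℝ := (mollifierBump n k).normed volume

theorem contDiff_mollifier (n k : ℕ) : ContDiff ℝ ∞ (mollifier n k) :=
  (mollifierBump n k).contDiff_normed

theorem hasCompactSupport_mollifier (n k : ℕ) : HasCompactSupport (mollifier n k) :=
  (mollifierBump n k).hasCompactSupport_normed

theorem integral_abs_mollifier (n k : ℕ) : ∫ y, |mollifier n k y| = 1 := by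
  have : ∀ y, |mollifier n k y| = mollifier n k y := fun y =>
    abs_of_nonneg ((mollifierBump n k).nonneg_normed y)
  simp only [this]
  exact (mollifierBump n k).integral_normed

theorem ae_tendsto_smoothing_mollifier [CompleteSpace V] {g : Space n → V} (hg : LocallyIntegrable g volume) :
    ∀ᵐ x, Tendsto (fun k => smoothing (mollifier n k) g x) atTop (𝓝 (g x)) := by
  refine ContDiffBump.ae_convolution_tendsto_right_of_locallyIntegrable (K := 2) ?_ ?_ hg
  · exact tendsto_one_div_add_atTop_nhds_zero_nat
  · refine Eventually.of_forall fun k => le_of_eq ?_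
    change 1 / ((k : ℝ) + 1) = 2 * (1 / (2 * (k + 1)))
    field_simp

theorem integral_sq_norm_smoothing_mollifier_le {g : Space n → V} (hg : MemLp g 2 volume) (k : ℕ) :
    ∫ x, ‖smoothing (mollifier n k) g x‖ ^ 2 ≤ ∫ x, ‖g x‖ ^ 2 := by
  have := integral_sq_norm_smoothing_le (contDiff_mollifier n k)
    (hasCompactSupport_mollifier n k) hg
  simpa [integral_abs_mollifier] using this

theorem memLp_smoothing_mollifier {g : Space n → V} (hg : MemLp g 2 volume) (k : ℕ) :
    MemLp (smoothing (mollifier n k) g) 2 volume :=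
  memLp_smoothing (contDiff_mollifier n k) (hasCompactSupport_mollifier n k) hg

theorem parallelogram_sub (a b : V) : ‖a - b‖ ^ 2 + ‖a + b‖ ^ 2 = 2 * ‖a‖ ^ 2 + 2 * ‖b‖ ^ 2 := by
  have := parallelogram_law_with_norm ℝ a b
  nlinarith [this]

/-- Almost everywhere convergence without increase of the norm implies convergence in `L²`. -/
theorem tendsto_integral_sq_norm_sub_of_ae {Ω : Type*} [MeasurableSpace Ω] {μ : Measure Ω}
    {f : ℕ → Ω → V} {g : Ω → V} (hf : ∀ k, MemLp (f k) 2 μ) (hg : MemLp g 2 μ)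
    (hle : ∀ k, ∫ x, ‖f k x‖ ^ 2 ∂μ ≤ ∫ x, ‖g x‖ ^ 2 ∂μ)
    (hae : ∀ᵐ x ∂μ, Tendsto (fun k => f k x) atTop (𝓝 (g x))) :
    Tendsto (fun k => ∫ x, ‖f k x - g x‖ ^ 2 ∂μ) atTop (𝓝 0) := by
  set I := ∫ x, ‖g x‖ ^ 2 ∂μ with hI
  have hsub : ∀ k, Integrable (fun x => ‖f k x - g x‖ ^ 2) μ := fun k =>
    ((hf k).sub hg).integrable_norm_pow two_ne_zero
  have hadd : ∀ k, Integrable (fun x => ‖f k x + g x‖ ^ 2) μ := fun k =>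
    ((hf k).add hg).integrable_norm_pow two_ne_zero
  have hpar : ∀ k, (∫ x, ‖f k x - g x‖ ^ 2 ∂μ) + ∫ x, ‖f k x + g x‖ ^ 2 ∂μ ≤ 4 * I := by
    intro k
    have i1 := ((hf k).integrable_norm_pow two_ne_zero).const_mul 2
    have i2 := (hg.integrable_norm_pow two_ne_zero).const_mul 2
    rw [← integral_add (hsub k) (hadd k)]
    simp only [parallelogram_sub]
    rw [integral_add i1 i2, integral_const_mul, integral_const_mul]
    linarith [hle k]
  -- By the parallelogram law it suffices that the norms of `f k + g` do not drop in the limit,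
  -- which is Fatou's lemma for `f k + g → 2g`.
  have hfatou : ENNReal.ofReal (4 * I) ≤
      liminf (fun k => ENNReal.ofReal (∫ x, ‖f k x + g x‖ ^ 2 ∂μ)) atTop := by
    have e1 : ENNReal.ofReal (4 * I) = ∫⁻ x, ENNReal.ofReal (‖g x + g x‖ ^ 2) ∂μ := by
      have hgg : Integrable (fun x => ‖g x + g x‖ ^ 2) μ :=
        (hg.add hg).integrable_norm_pow two_ne_zero
      rw [← ofReal_integral_eq_lintegral_ofReal hgg
        (Eventually.of_forall fun x => sq_nonneg _), hI, ← integral_const_mul]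
      congr 2
      funext x
      rw [← two_smul ℝ (g x), norm_smul, mul_pow]
      norm_num
    have e2 : ∀ k, ENNReal.ofReal (∫ x, ‖f k x + g x‖ ^ 2 ∂μ)
        = ∫⁻ x, ENNReal.ofReal (‖f k x + g x‖ ^ 2) ∂μ := fun k =>
      ofReal_integral_eq_lintegral_ofReal (hadd k) (Eventually.of_forall fun x => sq_nonneg _)
    simp only [e1, e2]
    refine le_trans (le_of_eq (lintegral_congr_ae ?_)) (lintegral_liminf_le' fun k =>
      (((hf k).1.add hg.1).norm.pow 2).aemeasurable.ennreal_ofReal)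
    filter_upwards [hae] with x hx
    exact ((ENNReal.continuous_ofReal.tendsto _).comp
      (((hx.add_const (g x)).norm).pow 2)).liminf_eq.symm
  have h0 : ∀ k, 0 ≤ ∫ x, ‖f k x - g x‖ ^ 2 ∂μ := fun k => integral_nonneg fun x => sq_nonneg _
  have h0' : ∀ k, 0 ≤ ∫ x, ‖f k x + g x‖ ^ 2 ∂μ := fun k => integral_nonneg fun x => sq_nonneg _
  have hI0 : 0 ≤ I := integral_nonneg fun x => sq_nonneg _
  rw [tendsto_order]
  refine ⟨fun a ha => Eventually.of_forall fun k => ha.trans_le (h0 k), fun ε hε => ?_⟩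
  rcases hI0.eq_or_lt with hz | hpos
  · refine Eventually.of_forall fun k => ?_
    have := hpar k
    rw [← hz] at this
    linarith [h0' k]
  · have hlt : ENNReal.ofReal (4 * I - ε) < ENNReal.ofReal (4 * I) :=
      (ENNReal.ofReal_lt_ofReal_iff (by linarith)).2 (by linarith)
    filter_upwards [eventually_lt_of_lt_liminf (hlt.trans_le hfatou)] with k hk
    have := (ENNReal.lt_ofReal_iff_toReal_lt ENNReal.ofReal_ne_top).1 hk
    have h2 : 4 * I - ε ≤ (ENNReal.ofReal (4 * I - ε)).toReal := by
      rw [ENNReal.toReal_ofReal']; exact le_max_left _ _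
    linarith [hpar k]

theorem tendsto_integral_sq_norm_smoothing_sub [CompleteSpace V] {g : Space n → V}
    (hg : MemLp g 2 volume) :
    Tendsto (fun k => ∫ x, ‖smoothing (mollifier n k) g x - g x‖ ^ 2) atTop (𝓝 0) :=
  tendsto_integral_sq_norm_sub_of_ae (fun k => memLp_smoothing_mollifier hg k) hg
    (integral_sq_norm_smoothing_mollifier_le hg)
    (ae_tendsto_smoothing_mollifier (hg.locallyIntegrable (by norm_num)))

/-- Uniform in `k`: it supplies the dominating function when the mollification error is integrated
over time. -/
theorem integral_sq_norm_smoothing_sub_le {g : Space n → V} (hg : MemLp g 2 volume) (k : ℕ) :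
    ∫ x, ‖smoothing (mollifier n k) g x - g x‖ ^ 2 ≤ 4 * ∫ x, ‖g x‖ ^ 2 := by
  have hs := memLp_smoothing_mollifier hg k
  have i1 := (hs.integrable_norm_pow two_ne_zero).const_mul 2
  have i2 := (hg.integrable_norm_pow two_ne_zero).const_mul 2
  calc ∫ x, ‖smoothing (mollifier n k) g x - g x‖ ^ 2
      ≤ ∫ x, (2 * ‖smoothing (mollifier n k) g x‖ ^ 2 + 2 * ‖g x‖ ^ 2) :=
        integral_mono ((hs.sub hg).integrable_norm_pow two_ne_zero) (i1.add i2) fun x => by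
          have := parallelogram_sub (smoothing (mollifier n k) g x) (g x)
          dsimp only
          linarith [sq_nonneg ‖smoothing (mollifier n k) g x + g x‖]
    _ ≤ 4 * ∫ x, ‖g x‖ ^ 2 := by
        rw [integral_add i1 i2, integral_const_mul, integral_const_mul]
        linarith [integral_sq_norm_smoothing_mollifier_le hg k]

end Mollifier
-- From weak to integrated equations in time
section TimeRegularity

/-- Bump functions on the line concentrating at the origin. -/
noncomputable def timeBump (k : ℕ) : ContDiffBump (0 : ℝ) where
  rIn := 1 / (2 * (k + 1))
  rOut := 1 / (k + 1)
  rIn_pos := by positivity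
  rIn_lt_rOut := by
    apply one_div_lt_one_div_of_lt <;> [positivity; linarith [Nat.cast_nonneg (α := ℝ) k]]

theorem tendsto_timeBump_rOut : Tendsto (fun k => (timeBump k).rOut) atTop (𝓝 0) :=
  tendsto_one_div_add_atTop_nhds_zero_nat

/-- A smooth approximation of the indicator function of `[a, b]`. -/
noncomputable def timeCutoff (k : ℕ) (a b t : ℝ) : ℝ :=
  ∫ r in (t - b)..(t - a), (timeBump k).normed volume r

theorem continuous_timeBump_normed (k : ℕ) : Continuous ((timeBump k).normed volume) :=
  ((timeBump k).contDiff_normed (n := 0)).continuous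

/-- The derivative is a mollifier centred at `a` minus one centred at `b`; testing with the cutoff
therefore produces `U a - U b` in the limit. -/
theorem hasDerivAt_timeCutoff (k : ℕ) (a b t : ℝ) :
    HasDerivAt (timeCutoff k a b)
      ((timeBump k).normed volume (t - a) - (timeBump k).normed volume (t - b)) t := by
  have hc := continuous_timeBump_normed k
  set φ := (timeBump k).normed (volume : Measure ℝ)
  have hF : ∀ x, HasDerivAt (fun x => ∫ r in (0 : ℝ)..x, φ r) (φ x) x := fun x =>
    intervalIntegral.integral_hasDerivAt_right (hc.intervalIntegrable _ _)
      (hc.stronglyMeasurableAtFilter _ _) hc.continuousAt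
  have e : timeCutoff k a b = fun t => (∫ r in (0 : ℝ)..(t - a), φ r) - ∫ r in (0 : ℝ)..(t - b), φ r := by
    funext t
    rw [timeCutoff, intervalIntegral.integral_interval_sub_left (hc.intervalIntegrable _ _)
      (hc.intervalIntegrable _ _)]
  rw [e]
  have h1 := (hF (t - a)).comp_sub_const t a
  have h2 := (hF (t - b)).comp_sub_const t b
  exact h1.sub h2

theorem contDiff_timeCutoff (k : ℕ) (a b : ℝ) : ContDiff ℝ ∞ (timeCutoff k a b) := by
  rw [contDiff_infty_iff_deriv]
  refine ⟨fun t => (hasDerivAt_timeCutoff k a b t).differentiableAt, ?_⟩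
  have : deriv (timeCutoff k a b) = fun t =>
      (timeBump k).normed volume (t - a) - (timeBump k).normed volume (t - b) :=
    funext fun t => (hasDerivAt_timeCutoff k a b t).deriv
  rw [this]
  have h := (timeBump k).contDiff_normed (μ := (volume : Measure ℝ)) (n := ⊤)
  exact (h.comp (contDiff_id.sub contDiff_const)).sub (h.comp (contDiff_id.sub contDiff_const))

theorem timeBump_eq_zero {k : ℕ} {r : ℝ} (hr : (timeBump k).rOut ≤ |r|) :
    (timeBump k).normed volume r = 0 := by
  rw [← Function.notMem_support, ContDiffBump.support_normed_eq, Metric.mem_ball, dist_zero_right,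
    Real.norm_eq_abs]
  exact not_lt.2 hr

theorem timeCutoff_eq_zero {k : ℕ} {a b t : ℝ} (hab : a ≤ b)
    (ht : t ≤ a - (timeBump k).rOut ∨ b + (timeBump k).rOut ≤ t) : timeCutoff k a b t = 0 := by
  rw [timeCutoff]
  refine (intervalIntegral.integral_congr fun r hr => ?_).trans intervalIntegral.integral_zero
  rw [uIcc_of_le (by linarith)] at hr
  refine timeBump_eq_zero ?_
  rcases ht with h | h
  · exact le_trans (by linarith [hr.2]) (neg_le_abs r)
  · exact le_trans (by linarith [hr.1]) (le_abs_self r)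

theorem timeCutoff_eq_one {k : ℕ} {a b t : ℝ}
    (h1 : a + (timeBump k).rOut ≤ t) (h2 : t ≤ b - (timeBump k).rOut) : timeCutoff k a b t = 1 := by
  have hr := (timeBump k).rOut_pos
  rw [timeCutoff, intervalIntegral.integral_of_le (by linarith), ← (timeBump k).integral_normed
    (μ := volume)]
  refine setIntegral_eq_integral_of_forall_compl_eq_zero fun r hr' => timeBump_eq_zero ?_
  by_contra hlt
  have := abs_lt.1 (not_le.1 hlt)
  exact hr' ⟨by linarith [this.1], by linarith [this.2]⟩

theorem abs_timeCutoff_le (k : ℕ) {a b : ℝ} (hab : a ≤ b) (t : ℝ) : |timeCutoff k a b t| ≤ 1 := by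
  have hn := (timeBump k).nonneg_normed (μ := (volume : Measure ℝ))
  rw [timeCutoff, intervalIntegral.integral_of_le (by linarith), abs_of_nonneg
    (integral_nonneg fun r => hn r), ← (timeBump k).integral_normed (μ := volume)]
  exact setIntegral_le_integral (timeBump k).integrable_normed (Eventually.of_forall hn)

theorem tsupport_timeCutoff_subset (k : ℕ) {a b : ℝ} (hab : a ≤ b) :
    tsupport (timeCutoff k a b) ⊆ Icc (a - (timeBump k).rOut) (b + (timeBump k).rOut) := by
  refine closure_minimal (fun t ht => ?_) isClosed_Icc
  by_contra hcon
  refine ht (timeCutoff_eq_zero hab ?_)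
  rw [mem_Icc, not_and_or, not_le, not_le] at hcon
  exact hcon.imp le_of_lt le_of_lt

variable {V : Type*} [NormedAddCommGroup V] [NormedSpace ℝ V] [CompleteSpace V]

theorem tendsto_setIntegral_timeBump {s a : ℝ} (hsa : s < a) {U : ℝ → V}
    (hU : ContinuousOn U (Ioi s)) :
    Tendsto (fun k => ∫ t in Ioi s, (timeBump k).normed volume (t - a) • U t) atTop
      (𝓝 (U a)) := by
  have h := ContDiffBump.convolution_tendsto_right (φ := timeBump) (μ := (volume : Measure ℝ))
    (g := fun _ => (Ioi s).indicator U) (k := fun _ => a) (x₀ := a) (z₀ := U a) (l := atTop)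
    tendsto_timeBump_rOut (Eventually.of_forall fun _ =>
      (aestronglyMeasurable_indicator_iff measurableSet_Ioi).2
        (hU.aestronglyMeasurable measurableSet_Ioi)) ?_ tendsto_const_nhds
  · refine h.congr fun k => ?_
    rw [convolution_eq_swap, ← integral_indicator measurableSet_Ioi]
    refine integral_congr_ae (Eventually.of_forall fun t => ?_)
    by_cases ht : t ∈ Ioi s
    · simp only [indicator_of_mem ht, ContinuousLinearMap.lsmul_apply]
      rw [← (timeBump k).normed_neg, neg_sub]
    · simp only [indicator_of_notMem ht, map_zero]
  · have h1 : Tendsto ((Ioi s).indicator U) (𝓝 a) (𝓝 (U a)) := by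
      refine (hU.continuousAt (Ioi_mem_nhds hsa)).tendsto.congr' ?_
      filter_upwards [Ioi_mem_nhds hsa] with t ht
      rw [indicator_of_mem ht]
    exact h1.comp tendsto_snd

/-- A continuous function whose weak derivative is an integrable function is its primitive. -/
theorem sub_eq_setIntegral_of_weakDeriv {s : ℝ} {U H : ℝ → V} (hU : ContinuousOn U (Ioi s))
    (hH : ∀ T, IntegrableOn H (Ioc s T))
    (h : ∀ θ : ℝ → ℝ, ContDiff ℝ ∞ θ → HasCompactSupport θ → tsupport θ ⊆ Ioi s →
      ∫ t in Ioi s, deriv θ t • U t = ∫ t in Ioi s, θ t • H t) {a b : ℝ} (hsa : s < a)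
    (hab : a < b) : U a - U b = ∫ t in Ioc a b, H t := by
  have hsb : s < b := hsa.trans hab
  -- A radius below `a - s` keeps the test functions supported in `(s, ∞)`; a radius below `1` keeps
  -- them inside `(s, b + 1]`, where the dominating function lives.
  have hev : ∀ᶠ k in atTop, (timeBump k).rOut < min (a - s) 1 :=
    tendsto_timeBump_rOut.eventually (gt_mem_nhds (lt_min (by linarith) one_pos))
  have hint : ∀ (k : ℕ) (c : ℝ), (timeBump k).rOut < c - s →
      IntegrableOn (fun t => (timeBump k).normed volume (t - c) • U t) (Ioi s) := by
    intro k c hc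
    have hr := (timeBump k).rOut_pos
    have hcont : ContinuousOn (fun t => (timeBump k).normed volume (t - c) • U t) (Ioi s) :=
      ((continuous_timeBump_normed k).comp (continuous_id.sub continuous_const)).continuousOn.smul hU
    have hI : IntegrableOn (fun t => (timeBump k).normed volume (t - c) • U t)
        (Icc (c - (timeBump k).rOut) (c + (timeBump k).rOut)) :=
      (hcont.mono fun t ht => by
        have := ht.1
        exact lt_of_lt_of_le (by linarith) this).integrableOn_compact isCompact_Icc
    refine hI.of_forall_sdiff_eq_zero measurableSet_Ioi fun t ht => ?_
    rw [timeBump_eq_zero, zero_smul]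
    by_contra hlt
    have := abs_lt.1 (not_le.1 hlt)
    exact ht.2 ⟨by linarith [this.1], by linarith [this.2]⟩
  have hL : Tendsto (fun k => ∫ t in Ioi s, deriv (timeCutoff k a b) t • U t) atTop
      (𝓝 (U a - U b)) := by
    refine ((tendsto_setIntegral_timeBump hsa hU).sub
      (tendsto_setIntegral_timeBump hsb hU)).congr' ?_
    filter_upwards [hev] with k hk
    have hk' := hk.trans_le (min_le_left _ _)
    rw [← integral_sub (hint k a hk') (hint k b (by linarith))]
    refine integral_congr_ae (Eventually.of_forall fun t => ?_)
    simp only [(hasDerivAt_timeCutoff k a b t).deriv, sub_smul]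
  have hR : Tendsto (fun k => ∫ t in Ioi s, timeCutoff k a b t • H t) atTop
      (𝓝 (∫ t in Ioi s, (Ioc a b).indicator H t)) := by
    have hHloc : IntegrableOn ((Ioc s (b + 1)).indicator fun t => ‖H t‖) (Ioi s) :=
      ((integrable_indicator_iff measurableSet_Ioc).2 (hH (b + 1)).norm).integrableOn
    have hHm : AEStronglyMeasurable H (volume.restrict (Ioi s)) := by
      have : Ioi s = ⋃ j : ℕ, Ioc s (s + j) := by
        ext t
        simp only [mem_Ioi, mem_iUnion, mem_Ioc]
        constructor
        · intro ht
          obtain ⟨j, hj⟩ := exists_nat_ge (t - s)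
          exact ⟨j, ht, by linarith⟩
        · rintro ⟨j, h1, _⟩
          exact h1
      rw [this]
      exact AEStronglyMeasurable.iUnion fun j => (hH (s + j)).1
    refine tendsto_integral_filter_of_dominated_convergence _ (Eventually.of_forall fun k =>
      ((contDiff_timeCutoff k a b).continuous.aestronglyMeasurable).smul hHm) ?_ hHloc ?_
    · filter_upwards [hev] with k hk
      refine (ae_restrict_iff' measurableSet_Ioi).2 (Eventually.of_forall fun t ht => ?_)
      by_cases htb : t ≤ b + 1
      · rw [indicator_of_mem (show t ∈ Ioc s (b + 1) from ⟨ht, htb⟩), norm_smul]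
        exact mul_le_of_le_one_left (norm_nonneg _) (abs_timeCutoff_le k hab.le t)
      · have hk' := hk.trans_le (min_le_right _ _)
        rw [timeCutoff_eq_zero hab.le (Or.inr (by linarith)), zero_smul, norm_zero]
        exact indicator_nonneg (fun _ _ => norm_nonneg _) _
    · have hne : ∀ᵐ t ∂(volume.restrict (Ioi s)), t ≠ a ∧ t ≠ b := by
        refine ae_restrict_of_ae ?_
        filter_upwards [Measure.ae_ne volume a, Measure.ae_ne volume b] with t h1 h2 using ⟨h1, h2⟩
      filter_upwards [hne] with t ht
      have hr := tendsto_timeBump_rOut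
      by_cases htab : t ∈ Ioc a b
      · rw [indicator_of_mem htab]
        have h1 : a < t := htab.1
        have h2 : t < b := lt_of_le_of_ne htab.2 ht.2
        refine tendsto_const_nhds.congr' ?_
        filter_upwards [hr.eventually (gt_mem_nhds (lt_min (sub_pos.2 h1) (sub_pos.2 h2)))]
          with k hk
        have k1 := hk.trans_le (min_le_left _ _)
        have k2 := hk.trans_le (min_le_right _ _)
        rw [timeCutoff_eq_one (by linarith) (by linarith), one_smul]
      · rw [indicator_of_notMem htab]
        refine tendsto_const_nhds.congr' ?_
        rcases lt_or_gt_of_ne ht.1 with h1 | h1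
        · filter_upwards [hr.eventually (gt_mem_nhds (sub_pos.2 h1))] with k hk
          rw [timeCutoff_eq_zero hab.le (Or.inl (by linarith)), zero_smul]
        · have h2 : b < t := by
            by_contra hcon
            exact htab ⟨h1, not_lt.1 hcon⟩
          filter_upwards [hr.eventually (gt_mem_nhds (sub_pos.2 h2))] with k hk
          rw [timeCutoff_eq_zero hab.le (Or.inr (by linarith)), zero_smul]
  have hEq : ∀ᶠ k in atTop, ∫ t in Ioi s, deriv (timeCutoff k a b) t • U t
      = ∫ t in Ioi s, timeCutoff k a b t • H t := by
    filter_upwards [hev] with k hk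
    have hk' := hk.trans_le (min_le_left _ _)
    have hsub := tsupport_timeCutoff_subset k hab.le
    refine h _ (contDiff_timeCutoff k a b) (isCompact_Icc.of_isClosed_subset
      (isClosed_tsupport _) hsub) (hsub.trans fun t ht => ?_)
    exact lt_of_lt_of_le (by linarith) ht.1
  have := tendsto_nhds_unique (hL.congr' hEq) hR
  rw [this, setIntegral_indicator measurableSet_Ioc]
  congr 2
  exact inter_eq_right.2 fun t ht => hsa.trans ht.1

/-- Let the left endpoint `a` in `sub_eq_setIntegral_of_weakDeriv` tend to `s`: the trace replaces
`U a`, and the primitive of the integrable `H` is continuous up to `s`. -/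
theorem eq_sub_setIntegral_of_weakDeriv {s : ℝ} {U H : ℝ → V} {U₀ : V}
    (hU : ContinuousOn U (Ioi s))
    (h₀ : Tendsto U (𝓝[>] s) (𝓝 U₀)) (hH : ∀ T, IntegrableOn H (Ioc s T))
    (h : ∀ θ : ℝ → ℝ, ContDiff ℝ ∞ θ → HasCompactSupport θ → tsupport θ ⊆ Ioi s →
      ∫ t in Ioi s, deriv θ t • U t = ∫ t in Ioi s, θ t • H t) {t : ℝ} (ht : s < t) :
    U t = U₀ - ∫ τ in Ioc s t, H τ := by
  have hprim : Tendsto (fun a => ∫ τ in a..t, H τ) (𝓝[>] s) (𝓝 (∫ τ in s..t, H τ)) := by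
    have hI : IntervalIntegrable H volume s t :=
      (intervalIntegrable_iff_integrableOn_Ioc_of_le ht.le).2 (hH t)
    have hc := intervalIntegral.continuousOn_primitive_interval_left
      (μ := volume) (f := H) (a := s) (b := t) (by
        rw [uIcc_of_le ht.le, integrableOn_Icc_iff_integrableOn_Ioc]; exact hH t)
    have := hc s left_mem_uIcc
    rw [uIcc_of_le ht.le] at this
    refine this.tendsto.mono_left ?_
    rw [← nhdsWithin_Ioc_eq_nhdsGT ht]
    exact nhdsWithin_mono _ Ioc_subset_Icc_self
  have hlim : Tendsto (fun a => U a - U t) (𝓝[>] s) (𝓝 (U₀ - U t)) := h₀.sub_const _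
  have heq : (fun a => ∫ τ in a..t, H τ) =ᶠ[𝓝[>] s] fun a => U a - U t := by
    filter_upwards [Ioo_mem_nhdsGT ht] with a ha
    rw [sub_eq_setIntegral_of_weakDeriv hU hH h ha.1 ha.2,
      intervalIntegral.integral_of_le ha.2.le]
  have := tendsto_nhds_unique (hprim.congr' heq) hlim
  rw [intervalIntegral.integral_of_le ht.le] at this
  rw [this]; abel

end TimeRegularity
-- Local convergence and testing with compactly supported functions
section LocalConvergence

variable {n : ℕ} {V : Type*} [NormedAddCommGroup V] [NormedSpace ℝ V] {ι : Type*} {l : Filter ι}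

theorem tendsto_integral_smul_of_eLpNorm_one {f : ι → Space n → V} {f₀ : Space n → V}
    {χ : Space n → ℝ} (hχ : Continuous χ) (hc : HasCompactSupport χ)
    (hf : ∀ᶠ i in l, IntegrableOn (f i) (tsupport χ)) (hf₀ : IntegrableOn f₀ (tsupport χ))
    (hlim : Tendsto (fun i => eLpNorm (f i - f₀) 1 (volume.restrict (tsupport χ))) l (𝓝 0)) :
    Tendsto (fun i => ∫ x, χ x • f i x) l (𝓝 (∫ x, χ x • f₀ x)) := by
  have hrestr : ∀ g : Space n → V, ∫ x, χ x • g x = ∫ x in tsupport χ, χ x • g x := fun g =>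
    (setIntegral_eq_integral_of_forall_compl_eq_zero fun x hx => by
      rw [image_eq_zero_of_notMem_tsupport hx, zero_smul]).symm
  obtain ⟨C, hC⟩ := hχ.bounded_above_of_compact_support hc
  have hint : ∀ g : Space n → V, IntegrableOn g (tsupport χ) →
      Integrable (fun x => χ x • g x) (volume.restrict (tsupport χ)) := fun g hg =>
    Integrable.bdd_smul hg C hχ.aestronglyMeasurable (Eventually.of_forall hC)
  simp only [hrestr]
  refine tendsto_integral_of_L1' _ (hint f₀ hf₀).1 (hf.mono fun i hi => hint _ hi) ?_
  have hlim' := ENNReal.Tendsto.const_mul (a := ENNReal.ofReal C) hlim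
    (Or.inr ENNReal.ofReal_ne_top)
  rw [mul_zero] at hlim'
  refine tendsto_of_tendsto_of_tendsto_of_le_of_le tendsto_const_nhds hlim'
    (fun _ => zero_le) fun i => ?_
  refine eLpNorm_le_mul_eLpNorm_of_ae_le_mul (Eventually.of_forall fun x => ?_) 1
  simp only [Pi.sub_apply, ← smul_sub, norm_smul]
  gcongr
  exact hC x

/-- Hölder on a set of finite measure. It puts continuity in `L²_loc` and the `L¹_loc` trace on the
same footing. -/
theorem tendsto_eLpNorm_one_of_two {V : Type*} [NormedAddCommGroup V] {f : ι → Space n → V} {f₀ : Space n → V} {K : Set (Space n)}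
    (hK : IsCompact K) (hf : ∀ᶠ i in l, MemLp (f i) 2 (volume.restrict K))
    (hf₀ : MemLp f₀ 2 (volume.restrict K))
    (hlim : Tendsto (fun i => eLpNorm (f i - f₀) 2 (volume.restrict K)) l (𝓝 0)) :
    Tendsto (fun i => eLpNorm (f i - f₀) 1 (volume.restrict K)) l (𝓝 0) := by
  have hfin : (volume.restrict K) univ ^ (1 / (1 : ℝ≥0∞).toReal - 1 / (2 : ℝ≥0∞).toReal) ≠ ⊤ := by
    refine ENNReal.rpow_ne_top_of_nonneg (by norm_num) ?_
    rw [Measure.restrict_apply_univ]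
    exact hK.measure_lt_top.ne
  have h := ENNReal.Tendsto.mul_const hlim (Or.inr hfin)
  rw [zero_mul] at h
  refine tendsto_of_tendsto_of_tendsto_of_le_of_le' tendsto_const_nhds h
    (Eventually.of_forall fun _ => zero_le) (hf.mono fun i hi => ?_)
  exact eLpNorm_le_eLpNorm_mul_rpow_measure_univ (by norm_num) (hi.sub hf₀).1

theorem tendsto_integral_smul_norm_of_eLpNorm_one {V : Type*} [NormedAddCommGroup V]
    {f : ι → Space n → V} {f₀ : Space n → V}
    {χ : Space n → ℝ} (hχ : Continuous χ) (hc : HasCompactSupport χ)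
    (hf : ∀ᶠ i in l, IntegrableOn (f i) (tsupport χ)) (hf₀ : IntegrableOn f₀ (tsupport χ))
    (hlim : Tendsto (fun i => eLpNorm (f i - f₀) 1 (volume.restrict (tsupport χ))) l (𝓝 0)) :
    Tendsto (fun i => ∫ x, χ x • ‖f i x‖) l (𝓝 (∫ x, χ x • ‖f₀ x‖)) := by
  refine tendsto_integral_smul_of_eLpNorm_one hχ hc (hf.mono fun i hi => hi.norm) hf₀.norm ?_
  refine tendsto_of_tendsto_of_tendsto_of_le_of_le tendsto_const_nhds hlim
    (fun _ => zero_le) fun i => ?_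
  refine eLpNorm_mono fun x => ?_
  exact abs_norm_sub_norm_le _ _

end LocalConvergence

/-! ### The weak formulation tested with products `θ(t) χ(x)` -/

section Solutions

variable {n N : ℕ}

theorem hasCompactSupport_prod_mul {θ : ℝ → ℝ} {χ : Space n → ℝ} (hθ : HasCompactSupport θ)
    (hχ : HasCompactSupport χ) :
    HasCompactSupport fun p : ℝ × Space n => θ p.1 * χ p.2 := by
  refine HasCompactSupport.intro (hθ.isCompact.prod hχ.isCompact) fun p hp => ?_
  rw [mem_prod, not_and_or] at hp
  rcases hp with h | h
  · rw [image_eq_zero_of_notMem_tsupport h, zero_mul]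
  · rw [image_eq_zero_of_notMem_tsupport h, mul_zero]

theorem tsupport_prod_mul_subset {s : ℝ} {θ : ℝ → ℝ} {χ : Space n → ℝ}
    (hs : tsupport θ ⊆ Ioi s) :
    tsupport (fun p : ℝ × Space n => θ p.1 * χ p.2) ⊆ Ioi s ×ˢ univ := by
  have : tsupport (fun p : ℝ × Space n => θ p.1 * χ p.2) ⊆ tsupport θ ×ˢ univ := by
    refine closure_minimal (fun p hp => ?_) ((isClosed_tsupport θ).prod isClosed_univ)
    refine ⟨subset_tsupport θ ?_, mem_univ _⟩
    exact left_ne_zero_of_mul hp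
  exact this.trans (prod_mono hs subset_rfl)

theorem multiDeriv_ofReal_mul {χ : Space n → ℝ} (hχ : ContDiff ℝ ∞ χ) (c : ℝ) (α : MultiIndex n)
    (x : Space n) : multiDeriv α (fun y => ((c * χ y : ℝ) : ℂ)) x
      = ((c * multiDeriv α χ x : ℝ) : ℂ) := by
  rw [multiDeriv_eq_wordDeriv, multiDeriv_eq_wordDeriv]
  have := congrFun (wordDeriv_comp_clm hχ (c • Complex.ofRealCLM) (indexWord α)) x
  simpa using this

theorem multiDeriv_zero (α : MultiIndex n) (x : Space n) :
    multiDeriv α (fun _ => (0 : ℂ)) x = 0 := by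
  rw [multiDeriv_eq_wordDeriv]
  exact congrFun (wordDeriv_comp_clm (contDiff_const (c := (0 : ℂ)))
    (0 : ℂ →L[ℝ] ℂ) (indexWord α)) x

theorem restrict_prod_univ_eq (s : ℝ) :
    (volume : Measure (ℝ × Space n)).restrict (Ioi s ×ˢ univ)
      = (volume.restrict (Ioi s)).prod volume := by
  conv_rhs => rw [← Measure.restrict_univ (μ := (volume : Measure (Space n)))]
  exact (Measure.prod_restrict _ _).symm

theorem IsElliptic.memLp_coeff_mul {m : ℕ} {lam Lam : ℝ} {A : Coeff n N}
    (hA : IsElliptic m lam Lam A) {s : ℝ} (hs : 0 ≤ s) {α β : MultiIndex n}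
    (hα : α ∈ multiIndices n m) (hβ : β ∈ multiIndices n m) (i j : Fin N)
    {X : ℝ × Space n → Target N} (hX : MemLp X 2 (volume.restrict (Ioi s ×ˢ univ))) :
    MemLp (fun p => A p.1 p.2 α β i j * X p j) 2 (volume.restrict (Ioi s ×ˢ univ)) := by
  have hsub : (Ioi s ×ˢ univ : Set (ℝ × Space n)) ⊆ Ioi 0 ×ˢ univ :=
    prod_mono (Ioi_subset_Ioi hs) subset_rfl
  have hm := (hA.measurable α hα β hβ i j).mono_measure (Measure.restrict_mono_set volume hsub)
  have hb := ae_mono (Measure.restrict_mono_set volume hsub) (hA.bounded α hα β hβ i j)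
  refine (hX.norm.const_mul Lam).mono' (hm.mul
    ((PiLp.continuous_apply 2 (fun _ : Fin N => ℂ) j).comp_aestronglyMeasurable hX.1)) ?_
  filter_upwards [hb] with p hp
  rw [norm_mul]
  have h0 : 0 ≤ Lam := (norm_nonneg _).trans hp
  gcongr
  exact PiLp.norm_apply_le (X p) j

theorem integrable_smul_of_continuous_compactSupport {w : ℝ × Space n → ℝ} (hw : Continuous w)
    (hc : HasCompactSupport w) {X : ℝ × Space n → Target N} {S : Set (ℝ × Space n)}
    (hX : MemLp X 2 (volume.restrict S)) :
    Integrable (fun p => w p • X p) (volume.restrict S) :=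
  integrable_bilin (B := (ContinuousLinearMap.lsmul ℝ ℝ : ℝ →L[ℝ] Target N →L[ℝ] _))
    ((hw.memLp_of_hasCompactSupport hc).restrict S) hX

theorem IsElliptic.ae_bounded {m : ℕ} {lam Lam : ℝ} {A : Coeff n N}
    (hA : IsElliptic m lam Lam A) :
    ∀ᵐ p : ℝ × Space n ∂(volume.restrict (Ioi (0 : ℝ) ×ˢ univ)), ∀ α ∈ multiIndices n m,
      ∀ β ∈ multiIndices n m, ∀ i j, ‖A p.1 p.2 α β i j‖ ≤ Lam :=
  (ae_ball_iff (Finset.countable_toSet _)).2 fun α hα =>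
    (ae_ball_iff (Finset.countable_toSet _)).2 fun β hβ =>
      ae_all_iff.2 fun i => ae_all_iff.2 fun j => hA.bounded α hα β hβ i j

theorem IsElliptic.memLp_flux {m : ℕ} {lam Lam : ℝ} {A : Coeff n N}
    (hA : IsElliptic m lam Lam A) {s : ℝ} (hs : 0 ≤ s)
    {D : MultiIndex n → ℝ → Space n → Target N}
    (hD : ∀ α ∈ multiIndices n m,
      MemLp (fun p : ℝ × Space n => D α p.1 p.2) 2 (volume.restrict (Ioi s ×ˢ univ)))
    {α : MultiIndex n} (hα : α ∈ multiIndices n m) :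
    MemLp (fun p : ℝ × Space n => coeffApply m (A p.1 p.2) (fun β => D β p.1 p.2) α) 2
      (volume.restrict (Ioi s ×ˢ univ)) := by
  have hsub : (Ioi s ×ˢ univ : Set (ℝ × Space n)) ⊆ Ioi 0 ×ˢ univ :=
    prod_mono (Ioi_subset_Ioi hs) subset_rfl
  refine memLp_coeffApply (a := fun p : ℝ × Space n => A p.1 p.2)
    (X := fun p β => D β p.1 p.2) (Lam := Lam) (fun β hβ i j =>
    (hA.measurable α hα β hβ i j).mono_measure (Measure.restrict_mono_set volume hsub)) ?_ hD
  filter_upwards [ae_mono (Measure.restrict_mono_set volume hsub) hA.ae_bounded] with p hp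
    using hp α hα

/-- The weak formulation tested with real products `θ(t) χ(x)`, in vector form. -/
theorem integral_smul_eq_of_weak {m : ℕ} {lam Lam : ℝ} {A : Coeff n N}
    (hA : IsElliptic m lam Lam A) {s : ℝ} (hs : 0 ≤ s) {u : ℝ → Space n → Target N}
    {D : MultiIndex n → ℝ → Space n → Target N}
    (hD : ∀ α ∈ multiIndices n m,
      MemLp (fun p : ℝ × Space n => D α p.1 p.2) 2 (volume.restrict (Ioi s ×ˢ univ)))
    (hEq : ∀ φ : Fin N → ℝ × Space n → ℂ,
      (∀ i, ContDiff ℝ ∞ (φ i) ∧ HasCompactSupport (φ i) ∧ tsupport (φ i) ⊆ Ioi s ×ˢ univ) →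
      ∑ i : Fin N, ∫ p in Ioi s ×ˢ (univ : Set (Space n)),
          u p.1 p.2 i * star (deriv (fun r => φ i (r, p.2)) p.1) =
        ∑ α ∈ multiIndices n m, ∑ β ∈ multiIndices n m, ∑ i : Fin N, ∑ j : Fin N,
          ∫ p in Ioi s ×ˢ (univ : Set (Space n)),
            A p.1 p.2 α β i j * D β p.1 p.2 j *
              star (multiDeriv α (fun y => φ i (p.1, y)) p.2))
    {θ : ℝ → ℝ} (hθ : ContDiff ℝ ∞ θ) (hθc : HasCompactSupport θ) (hθs : tsupport θ ⊆ Ioi s)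
    {χ : Space n → ℝ} (hχ : ContDiff ℝ ∞ χ) (hχc : HasCompactSupport χ)
    (hu : Integrable (fun p : ℝ × Space n => (deriv θ p.1 * χ p.2) • u p.1 p.2)
      (volume.restrict (Ioi s ×ˢ univ))) :
    ∫ p in Ioi s ×ˢ (univ : Set (Space n)), (deriv θ p.1 * χ p.2) • u p.1 p.2 =
      ∑ α ∈ multiIndices n m, ∫ p in Ioi s ×ˢ (univ : Set (Space n)),
        (θ p.1 * multiDeriv α χ p.2) •
          coeffApply m (A p.1 p.2) (fun β => D β p.1 p.2) α := by
  have hw : ∀ α : MultiIndex n, Continuous fun p : ℝ × Space n => θ p.1 * multiDeriv α χ p.2 :=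
    fun α => (hθ.continuous.comp continuous_fst).mul
      ((contDiff_multiDeriv hχ α).continuous.comp continuous_snd)
  have hwc : ∀ α : MultiIndex n,
      HasCompactSupport fun p : ℝ × Space n => θ p.1 * multiDeriv α χ p.2 := fun α =>
    hasCompactSupport_prod_mul hθc (hasCompactSupport_multiDeriv hχc α)
  have hflux := fun α (hα : α ∈ multiIndices n m) => hA.memLp_flux hs hD hα
  ext i
  have hcomp : ∀ {f : ℝ × Space n → Target N}, Integrable f (volume.restrict (Ioi s ×ˢ univ)) →
      (∫ p in Ioi s ×ˢ (univ : Set (Space n)), f p) i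
        = ∫ p in Ioi s ×ˢ (univ : Set (Space n)), f p i := fun hf =>
    ((EuclideanSpace.proj i : Target N →L[ℂ] ℂ).integral_comp_comm hf).symm
  rw [hcomp hu, WithLp.ofLp_sum, Finset.sum_apply]
  -- Testing only in component `i`, with a real function so that conjugation acts trivially, reads
  -- off component `i` of the vector identity.
  set φ : Fin N → ℝ × Space n → ℂ := fun i' p =>
    if i' = i then ((θ p.1 * χ p.2 : ℝ) : ℂ) else 0 with hφ
  have key := hEq φ fun i' => by
    by_cases h : i' = i
    · have e : φ i' = fun p => ((θ p.1 * χ p.2 : ℝ) : ℂ) := by funext p; simp [hφ, h]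
      rw [e]
      refine ⟨Complex.ofRealCLM.contDiff.comp
        ((hθ.comp contDiff_fst).mul (hχ.comp contDiff_snd)),
        (hasCompactSupport_prod_mul hθc hχc).comp_left (g := fun r : ℝ => (r : ℂ))
          Complex.ofReal_zero, ?_⟩
      refine (tsupport_comp_subset (g := fun r : ℝ => (r : ℂ)) Complex.ofReal_zero
        (fun p : ℝ × Space n => θ p.1 * χ p.2)).trans (tsupport_prod_mul_subset hθs)
    · have e : φ i' = fun _ => 0 := by funext p; simp [hφ, h]
      rw [e]
      refine ⟨contDiff_const, HasCompactSupport.zero, ?_⟩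
      have : tsupport (fun _ : ℝ × Space n => (0 : ℂ)) = ∅ := tsupport_eq_empty_iff.2 rfl
      rw [this]
      exact empty_subset _
  have hφi : ∀ p, φ i p = ((θ p.1 * χ p.2 : ℝ) : ℂ) := fun p => by simp [hφ]
  have hφn : ∀ i' ≠ i, ∀ p, φ i' p = 0 := fun i' h p => by simp [hφ, h]
  rw [Finset.sum_eq_single i (fun i' _ h => by simp [hφn i' h]) (by simp)] at key
  have hL : ∀ p : ℝ × Space n, u p.1 p.2 i * star (deriv (fun r => φ i (r, p.2)) p.1)
      = ((deriv θ p.1 * χ p.2) • u p.1 p.2) i := by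
    intro p
    have hd : HasDerivAt (fun r => φ i (r, p.2)) ((deriv θ p.1 * χ p.2 : ℝ) : ℂ) p.1 := by
      simp only [hφi]
      exact (((hθ.differentiable (by simp)) p.1).hasDerivAt.mul_const (χ p.2)).ofReal_comp
    rw [hd.deriv]
    simp [mul_comm]
  simp only [hL] at key
  rw [key]
  refine Finset.sum_congr rfl fun α hα => ?_
  rw [hcomp (integrable_smul_of_continuous_compactSupport (hw α) (hwc α) (hflux α hα))]
  have hterm : ∀ β ∈ multiIndices n m, ∀ j : Fin N, Integrable (fun p : ℝ × Space n =>
      (θ p.1 * multiDeriv α χ p.2) • (A p.1 p.2 α β i j * D β p.1 p.2 j))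
      (volume.restrict (Ioi s ×ˢ univ)) := fun β hβ j =>
    integrable_bilin (B := (ContinuousLinearMap.lsmul ℝ ℝ : ℝ →L[ℝ] ℂ →L[ℝ] _))
      (((hw α).memLp_of_hasCompactSupport (hwc α)).restrict _)
      (hA.memLp_coeff_mul hs hα hβ i j (hD β hβ))
  have e : ∀ p : ℝ × Space n, ((θ p.1 * multiDeriv α χ p.2) •
      coeffApply m (A p.1 p.2) (fun β => D β p.1 p.2) α) i
      = ∑ β ∈ multiIndices n m, ∑ j : Fin N,
        (θ p.1 * multiDeriv α χ p.2) • (A p.1 p.2 α β i j * D β p.1 p.2 j) := by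
    intro p
    simp only [PiLp.smul_apply, coeffApply, Finset.smul_sum]
  simp only [e]
  rw [integral_finsetSum _ fun β hβ => integrable_finsetSum _ fun j _ => hterm β hβ j]
  refine Finset.sum_congr rfl fun β hβ => ?_
  rw [integral_finsetSum _ fun j _ => hterm β hβ j,
    Finset.sum_eq_single i (fun i' _ h => ?_) (by simp)]
  · refine Finset.sum_congr rfl fun j _ => integral_congr_ae (Eventually.of_forall fun p => ?_)
    simp only [hφi, multiDeriv_ofReal_mul hχ]
    simp [mul_comm]
  · refine Finset.sum_eq_zero fun j _ => integral_eq_zero_of_ae (Eventually.of_forall fun p => ?_)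
    simp only [hφn i' h, multiDeriv_zero]
    simp

end Solutions
-- Energy solutions as solutions of a time-integrated equation
section Mild

variable {n N : ℕ}

theorem coeffApply_congr {m : ℕ} (a : MultiIndex n → MultiIndex n → Fin N → Fin N → ℂ)
    {X Y : MultiIndex n → Target N} (h : ∀ β ∈ multiIndices n m, X β = Y β) (α : MultiIndex n) :
    coeffApply m a X α = coeffApply m a Y α := by
  ext i
  simp only [coeffApply]
  exact Finset.sum_congr rfl fun β hβ => by rw [h β hβ]

theorem IsWeakDeriv.congr_ae {α : MultiIndex n} {f g g' : Space n → Target N}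
    (h : IsWeakDeriv α f g) (hg : g =ᵐ[volume] g') : IsWeakDeriv α f g' := by
  refine ⟨h.1, h.2.1.congr hg, fun φ hφ hc => ?_⟩
  rw [h.2.2 φ hφ hc]
  congr 1
  exact integral_congr_ae (hg.mono fun x hx => by simp only [hx])

/-- An energy solution in time-integrated form: `G` is the flux and `D` the gradient of order
`m`, both given by everywhere defined measurable functions. -/
structure IsMildSolution (m : ℕ) (A : Coeff n N) (s : ℝ) (h : Space n → Target N)
    (u : ℝ → Space n → Target N) (G D : MultiIndex n → ℝ × Space n → Target N) : Prop where
  measurable_flux : ∀ α ∈ multiIndices n m, StronglyMeasurable (G α)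
  memLp_flux : ∀ α ∈ multiIndices n m, MemLp (G α) 2 volume
  measurable_grad : ∀ α ∈ multiIndices n m, StronglyMeasurable (D α)
  memLp_grad : ∀ α ∈ multiIndices n m, MemLp (D α) 2 volume
  ae_slice : ∀ᵐ t ∂(volume.restrict (Ioi s)), ∀ α ∈ multiIndices n m,
    IsWeakDeriv α (u t) (fun x => D α (t, x)) ∧
      (fun x => G α (t, x)) =ᵐ[volume] fun x => coeffApply m (A t x) (fun β => D β (t, x)) α
  locallyIntegrable : ∀ t, s < t → LocallyIntegrable (u t) volume
  integral_eq : ∀ χ : Space n → ℝ, ContDiff ℝ ∞ χ → HasCompactSupport χ → ∀ t, s < t →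
    ∫ x, χ x • u t x = (∫ x, χ x • h x) -
      ∫ τ in Ioc s t, ∑ α ∈ multiIndices n m, ∫ x, multiDeriv α χ x • G α (τ, x)

/-- Square integrable functions on a half-space have everywhere defined measurable versions. -/
theorem exists_measurable_version {V : Type*} [NormedAddCommGroup V] {s : ℝ}
    {f : ℝ × Space n → V}
    (hf : MemLp f 2 (volume.restrict (Ioi s ×ˢ univ))) :
    ∃ g : ℝ × Space n → V, StronglyMeasurable g ∧ MemLp g 2 volume ∧
      ∀ᵐ p, p ∈ (Ioi s ×ˢ univ : Set (ℝ × Space n)) → g p = f p := by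
  have hm : MeasurableSet (Ioi s ×ˢ univ : Set (ℝ × Space n)) := measurableSet_Ioi.prod .univ
  have h1 := (memLp_indicator_iff_restrict (f := f) (p := 2) (μ := volume) hm).2 hf
  refine ⟨h1.1.mk _, h1.1.stronglyMeasurable_mk, h1.ae_eq h1.1.ae_eq_mk, ?_⟩
  filter_upwards [h1.1.ae_eq_mk] with p hp hps
  rw [← hp, indicator_of_mem hps]

theorem integrableOn_time_integral {V : Type*} [NormedAddCommGroup V] [NormedSpace ℝ V]
    {χ : Space n → ℝ} (hχ : Continuous χ)
    (hc : HasCompactSupport χ) {G : ℝ × Space n → V} (hG : MemLp G 2 volume) (s T : ℝ) :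
    IntegrableOn (fun t => ∫ x, χ x • G (t, x)) (Ioc s T) := by
  have h1 : MemLp (fun p : ℝ × Space n => χ p.2) 2
      ((volume.restrict (Ioc s T)).prod volume) :=
    (hχ.memLp_of_hasCompactSupport hc).comp_snd _
  have h2 : MemLp G 2 ((volume.restrict (Ioc s T)).prod volume) := by
    have := hG.restrict (Ioc s T ×ˢ (univ : Set (Space n)))
    rwa [Measure.volume_eq_prod, ← Measure.prod_restrict, Measure.restrict_univ] at this
  exact (integrable_bilin (B := (ContinuousLinearMap.lsmul ℝ ℝ : ℝ →L[ℝ] V →L[ℝ] _))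
    h1 h2).integral_prod_left

/-- By Fubini, testing with `θ(t) χ(x)` says that `t ↦ ∫ χ u(t)` has a weak derivative in time given
by the flux. This function is continuous with the right limit at `s`, hence is the primitive of that
derivative. Flux and gradient are replaced by jointly measurable versions on all of space-time, so
that slices and iterated integrals are available later. -/
theorem IsEnergySolution.exists_isMildSolution {m : ℕ} {lam Lam : ℝ} {A : Coeff n N}
    (hA : IsElliptic m lam Lam A) {s : ℝ} (hs : 0 ≤ s) {h : Space n → Target N}
    (hh : MemLp h 2 volume) {u : ℝ → Space n → Target N} (hu : IsEnergySolution m A s h u) :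
    ∃ G D, IsMildSolution m A s h u G D := by
  obtain ⟨D₀, hum, hreg, hD, hEq, hcont, htrace, -⟩ := hu
  have hflux := fun α (hα : α ∈ multiIndices n m) => hA.memLp_flux hs hD hα
  have hexG : ∀ α : MultiIndex n, ∃ g : ℝ × Space n → Target N, α ∈ multiIndices n m →
      StronglyMeasurable g ∧ MemLp g 2 volume ∧
      ∀ᵐ p, p ∈ (Ioi s ×ˢ univ : Set (ℝ × Space n)) →
        g p = coeffApply m (A p.1 p.2) (fun β => D₀ β p.1 p.2) α := fun α => by
    by_cases hα : α ∈ multiIndices n m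
    · obtain ⟨g, hg⟩ := exists_measurable_version (hflux α hα)
      exact ⟨g, fun _ => hg⟩
    · exact ⟨0, fun h => absurd h hα⟩
  have hexD : ∀ α : MultiIndex n, ∃ g : ℝ × Space n → Target N, α ∈ multiIndices n m →
      StronglyMeasurable g ∧ MemLp g 2 volume ∧
      ∀ᵐ p, p ∈ (Ioi s ×ˢ univ : Set (ℝ × Space n)) → g p = D₀ α p.1 p.2 := fun α => by
    by_cases hα : α ∈ multiIndices n m
    · obtain ⟨g, hg⟩ := exists_measurable_version (hD α hα)
      exact ⟨g, fun _ => hg⟩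
    · exact ⟨0, fun h => absurd h hα⟩
  choose G hG using hexG
  choose D hD' using hexD
  have hslice : ∀ {f g : ℝ × Space n → Target N},
      (∀ᵐ p, p ∈ (Ioi s ×ˢ univ : Set (ℝ × Space n)) → g p = f p) →
      ∀ᵐ t ∂(volume.restrict (Ioi s)), ∀ᵐ x, g (t, x) = f (t, x) := by
    intro f g hfg
    have hm : MeasurableSet (Ioi s ×ˢ univ : Set (ℝ × Space n)) := measurableSet_Ioi.prod .univ
    have := (ae_restrict_iff' hm).2 hfg
    rw [restrict_prod_univ_eq] at this
    exact Measure.ae_ae_of_ae_prod this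
  have hloc : ∀ t, s < t → LocallyIntegrable (u t) volume := fun t ht =>
    (locallyIntegrable_iff).2 fun K hK => by
      have : IsFiniteMeasure (volume.restrict K) := ⟨by simpa using hK.measure_lt_top⟩
      exact (hcont K hK t ht).1.integrable (by norm_num)
  refine ⟨G, D, fun α hα => (hG α hα).1, fun α hα => (hG α hα).2.1, fun α hα => (hD' α hα).1,
    fun α hα => (hD' α hα).2.1, ?_, hloc, ?_⟩
  · have h1 : ∀ᵐ t ∂(volume.restrict (Ioi s)), ∀ α ∈ multiIndices n m,
        ∀ᵐ x, D α (t, x) = D₀ α t x :=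
      (ae_ball_iff (Finset.countable_toSet _)).2 fun α hα => hslice (hD' α hα).2.2
    have h2 : ∀ᵐ t ∂(volume.restrict (Ioi s)), ∀ α ∈ multiIndices n m,
        ∀ᵐ x, G α (t, x) = coeffApply m (A t x) (fun β => D₀ β t x) α :=
      (ae_ball_iff (Finset.countable_toSet _)).2 fun α hα => hslice (hG α hα).2.2
    have h3 : ∀ᵐ t ∂(volume.restrict (Ioi s)), ∀ α ∈ multiIndices n m,
        IsWeakDeriv α (u t) (D₀ α t) :=
      (ae_ball_iff (Finset.countable_toSet _)).2 fun α hα =>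
        (hreg α (mem_multiIndices.1 hα).le).1
    filter_upwards [h1, h2, h3] with t ht1 ht2 ht3 α hα
    refine ⟨(ht3 α hα).congr_ae ((ht1 α hα).mono fun x hx => hx.symm), ?_⟩
    have hall : ∀ᵐ x, ∀ β ∈ multiIndices n m, D β (t, x) = D₀ β t x :=
      (ae_ball_iff (Finset.countable_toSet _)).2 ht1
    filter_upwards [ht2 α hα, hall] with x hx1 hx2
    rw [hx1]
    exact coeffApply_congr _ (fun β hβ => (hx2 β hβ).symm) α
  · intro χ hχ hχc t ht
    have hKχ := hχc.isCompact
    have hintK : ∀ t, s < t → IntegrableOn (u t) (tsupport χ) := fun t ht =>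
      (hloc t ht).integrableOn_isCompact hKχ
    have hlim1 : ∀ t, s < t →
        Tendsto (fun r => eLpNorm (u r - u t) 1 (volume.restrict (tsupport χ))) (𝓝 t) (𝓝 0) :=
      fun t ht => tendsto_eLpNorm_one_of_two hKχ ((lt_mem_nhds ht).mono fun r hr =>
        (hcont _ hKχ r hr).1) (hcont _ hKχ t ht).1 (hcont _ hKχ t ht).2
    have hevK : ∀ t, s < t → ∀ᶠ r in 𝓝 t, IntegrableOn (u r) (tsupport χ) := fun t ht =>
      (lt_mem_nhds ht).mono fun r hr => hintK r hr
    refine eq_sub_setIntegral_of_weakDeriv (U := fun t => ∫ x, χ x • u t x)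
      (H := fun τ => ∑ α ∈ multiIndices n m, ∫ x, multiDeriv α χ x • G α (τ, x))
      (U₀ := ∫ x, χ x • h x) ?_ ?_ ?_ ?_ ht
    · exact fun r hr => (tendsto_integral_smul_of_eLpNorm_one hχ.continuous hχc (hevK r hr)
        (hintK r hr) (hlim1 r hr)).mono_left nhdsWithin_le_nhds
    · exact tendsto_integral_smul_of_eLpNorm_one hχ.continuous hχc
        (eventually_nhdsWithin_of_forall fun r hr => hintK r hr)
        ((hh.locallyIntegrable (by norm_num)).integrableOn_isCompact hKχ) (htrace _ hKχ)
    · exact fun T => integrable_finsetSum _ fun α hα => integrableOn_time_integral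
        (contDiff_multiDeriv hχ α).continuous (hasCompactSupport_multiDeriv hχc α) (hG α hα).2.1 s T
    · intro θ hθ hθc hθs
      have hθ' : Continuous (deriv θ) := hθ.continuous_deriv (by simp)
      -- Joint integrability of `θ' χ u` comes from Tonelli: this integral is continuous in time,
      -- hence bounded on the compact support of `θ`.
      have hcont' : ContinuousOn (fun t => ∫ x, |χ x| • ‖u t x‖) (Ioi s) := fun r hr => by
        have hca : HasCompactSupport fun y => |χ y| :=
          hχc.comp_left (g := fun s : ℝ => |s|) abs_zero
        have hts : tsupport (fun y => |χ y|) = tsupport χ := by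
          simp only [tsupport]
          congr 1
          ext y
          simp
        refine (tendsto_integral_smul_norm_of_eLpNorm_one hχ.continuous.abs hca ?_ ?_
          ?_).mono_left nhdsWithin_le_nhds
        · rw [hts]; exact hevK r hr
        · rw [hts]; exact hintK r hr
        · rw [hts]; exact hlim1 r hr
      have hI : Integrable (fun p : ℝ × Space n => (deriv θ p.1 * χ p.2) • u p.1 p.2)
          (volume.restrict (Ioi s ×ˢ univ)) := by
        have hm : AEStronglyMeasurable (fun p : ℝ × Space n => (deriv θ p.1 * χ p.2) • u p.1 p.2)
            (volume.restrict (Ioi s ×ˢ univ)) :=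
          ((hθ'.comp continuous_fst).mul
            (hχ.continuous.comp continuous_snd)).aestronglyMeasurable.smul hum
        rw [restrict_prod_univ_eq] at hm ⊢
        refine (integrable_prod_iff hm).2 ⟨?_, ?_⟩
        · refine (ae_restrict_iff' measurableSet_Ioi).2 (Eventually.of_forall fun r hr => ?_)
          have := ((hloc r hr).integrable_smul_left_of_hasCompactSupport hχ.continuous hχc).smul
            (deriv θ r)
          simpa only [Pi.smul_def, smul_smul] using this
        · have e : ∀ r, ∫ x, ‖(deriv θ r * χ x) • u r x‖
              = |deriv θ r| * ∫ x, |χ x| • ‖u r x‖ := fun r => by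
            rw [← integral_const_mul]
            refine integral_congr_ae (Eventually.of_forall fun x => ?_)
            simp only [norm_smul, norm_mul, Real.norm_eq_abs, smul_eq_mul, mul_assoc]
          simp only [e]
          have hK : IsCompact (tsupport θ) := hθc.isCompact
          have h1 : IntegrableOn (fun r => |deriv θ r| * ∫ x, |χ x| • ‖u r x‖) (tsupport θ) :=
            (hθ'.abs.continuousOn.mul (hcont'.mono hθs)).integrableOn_compact hK
          refine h1.of_forall_sdiff_eq_zero measurableSet_Ioi fun r hr => ?_
          have : deriv θ r = 0 := by
            by_contra hne
            exact hr.2 (support_deriv_subset hne)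
          rw [this, abs_zero, zero_mul]
      have key := integral_smul_eq_of_weak hA hs hD hEq hθ hθc hθs hχ hχc hI
      have eL : ∫ t in Ioi s, deriv θ t • ∫ x, χ x • u t x
          = ∫ p in Ioi s ×ˢ (univ : Set (Space n)), (deriv θ p.1 * χ p.2) • u p.1 p.2 := by
        rw [restrict_prod_univ_eq] at hI ⊢
        rw [integral_prod _ hI]
        refine integral_congr_ae (Eventually.of_forall fun r => ?_)
        simp only [← smul_smul, integral_smul]
      rw [eL, key]
      have hGi : ∀ α ∈ multiIndices n m, Integrable
          (fun p : ℝ × Space n => (θ p.1 * multiDeriv α χ p.2) • G α p)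
          (volume.restrict (Ioi s ×ˢ univ)) := fun α hα =>
        integrable_smul_of_continuous_compactSupport
          ((hθ.continuous.comp continuous_fst).mul
            ((contDiff_multiDeriv hχ α).continuous.comp continuous_snd))
          (hasCompactSupport_prod_mul hθc (hasCompactSupport_multiDeriv hχc α))
          ((hG α hα).2.1.restrict _)
      have eG : ∀ α ∈ multiIndices n m,
          ∫ p in Ioi s ×ˢ (univ : Set (Space n)), (θ p.1 * multiDeriv α χ p.2) •
            coeffApply m (A p.1 p.2) (fun β => D₀ β p.1 p.2) α
          = ∫ p in Ioi s ×ˢ (univ : Set (Space n)), (θ p.1 * multiDeriv α χ p.2) • G α p := by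
        intro α hα
        refine setIntegral_congr_ae (measurableSet_Ioi.prod .univ) ?_
        filter_upwards [(hG α hα).2.2] with p hp hps
        rw [hp hps]
      rw [Finset.sum_congr rfl eG, ← integral_finsetSum _ hGi]
      have hGs := integrable_finsetSum _ hGi
      rw [restrict_prod_univ_eq] at hGs hGi ⊢
      rw [integral_prod _ hGs]
      refine integral_congr_ae ?_
      have hae : ∀ᵐ r ∂(volume.restrict (Ioi s)), ∀ α ∈ multiIndices n m,
          Integrable fun x => (θ r * multiDeriv α χ x) • G α (r, x) :=
        (ae_ball_iff (Finset.countable_toSet _)).2 fun α hα => (hGi α hα).prod_right_ae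
      filter_upwards [hae] with r hr
      rw [integral_finsetSum _ hr, Finset.smul_sum]
      refine Finset.sum_congr rfl fun α _ => ?_
      rw [← integral_smul]
      simp only [smul_smul]

end Mild
-- The energy identity for primitives of vector-valued functions
section Primitive

variable {V : Type*} [NormedAddCommGroup V] [InnerProductSpace ℝ V] [CompleteSpace V]

/-- The kernel `⟨f τ, f r⟩` is symmetric, so the triangles `r ≤ τ` and `τ < r` contribute equally to
its integral over the square; the diagonal is negligible because points are null. Integrability of
`f` is enough, with no differentiation of the primitive. -/
theorem two_mul_integral_inner_primitive {μ : Measure ℝ} [IsFiniteMeasure μ] [NullSingletonClass μ]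
    {f : ℝ → V} (hf : Integrable f μ) :
    Integrable (fun τ => inner ℝ (f τ) (∫ r in Iic τ, f r ∂μ)) μ ∧
      2 * ∫ τ, inner ℝ (f τ) (∫ r in Iic τ, f r ∂μ) ∂μ = ‖∫ τ, f τ ∂μ‖ ^ 2 := by
  set Φ : ℝ × ℝ → ℝ := fun p => inner ℝ (f p.1) (f p.2) with hΦ
  have hΦi : Integrable Φ (μ.prod μ) := by
    have h := hf.norm.mul_prod hf.norm
    refine h.mono' (hf.1.comp_fst.inner hf.1.comp_snd) (Eventually.of_forall fun p => ?_)
    exact norm_inner_le_norm _ _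
  have hS : MeasurableSet {p : ℝ × ℝ | p.2 ≤ p.1} := measurableSet_le measurable_snd measurable_fst
  have hS' : MeasurableSet {p : ℝ × ℝ | p.1 < p.2} := measurableSet_lt measurable_fst measurable_snd
  have e1 : ∀ τ, ∫ r, ({p : ℝ × ℝ | p.2 ≤ p.1}).indicator Φ (τ, r) ∂μ
      = inner ℝ (f τ) (∫ r in Iic τ, f r ∂μ) := by
    intro τ
    rw [← integral_inner hf.integrableOn, ← integral_indicator measurableSet_Iic]
    rfl
  have e2 : ∀ r, ∫ τ, ({p : ℝ × ℝ | p.1 < p.2}).indicator Φ (τ, r) ∂μ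
      = inner ℝ (f r) (∫ τ in Iic r, f τ ∂μ) := by
    intro r
    rw [← integral_inner hf.integrableOn, integral_Iic_eq_integral_Iio,
      ← integral_indicator measurableSet_Iio]
    refine integral_congr_ae (Eventually.of_forall fun τ => ?_)
    simp only [indicator, mem_ofPred_eq, mem_Iio, hΦ]
    split_ifs
    · exact real_inner_comm _ _
    · rfl
  have hJ1 := hΦi.indicator hS
  have hJ2 := hΦi.indicator hS'
  have hI : Integrable (fun τ => inner ℝ (f τ) (∫ r in Iic τ, f r ∂μ)) μ := by
    have := hJ1.integral_prod_left
    simpa only [e1] using this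
  refine ⟨hI, ?_⟩
  have h1 : ∫ p, ({p : ℝ × ℝ | p.2 ≤ p.1}).indicator Φ p ∂(μ.prod μ)
      = ∫ τ, inner ℝ (f τ) (∫ r in Iic τ, f r ∂μ) ∂μ := by
    rw [integral_prod _ hJ1]
    simp only [e1]
  have h2 : ∫ p, ({p : ℝ × ℝ | p.1 < p.2}).indicator Φ p ∂(μ.prod μ)
      = ∫ τ, inner ℝ (f τ) (∫ r in Iic τ, f r ∂μ) ∂μ := by
    rw [integral_prod_symm _ hJ2]
    simp only [e2]
  have hsplit : (fun p => ({p : ℝ × ℝ | p.2 ≤ p.1}).indicator Φ p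
      + ({p : ℝ × ℝ | p.1 < p.2}).indicator Φ p) = Φ := by
    funext p
    by_cases hp : p.2 ≤ p.1
    · simp [indicator, hp, not_lt.2 hp]
    · simp [indicator, hp, not_le.1 hp]
  have htot : ∫ p, Φ p ∂(μ.prod μ) = ‖∫ τ, f τ ∂μ‖ ^ 2 := by
    rw [integral_prod _ hΦi, ← real_inner_self_eq_norm_sq]
    have : ∀ τ, ∫ r, Φ (τ, r) ∂μ = inner ℝ (∫ r, f r ∂μ) (f τ) := fun τ => by
      rw [real_inner_comm]
      exact integral_inner hf (f τ)
    simp only [this]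
    exact integral_inner hf _
  rw [two_mul]
  nth_rewrite 1 [← h1]
  rw [← h2, ← integral_add hJ1 hJ2, hsplit, htot]

/-- The energy identity for the primitive of an integrable function. -/
theorem sq_norm_add_primitive {f : ℝ → V} {s t : ℝ}
    (hf : IntegrableOn f (Ioc s t)) (q₀ : V) :
    ‖q₀ + ∫ τ in Ioc s t, f τ‖ ^ 2 =
      ‖q₀‖ ^ 2 + 2 * ∫ τ in Ioc s t, inner ℝ (f τ) (q₀ + ∫ r in Ioc s τ, f r) := by
  obtain ⟨hI, h2⟩ := two_mul_integral_inner_primitive hf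
  have e : ∫ τ in Ioc s t, inner ℝ (f τ) (q₀ + ∫ r in Ioc s τ, f r)
      = ∫ τ in Ioc s t, (inner ℝ q₀ (f τ) +
        inner ℝ (f τ) (∫ r in Iic τ, f r ∂(volume.restrict (Ioc s t)))) := by
    refine setIntegral_congr_fun measurableSet_Ioc fun τ hτ => ?_
    have hset : Iic τ ∩ Ioc s t = Ioc s τ := by
      ext r
      simp only [mem_inter_iff, mem_Iic, mem_Ioc]
      exact ⟨fun h => ⟨h.2.1, h.1⟩, fun h => ⟨h.2, h.1, h.2.trans hτ.2⟩⟩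
    simp only [inner_add_right, Measure.restrict_restrict measurableSet_Iic, hset,
      real_inner_comm]
  rw [e, integral_add (hf.const_inner q₀) hI, integral_inner hf, mul_add, h2, norm_add_sq_real]
  ring

end Primitive

/-! ### Grönwall's inequality -/

section Gronwall

/-- Grönwall's inequality in integral form, for integrable functions. -/
theorem gronwall_integral {y : ℝ → ℝ} {s T a B : ℝ} (hsT : s < T) (ha : 0 < a)
    (hy : IntegrableOn y (Ioc s T))
    (h : ∀ t ∈ Ioc s T, y t ≤ B + a * ∫ τ in Ioc s t, y τ) :
    y T ≤ B * Real.exp (a * (T - s)) := by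
  have hyI : ∀ t ∈ Icc s T, IntervalIntegrable y volume s t := fun t ht =>
    (intervalIntegrable_iff_integrableOn_Ioc_of_le ht.1).2
      (hy.mono_set (Ioc_subset_Ioc_right ht.2))
  set Z : ℝ → ℝ := fun t => B + a * ∫ τ in s..t, y τ with hZ
  have hyZ : ∀ t ∈ Ioc s T, y t ≤ Z t := fun t ht => by
    have := h t ht
    rwa [← intervalIntegral.integral_of_le ht.1.le] at this
  have hZc : ContinuousOn Z (Icc s T) := by
    have := intervalIntegral.continuousOn_primitive_interval (μ := volume) (f := y) (a := s)
      (b := T) (by rw [uIcc_of_le hsT.le, integrableOn_Icc_iff_integrableOn_Ioc]; exact hy)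
    rw [uIcc_of_le hsT.le] at this
    exact continuousOn_const.add (continuousOn_const.mul this)
  have hZI : ∀ t ∈ Icc s T, IntervalIntegrable Z volume s t := fun t ht =>
    (hZc.mono (by rw [uIcc_of_le ht.1]; exact Icc_subset_Icc_right ht.2)).intervalIntegrable
  -- The function `y` is merely integrable, so the differential form is applied to the primitive `P`
  -- of its continuous majorant `Z`, for which `P' = Z ≤ B + a P`.
  set P : ℝ → ℝ := fun t => ∫ τ in s..t, Z τ with hP
  have hZP : ∀ t ∈ Icc s T, Z t ≤ B + a * P t := fun t ht => by
    simp only [hZ, hP]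
    gcongr
    rw [intervalIntegral.integral_of_le ht.1, intervalIntegral.integral_of_le ht.1]
    exact setIntegral_mono_on ((intervalIntegrable_iff_integrableOn_Ioc_of_le ht.1).1 (hyI t ht))
      ((intervalIntegrable_iff_integrableOn_Ioc_of_le ht.1).1 (hZI t ht)) measurableSet_Ioc
      fun τ hτ => hyZ τ ⟨hτ.1, hτ.2.trans ht.2⟩
  have hPd : ∀ t ∈ Ico s T, HasDerivWithinAt P (Z t) (Ici t) t := by
    intro t ht
    have hnt : t ∈ Icc s T := ⟨ht.1, ht.2.le⟩
    have hmem : Icc s T ∈ 𝓝[Ioi t] t :=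
      mem_of_superset (Ioc_mem_nhdsGT ht.2) fun r hr => ⟨ht.1.trans hr.1.le, hr.2⟩
    refine intervalIntegral.integral_hasDerivWithinAt_right (hZI t hnt) ?_ ?_
    · exact ⟨Icc s T, hmem, hZc.aestronglyMeasurable measurableSet_Icc⟩
    · exact ((hZc t hnt).mono_of_mem_nhdsWithin hmem)
  have hPc : ContinuousOn P (Icc s T) := by
    have := intervalIntegral.continuousOn_primitive_interval (μ := volume) (f := Z) (a := s)
      (b := T) (by rw [uIcc_of_le hsT.le]; exact hZc.integrableOn_compact isCompact_Icc)
    rwa [uIcc_of_le hsT.le] at this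
  have hT : T ∈ Icc s T := right_mem_Icc.2 hsT.le
  have key := le_gronwallBound_of_liminf_deriv_right_le (f := P) (f' := Z) (δ := 0) (K := a)
    (ε := B) hPc (fun t ht r hr => by
      have := (hPd t ht).liminf_right_slope_le hr
      refine this.mono fun z hz => ?_
      simpa [slope_def_field, div_eq_inv_mul] using hz)
    (by simp [hP]) (fun t ht => by
      have := hZP t ⟨ht.1, ht.2.le⟩
      linarith) T hT
  rw [gronwallBound_of_K_ne_0 ha.ne'] at key
  calc y T ≤ Z T := hyZ T (right_mem_Ioc.2 hsT)
    _ ≤ B + a * P T := hZP T hT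
    _ ≤ B + a * (0 * Real.exp (a * (T - s)) + B / a * (Real.exp (a * (T - s)) - 1)) := by gcongr
    _ = B * Real.exp (a * (T - s)) := by field_simp; ring

end Gronwall

/-! ### Mollification in space of functions of time and space -/

section ParametricSmoothing

variable {n : ℕ} {V : Type*} [NormedAddCommGroup V] [InnerProductSpace ℝ V]

theorem ae_memLp_slice {V : Type*} [NormedAddCommGroup V] {G : ℝ × Space n → V}
    (hGm : StronglyMeasurable G) (hG : MemLp G 2 volume) :
    ∀ᵐ τ, MemLp (fun x => G (τ, x)) 2 volume := by
  have h : Integrable (fun p => ‖G p‖ ^ 2) (volume.prod volume) :=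
    hG.integrable_norm_pow two_ne_zero
  filter_upwards [h.prod_right_ae] with τ hτ
  exact (memLp_two_iff_integrable_sq_norm
    (hGm.comp_measurable measurable_prodMk_left).aestronglyMeasurable).2 hτ

theorem memLp_of_slice_le {W : Type*} [NormedAddCommGroup W] {S : ℝ × Space n → W}
    (hSm : StronglyMeasurable S) {μ : Measure ℝ} [SFinite μ] {b : ℝ → ℝ} (hb : Integrable b μ)
    (h : ∀ᵐ τ ∂μ, MemLp (fun x => S (τ, x)) 2 volume ∧ ∫ x, ‖S (τ, x)‖ ^ 2 ≤ b τ) :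
    MemLp S 2 (μ.prod volume) := by
  rw [memLp_two_iff_integrable_sq_norm hSm.aestronglyMeasurable]
  have hm : AEStronglyMeasurable (fun p => ‖S p‖ ^ 2) (μ.prod volume) :=
    (hSm.norm.pow 2).aestronglyMeasurable
  refine (integrable_prod_iff hm).2 ⟨?_, ?_⟩
  · filter_upwards [h] with τ hτ using hτ.1.integrable_norm_pow two_ne_zero
  · refine hb.mono' ?_ ?_
    · exact (hSm.norm.pow 2).norm.integral_prod_right.aestronglyMeasurable
    · filter_upwards [h] with τ hτ
      simp only [norm_pow, norm_norm]
      rw [Real.norm_of_nonneg (integral_nonneg fun x => sq_nonneg _)]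
      exact hτ.2

theorem memLp_parametric_smoothing {η : Space n → ℝ} (hη : ContDiff ℝ ∞ η)
    (hc : HasCompactSupport η) {G : ℝ × Space n → V} (hGm : StronglyMeasurable G)
    (hG : MemLp G 2 volume) :
    MemLp (fun p : ℝ × Space n => smoothing η (fun y => G (p.1, y)) p.2) 2 volume := by
  have hI : Integrable fun τ => ∫ x, ‖G (τ, x)‖ ^ 2 := by
    have h : Integrable (fun p => ‖G p‖ ^ 2) (volume.prod volume) :=
      hG.integrable_norm_pow two_ne_zero
    exact h.integral_prod_left
  refine memLp_of_slice_le (stronglyMeasurable_smoothing hη.continuous hGm)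
    (hI.const_mul ((∫ y, |η y|) ^ 2)) ?_
  filter_upwards [ae_memLp_slice hGm hG] with τ hτ
  exact ⟨memLp_smoothing hη hc hτ, integral_sq_norm_smoothing_le hη hc hτ⟩

/-- The squared `L²` error of mollification of a time slice. -/
noncomputable def mollifyError (k : ℕ) (G : ℝ × Space n → V) (τ : ℝ) : ℝ :=
  ∫ x, ‖smoothing (mollifier n k) (fun y => G (τ, y)) x - G (τ, x)‖ ^ 2

theorem mollifyError_nonneg (k : ℕ) (G : ℝ × Space n → V) (τ : ℝ) : 0 ≤ mollifyError k G τ :=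
  integral_nonneg fun _ => sq_nonneg _

theorem integrable_sq_norm_slice {V : Type*} [NormedAddCommGroup V] {G : ℝ × Space n → V}
    (hG : MemLp G 2 volume) : Integrable fun τ => ∫ x, ‖G (τ, x)‖ ^ 2 := by
  have h : Integrable (fun p => ‖G p‖ ^ 2) (volume.prod volume) :=
    hG.integrable_norm_pow two_ne_zero
  exact h.integral_prod_left

theorem integrable_mollifyError (k : ℕ) {G : ℝ × Space n → V} (hGm : StronglyMeasurable G)
    (hG : MemLp G 2 volume) : Integrable (mollifyError k G) := by
  have h := ((memLp_parametric_smoothing (contDiff_mollifier n k)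
    (hasCompactSupport_mollifier n k) hGm hG).sub hG)
  exact integrable_sq_norm_slice h

/-- Mollification converges in `L²` on almost every time slice, and four times the squared norm of
the slice dominates. -/
theorem tendsto_integral_mollifyError [CompleteSpace V] {G : ℝ × Space n → V}
    (hGm : StronglyMeasurable G) (hG : MemLp G 2 volume) :
    Tendsto (fun k => ∫ τ, mollifyError k G τ) atTop (𝓝 0) := by
  have hdom := (integrable_sq_norm_slice hG).const_mul 4
  have h := tendsto_integral_of_dominated_convergence (F := fun k => mollifyError k G)
    (f := fun _ => 0) _ (fun k => (integrable_mollifyError k hGm hG).1) hdom ?_ ?_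
  · simpa using h
  · intro k
    filter_upwards [ae_memLp_slice hGm hG] with τ hτ
    rw [Real.norm_of_nonneg (mollifyError_nonneg k G τ)]
    exact integral_sq_norm_smoothing_sub_le hτ k
  · filter_upwards [ae_memLp_slice hGm hG] with τ hτ
    exact tendsto_integral_sq_norm_smoothing_sub hτ

end ParametricSmoothing
-- The equation satisfied by the mollified solution
section Regularised

variable {n N : ℕ}

/-- The time derivative of the smoothed solution. -/
noncomputable def forcing (m : ℕ) (η : Space n → ℝ) (G : MultiIndex n → ℝ × Space n → Target N)
    (p : ℝ × Space n) : Target N :=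
  -((-1 : ℝ) ^ m • ∑ α ∈ multiIndices n m, smoothing (multiDeriv α η) (fun y => G α (p.1, y)) p.2)

variable {m : ℕ} {A : Coeff n N} {s : ℝ} {h : Space n → Target N} {u : ℝ → Space n → Target N}
  {G D : MultiIndex n → ℝ × Space n → Target N} {η : Space n → ℝ}

theorem IsMildSolution.stronglyMeasurable_forcing (H : IsMildSolution m A s h u G D)
    (hη : ContDiff ℝ ∞ η) : StronglyMeasurable (forcing m η G) := by
  have hsum : StronglyMeasurable fun p : ℝ × Space n =>
      ∑ α ∈ multiIndices n m, smoothing (multiDeriv α η) (fun y => G α (p.1, y)) p.2 :=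
    Finset.stronglyMeasurable_fun_sum _ fun α hα =>
      stronglyMeasurable_smoothing (contDiff_multiDeriv hη α).continuous (H.measurable_flux α hα)
  exact (hsum.const_smul ((-1 : ℝ) ^ m)).neg

theorem IsMildSolution.memLp_forcing (H : IsMildSolution m A s h u G D)
    (hη : ContDiff ℝ ∞ η) (hc : HasCompactSupport η) : MemLp (forcing m η G) 2 volume := by
  have hsum : MemLp (fun p : ℝ × Space n => ∑ α ∈ multiIndices n m,
      smoothing (multiDeriv α η) (fun y => G α (p.1, y)) p.2) 2 volume :=
    memLp_finsetSum _ fun α hα => memLp_parametric_smoothing (contDiff_multiDeriv hη α)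
      (hasCompactSupport_multiDeriv hc α) (H.measurable_flux α hα) (H.memLp_flux α hα)
  exact (hsum.const_smul ((-1 : ℝ) ^ m)).neg

theorem hasCompactSupport_comp_sub {V : Type*} [Zero V] {χ : Space n → V}
    (hc : HasCompactSupport χ) (x : Space n) : HasCompactSupport fun y => χ (x - y) :=
  hc.comp_homeomorph (Homeomorph.subLeft x)

theorem IsMildSolution.integrableOn_forcing (H : IsMildSolution m A s h u G D)
    (hη : ContDiff ℝ ∞ η) (hc : HasCompactSupport η) (x : Space n) (t : ℝ) :
    IntegrableOn (fun τ => forcing m η G (τ, x)) (Ioc s t) := by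
  refine Integrable.neg (Integrable.smul ((-1 : ℝ) ^ m) ?_)
  refine integrable_finsetSum _ fun α hα => ?_
  simp only [smoothing_apply]
  exact integrableOn_time_integral (χ := fun y => multiDeriv α η (x - y))
    ((contDiff_multiDeriv hη α).continuous.comp (continuous_const.sub continuous_id))
    (hasCompactSupport_comp_sub (hasCompactSupport_multiDeriv hc α) x) (H.memLp_flux α hα) s t

theorem multiDeriv_comp_sub {V : Type*} [NormedAddCommGroup V] [NormedSpace ℝ V] {χ : Space n → V}
    (hχ : ContDiff ℝ ∞ χ) (x y : Space n) (α : MultiIndex n) :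
    multiDeriv α (fun y => χ (x - y)) y = (-1 : ℝ) ^ α.length • multiDeriv α χ (x - y) := by
  have e : (fun y => χ (x - y)) = fun y => χ (x + (-1 : ℝ) • y) := by
    funext y; simp [sub_eq_add_neg]
  rw [e, multiDeriv_eq_wordDeriv, wordDeriv_comp_affine hχ, multiDeriv_eq_wordDeriv,
    length_indexWord]
  simp [sub_eq_add_neg]

/-- Test the integrated equation with `χ = η(x - ·)`. The reflection accounts for the sign `(-1)^m`
in `forcing`, and the formula holds at every `x`. -/
theorem IsMildSolution.smoothing_eq (H : IsMildSolution m A s h u G D)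
    (hη : ContDiff ℝ ∞ η) (hc : HasCompactSupport η) {t : ℝ} (ht : s < t) (x : Space n) :
    smoothing η (u t) x = smoothing η h x + ∫ τ in Ioc s t, forcing m η G (τ, x) := by
  have hχ : ContDiff ℝ ∞ fun y => η (x - y) := hη.comp (contDiff_const.sub contDiff_id)
  have key := H.integral_eq (fun y => η (x - y)) hχ (hasCompactSupport_comp_sub hc x) t ht
  rw [smoothing_apply, smoothing_apply, key, sub_eq_add_neg, ← integral_neg]
  congr 1
  refine integral_congr_ae (Eventually.of_forall fun τ => ?_)
  simp only [forcing, smoothing_apply, Finset.smul_sum]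
  congr 1
  refine Finset.sum_congr rfl fun α hα => ?_
  simp only [multiDeriv_comp_sub hη, mem_multiIndices.1 hα, smul_assoc]
  exact integral_smul _ _

theorem sq_norm_integral_le {V : Type*} [NormedAddCommGroup V] [NormedSpace ℝ V] {f : ℝ → V}
    {s t : ℝ} (hst : s ≤ t) (hf : AEStronglyMeasurable f volume)
    (hf2 : Integrable fun τ => ‖f τ‖ ^ 2) :
    ‖∫ τ in Ioc s t, f τ‖ ^ 2 ≤ (t - s) * ∫ τ, ‖f τ‖ ^ 2 := by
  have h := (sq_integral_mul_le (μ := volume.restrict (Ioc s t)) (w := fun _ => 1)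
    (G := fun τ => ‖f τ‖) (fun _ => zero_le_one) (integrable_const _) hf.norm.restrict
    (by simpa using hf2.restrict)).2
  simp only [one_mul, integral_const, smul_eq_mul, mul_one, measureReal_restrict_apply_univ,
    Real.volume_real_Ioc_of_le hst] at h
  calc ‖∫ τ in Ioc s t, f τ‖ ^ 2 ≤ (∫ τ in Ioc s t, ‖f τ‖) ^ 2 := by
        gcongr; exact norm_integral_le_integral_norm _
    _ ≤ (t - s) * ∫ τ in Ioc s t, ‖f τ‖ ^ 2 := h
    _ ≤ (t - s) * ∫ τ, ‖f τ‖ ^ 2 := by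
        refine mul_le_mul_of_nonneg_left ?_ (by linarith)
        exact setIntegral_le_integral hf2 (Eventually.of_forall fun τ => sq_nonneg _)

/-- Global square integrability of `u t` is not available at this stage. It is not needed: the datum
is in `L²`, and so is the forcing, since all derivatives fall on `η` and the flux is in `L²`;
Cauchy–Schwarz in time controls the primitive. -/
theorem IsMildSolution.memLp_smoothing_solution (H : IsMildSolution m A s h u G D)
    (hh : MemLp h 2 volume)
    (hη : ContDiff ℝ ∞ η) (hc : HasCompactSupport η) {t : ℝ} (ht : s < t) :
    MemLp (smoothing η (u t)) 2 volume ∧ ∫ x, ‖smoothing η (u t) x‖ ^ 2 ≤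
      2 * (∫ x, ‖smoothing η h x‖ ^ 2) + 2 * ((t - s) * ∫ p, ‖forcing m η G p‖ ^ 2) := by
  have hFm := H.stronglyMeasurable_forcing hη
  have hF : Integrable (fun p => ‖forcing m η G p‖ ^ 2) (volume.prod volume) :=
    (H.memLp_forcing hη hc).integrable_norm_pow two_ne_zero
  have hcont := (contDiff_smoothing hη hc (H.locallyIntegrable t ht)).continuous
  have hh' := memLp_smoothing hη hc hh
  have hpt : ∀ᵐ x, ‖smoothing η (u t) x‖ ^ 2 ≤ 2 * ‖smoothing η h x‖ ^ 2
      + 2 * ((t - s) * ∫ τ, ‖forcing m η G (τ, x)‖ ^ 2) := by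
    filter_upwards [hF.prod_left_ae] with x hx
    have h1 := sq_norm_integral_le (f := fun τ => forcing m η G (τ, x)) ht.le
      (hFm.comp_measurable measurable_prodMk_right).aestronglyMeasurable hx
    rw [H.smoothing_eq hη hc ht x]
    have h2 := parallelogram_sub (smoothing η h x) (∫ τ in Ioc s t, forcing m η G (τ, x))
    have h3 := sq_nonneg ‖smoothing η h x - ∫ τ in Ioc s t, forcing m η G (τ, x)‖
    linarith
  have i1 := (hh'.integrable_norm_pow two_ne_zero).const_mul 2
  have i2 := (hF.integral_prod_right.const_mul (t - s)).const_mul 2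
  have hmem : Integrable fun x => ‖smoothing η (u t) x‖ ^ 2 := by
    refine (i1.add i2).mono' (hcont.norm.pow 2).aestronglyMeasurable ?_
    filter_upwards [hpt] with x hx
    rw [Real.norm_of_nonneg (sq_nonneg _)]
    exact hx
  refine ⟨(memLp_two_iff_integrable_sq_norm hcont.aestronglyMeasurable).2 hmem, ?_⟩
  refine (integral_mono_ae hmem (i1.add i2) hpt).trans (le_of_eq ?_)
  rw [integral_add' i1 i2, integral_const_mul, integral_const_mul, integral_const_mul]
  congr 3
  exact (integral_prod_symm _ hF).symm

/-- The previous bound applies equally to the kernels `∂^w η`, which are the derivatives of the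
mollified solution. -/
theorem IsMildSolution.isSobolev_smoothing_solution (H : IsMildSolution m A s h u G D)
    (hh : MemLp h 2 volume) (hη : ContDiff ℝ ∞ η) (hc : HasCompactSupport η) {t : ℝ}
    (ht : s < t) : IsSobolev (smoothing η (u t)) := by
  refine isSobolev_of_wordDeriv (contDiff_smoothing hη hc (H.locallyIntegrable t ht)) fun w => ?_
  rw [wordDeriv_smoothing hη hc (H.locallyIntegrable t ht)]
  exact (H.memLp_smoothing_solution hh (contDiff_wordDeriv hη w)
    (hasCompactSupport_wordDeriv hc w) ht).1

/-- The smoothed solution as an everywhere defined jointly measurable function. -/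
noncomputable def smoothedState (m : ℕ) (s : ℝ) (h : Space n → Target N) (η : Space n → ℝ)
    (G : MultiIndex n → ℝ × Space n → Target N) (p : ℝ × Space n) : Target N :=
  smoothing η h p.2 + ∫ τ in Ioc s p.1, forcing m η G (τ, p.2)

theorem IsMildSolution.stronglyMeasurable_smoothedState (H : IsMildSolution m A s h u G D)
    (hh : MemLp h 2 volume) (hη : ContDiff ℝ ∞ η) (hc : HasCompactSupport η) :
    StronglyMeasurable (smoothedState m s h η G) := by
  refine StronglyMeasurable.add ?_ ?_
  · exact ((contDiff_smoothing hη hc (hh.locallyIntegrable (by norm_num))).continuous.comp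
      continuous_snd).stronglyMeasurable
  · have e : (fun p : ℝ × Space n => ∫ τ in Ioc s p.1, forcing m η G (τ, p.2)) =
        fun p : ℝ × Space n => ∫ τ, ({q : (ℝ × Space n) × ℝ | s < q.2 ∧ q.2 ≤ q.1.1}).indicator
          (fun q => forcing m η G (q.2, q.1.2)) (p, τ) := by
      funext p
      rw [← integral_indicator measurableSet_Ioc]
      rfl
    rw [e]
    refine StronglyMeasurable.integral_prod_right' (f :=
      ({q : (ℝ × Space n) × ℝ | s < q.2 ∧ q.2 ≤ q.1.1}).indicator
          (fun q => forcing m η G (q.2, q.1.2))) ?_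
    refine StronglyMeasurable.indicator ?_ ?_
    · exact (H.stronglyMeasurable_forcing hη).comp_measurable (by fun_prop)
    · exact (measurableSet_lt measurable_const measurable_snd).inter
        (measurableSet_le measurable_snd (measurable_fst.comp measurable_fst))

theorem IsMildSolution.memLp_smoothedState (H : IsMildSolution m A s h u G D)
    (hh : MemLp h 2 volume) (hη : ContDiff ℝ ∞ η) (hc : HasCompactSupport η) (T : ℝ) :
    MemLp (smoothedState m s h η G) 2 ((volume.restrict (Ioc s T)).prod volume) := by
  refine memLp_of_slice_le (H.stronglyMeasurable_smoothedState hh hη hc)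
    (b := fun _ => 2 * (∫ x, ‖smoothing η h x‖ ^ 2) +
      2 * ((T - s) * ∫ p, ‖forcing m η G p‖ ^ 2)) (integrable_const _) ?_
  refine (ae_restrict_iff' measurableSet_Ioc).2 (Eventually.of_forall fun t ht => ?_)
  have e : (fun x => smoothedState m s h η G (t, x)) = smoothing η (u t) := by
    funext x
    rw [H.smoothing_eq hη hc ht.1]
    rfl
  have key := H.memLp_smoothing_solution hh hη hc ht.1
  refine ⟨e ▸ key.1, ?_⟩
  have e2 : ∫ x, ‖smoothedState m s h η G (t, x)‖ ^ 2 = ∫ x, ‖smoothing η (u t) x‖ ^ 2 := by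
    rw [← e]
  rw [e2]
  refine key.2.trans ?_
  have : 0 ≤ ∫ p, ‖forcing m η G p‖ ^ 2 := integral_nonneg fun _ => sq_nonneg _
  gcongr
  exact ht.2

/-- The weighted energy identity for the smoothed solution. -/
theorem IsMildSolution.energy_identity (H : IsMildSolution m A s h u G D)
    (hh : MemLp h 2 volume) (hη : ContDiff ℝ ∞ η) (hc : HasCompactSupport η)
    {b : Space n → ℝ} (hb : Continuous b) {C : ℝ} (hbC : ∀ x, |b x| ≤ C) {t : ℝ} (ht : s < t) :
    IntegrableOn (fun τ => ∫ x, b x * inner ℝ (forcing m η G (τ, x)) (smoothing η (u τ) x))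
      (Ioc s t) ∧
    ∫ x, b x * ‖smoothing η (u t) x‖ ^ 2 = (∫ x, b x * ‖smoothing η h x‖ ^ 2) +
      2 * ∫ τ in Ioc s t,
        ∫ x, b x * inner ℝ (forcing m η G (τ, x)) (smoothing η (u τ) x) := by
  set Q := smoothedState m s h η G with hQ
  have hQe : ∀ τ ∈ Ioc s t, ∀ x, Q (τ, x) = smoothing η (u τ) x := fun τ hτ x =>
    (H.smoothing_eq hη hc hτ.1 x).symm
  have hF : MemLp (forcing m η G) 2 ((volume.restrict (Ioc s t)).prod volume) := by
    have := (H.memLp_forcing hη hc).restrict (Ioc s t ×ˢ (univ : Set (Space n)))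
    rwa [Measure.volume_eq_prod, ← Measure.prod_restrict, Measure.restrict_univ] at this
  have hI : Integrable (fun p : ℝ × Space n => b p.2 * inner ℝ (forcing m η G p) (Q p))
      ((volume.restrict (Ioc s t)).prod volume) :=
    Integrable.bdd_mul
      (integrable_bilin (B := innerSL ℝ) hF (H.memLp_smoothedState hh hη hc t))
      (hb.comp continuous_snd).aestronglyMeasurable (Eventually.of_forall fun p => hbC p.2)
  have eτ : ∀ τ ∈ Ioc s t, ∫ x, b x * inner ℝ (forcing m η G (τ, x)) (Q (τ, x))
      = ∫ x, b x * inner ℝ (forcing m η G (τ, x)) (smoothing η (u τ) x) := fun τ hτ => by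
    simp only [hQe τ hτ]
  refine ⟨hI.integral_prod_left.congr ((ae_restrict_iff' measurableSet_Ioc).2
    (Eventually.of_forall eτ)), ?_⟩
  -- For each fixed `x` this is the energy identity of a primitive in time; integration in `x` and
  -- Fubini finish.
  have hpt : ∀ x, b x * ‖smoothing η (u t) x‖ ^ 2 = b x * ‖smoothing η h x‖ ^ 2 +
      2 * ∫ τ in Ioc s t, b x * inner ℝ (forcing m η G (τ, x)) (Q (τ, x)) := by
    intro x
    rw [H.smoothing_eq hη hc ht x,
      sq_norm_add_primitive (H.integrableOn_forcing hη hc x t) (smoothing η h x), integral_const_mul]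
    simp only [hQ, smoothedState]
    ring
  have i1 : Integrable fun x => b x * ‖smoothing η h x‖ ^ 2 :=
    ((memLp_smoothing hη hc hh).integrable_norm_pow two_ne_zero).bdd_mul
      hb.aestronglyMeasurable (Eventually.of_forall hbC)
  have i2 := hI.integral_prod_right
  simp only [hpt]
  rw [integral_add i1 (i2.const_mul 2), integral_const_mul]
  congr 2
  rw [← integral_prod_symm _ hI, integral_prod _ hI]
  exact setIntegral_congr_fun measurableSet_Ioc eτ

end Regularised
-- Weighted energy estimate and passage to the limit
section WeightedEstimate

variable {n N : ℕ}

theorem IsElliptic.ae_isEllipticSlice {m : ℕ} {lam Lam : ℝ} {A : Coeff n N}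
    (hA : IsElliptic m lam Lam A) :
    ∀ᵐ t ∂(volume.restrict (Ioi (0 : ℝ))), IsEllipticSlice m lam Lam (A t) := by
  have hmeas : ∀ᵐ t ∂(volume.restrict (Ioi (0 : ℝ))), ∀ α ∈ multiIndices n m,
      ∀ β ∈ multiIndices n m, ∀ i j, AEStronglyMeasurable (fun x => A t x α β i j) volume := by
    refine (ae_ball_iff (Finset.countable_toSet _)).2 fun α hα =>
      (ae_ball_iff (Finset.countable_toSet _)).2 fun β hβ =>
        ae_all_iff.2 fun i => ae_all_iff.2 fun j => ?_
    have h := hA.measurable α hα β hβ i j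
    rw [restrict_prod_univ_eq] at h
    exact h.prodMk_left
  have hbdd := hA.ae_bounded
  rw [restrict_prod_univ_eq] at hbdd
  filter_upwards [hmeas, Measure.ae_ae_of_ae_prod hbdd, hA.garding] with t h1 h2 h3
  refine ⟨h1, h2, fun v hv => ?_⟩
  refine (h3 v (fun α => multiDeriv α v) fun α _ =>
    ⟨hv.isWeakDeriv α, (hv.multiDeriv α).memLp_two⟩).trans (le_of_eq ?_)
  have comp : ∀ (γ : MultiIndex n) (i : Fin N), MemLp (fun x => multiDeriv γ v x i) 2 volume :=
    fun γ i => (hv.multiDeriv γ).memLp_two.norm.mono'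
      ((PiLp.continuous_apply 2 (fun _ : Fin N => ℂ) i).comp_aestronglyMeasurable
        (hv.multiDeriv γ).memLp_two.1)
      (Eventually.of_forall fun x => PiLp.norm_apply_le _ i)
  have hint : ∀ α ∈ multiIndices n m, ∀ β ∈ multiIndices n m, ∀ i j,
      Integrable fun x => A t x α β i j * multiDeriv β v x j * star (multiDeriv α v x i) := by
    intro α hα β hβ i j
    have m1 : MemLp (fun x => A t x α β i j * multiDeriv β v x j) 2 volume := by
      refine ((comp β j).norm.const_mul Lam).mono' ((h1 α hα β hβ i j).mul (comp β j).1) ?_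
      filter_upwards [h2] with x hx
      rw [norm_mul]
      exact mul_le_mul_of_nonneg_right (hx α hα β hβ i j) (norm_nonneg _)
    exact m1.integrable_mul (comp α i).star
  rw [Complex.re_sum]
  refine Finset.sum_congr rfl fun α hα => ?_
  have e : ∀ x, inner ℝ (multiDeriv α v x) (coeffApply m (A t x) (fun β => multiDeriv β v x) α)
      = (∑ β ∈ multiIndices n m, ∑ i, ∑ j,
        A t x α β i j * multiDeriv β v x j * star (multiDeriv α v x i)).re := by
    intro x
    rw [real_inner_eq_re, ← Complex.re_sum, Finset.sum_comm]
    congr 1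
    refine Finset.sum_congr rfl fun i _ => ?_
    simp only [coeffApply, Finset.sum_mul]
  simp only [e]
  have hI : Integrable fun x => ∑ β ∈ multiIndices n m, ∑ i, ∑ j,
      A t x α β i j * multiDeriv β v x j * star (multiDeriv α v x i) :=
    integrable_finsetSum _ fun β hβ => integrable_finsetSum _ fun i _ =>
      integrable_finsetSum _ fun j _ => hint α hα β hβ i j
  rw [show (∫ x, (∑ β ∈ multiIndices n m, ∑ i, ∑ j,
      A t x α β i j * multiDeriv β v x j * star (multiDeriv α v x i)).re)
      = (∫ x, ∑ β ∈ multiIndices n m, ∑ i, ∑ j,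
      A t x α β i j * multiDeriv β v x j * star (multiDeriv α v x i)).re from integral_re hI]
  rw [integral_finsetSum _ fun β hβ => integrable_finsetSum _ fun i _ =>
      integrable_finsetSum _ fun j _ => hint α hα β hβ i j]
  congr 1
  refine Finset.sum_congr rfl fun β hβ => ?_
  rw [integral_finsetSum _ fun i _ => integrable_finsetSum _ fun j _ => hint α hα β hβ i j]
  refine Finset.sum_congr rfl fun i _ => ?_
  rw [integral_finsetSum _ fun j _ => hint α hα β hβ i j]

/-- The definition of the weak derivative, tested with `η(x - ·)`; the sign from the reflection
cancels the one from the integration by parts. -/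
theorem IsWeakDeriv.multiDeriv_smoothing {α : MultiIndex n} {f g : Space n → Target N}
    (hw : IsWeakDeriv α f g) {η : Space n → ℝ} (hη : ContDiff ℝ ∞ η) (hc : HasCompactSupport η) :
    multiDeriv α (smoothing η f) = smoothing η g := by
  funext x
  have hχ : ContDiff ℝ ∞ fun y => η (x - y) := hη.comp (contDiff_const.sub contDiff_id)
  have h := hw.2.2 (fun y => η (x - y)) hχ (hasCompactSupport_comp_sub hc x)
  simp only [multiDeriv_comp_sub hη, smul_assoc] at h
  rw [integral_smul] at h
  rw [HigherOrderParabolic.multiDeriv_smoothing hη hc hw.1, smoothing_apply, smoothing_apply]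
  exact smul_right_injective _ (pow_ne_zero α.length (by norm_num : (-1 : ℝ) ≠ 0)) h

/-- A bound for the commutator of the flux with mollification. -/
noncomputable def fluxError (m : ℕ) (B : ℝ) (k : ℕ) (G D : MultiIndex n → ℝ × Space n → Target N)
    (τ : ℝ) : ℝ :=
  ∑ α ∈ multiIndices n m, (2 * mollifyError k (G α) τ +
    2 * (B ^ 2 * (multiIndices n m).card) * ∑ β ∈ multiIndices n m, mollifyError k (D β) τ)

theorem fluxError_nonneg (m : ℕ) (B : ℝ) (k : ℕ) (G D : MultiIndex n → ℝ × Space n → Target N)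
    (τ : ℝ) : 0 ≤ fluxError m B k G D τ :=
  Finset.sum_nonneg fun α _ => add_nonneg (mul_nonneg zero_le_two (mollifyError_nonneg _ _ _))
    (mul_nonneg (by positivity) (Finset.sum_nonneg fun β _ => mollifyError_nonneg _ _ _))

variable {m : ℕ} {A : Coeff n N} {s : ℝ} {h : Space n → Target N} {u : ℝ → Space n → Target N}
  {G D : MultiIndex n → ℝ × Space n → Target N}

theorem IsMildSolution.integrable_fluxError (H : IsMildSolution m A s h u G D) (B : ℝ) (k : ℕ) :
    Integrable (fluxError m B k G D) :=
  integrable_finsetSum _ fun α hα =>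
    ((integrable_mollifyError k (H.measurable_flux α hα) (H.memLp_flux α hα)).const_mul 2).add
      ((integrable_finsetSum _ fun β hβ =>
        integrable_mollifyError k (H.measurable_grad β hβ) (H.memLp_grad β hβ)).const_mul _)

theorem IsMildSolution.tendsto_integral_fluxError (H : IsMildSolution m A s h u G D) (B : ℝ) :
    Tendsto (fun k => ∫ τ, fluxError m B k G D τ) atTop (𝓝 0) := by
  have iG := fun k α hα => integrable_mollifyError k (H.measurable_flux α hα) (H.memLp_flux α hα)
  have iD := fun k α hα => integrable_mollifyError k (H.measurable_grad α hα) (H.memLp_grad α hα)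
  have e : (fun k => ∫ τ, fluxError m B k G D τ) = fun k => ∑ α ∈ multiIndices n m,
      (2 * (∫ τ, mollifyError k (G α) τ) + 2 * (B ^ 2 * (multiIndices n m).card) *
        ∑ β ∈ multiIndices n m, ∫ τ, mollifyError k (D β) τ) := by
    funext k
    have i2 := (integrable_finsetSum _ fun β hβ => iD k β hβ).const_mul
      (2 * (B ^ 2 * (multiIndices n m).card))
    simp only [fluxError]
    refine (integral_finsetSum _ fun α hα => ((iG k α hα).const_mul 2).add i2).trans
      (Finset.sum_congr rfl fun α hα => ?_)
    refine (integral_add ((iG k α hα).const_mul 2) i2).trans ?_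
    rw [integral_const_mul, integral_const_mul,
      integral_finsetSum _ fun β hβ => iD k β hβ]
  rw [e]
  have := tendsto_finsetSum (multiIndices n m) fun α hα =>
    ((tendsto_integral_mollifyError (H.measurable_flux α hα) (H.memLp_flux α hα)).const_mul
      (2 : ℝ)).add ((tendsto_finsetSum (multiIndices n m) fun β hβ =>
        tendsto_integral_mollifyError (H.measurable_grad β hβ) (H.memLp_grad β hβ)).const_mul
          (2 * (B ^ 2 * (multiIndices n m).card)))
  simpa using this

/-- The mollified flux is close to the flux of the mollified solution. -/
theorem integral_sq_norm_smoothing_flux_sub_le {lam Lam : ℝ}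
    {a : Space n → MultiIndex n → MultiIndex n → Fin N → Fin N → ℂ}
    (ha : IsEllipticSlice m lam Lam a) {τ : ℝ} (k : ℕ) {α : MultiIndex n}
    (hα : α ∈ multiIndices n m)
    (hG : MemLp (fun x => G α (τ, x)) 2 volume)
    (hD : ∀ β ∈ multiIndices n m, MemLp (fun x => D β (τ, x)) 2 volume)
    (hGD : (fun x => G α (τ, x)) =ᵐ[volume] fun x => coeffApply m (a x) (fun β => D β (τ, x)) α) :
    ∫ x, ‖smoothing (mollifier n k) (fun y => G α (τ, y)) x - coeffApply m (a x)
        (fun β => smoothing (mollifier n k) (fun y => D β (τ, y)) x) α‖ ^ 2 ≤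
      2 * mollifyError k (G α) τ + 2 * ((N * (Lam * N)) ^ 2 * (multiIndices n m).card) *
        ∑ β ∈ multiIndices n m, mollifyError k (D β) τ := by
  have mG := memLp_smoothing_mollifier hG k
  have mD := fun β hβ => memLp_smoothing_mollifier (hD β hβ) k
  have i1 : Integrable fun x => ‖smoothing (mollifier n k) (fun y => G α (τ, y)) x - G α (τ, x)‖ ^ 2 :=
    (mG.sub hG).integrable_norm_pow two_ne_zero
  have i2 : ∀ β ∈ multiIndices n m, Integrable fun x =>
      ‖smoothing (mollifier n k) (fun y => D β (τ, y)) x - D β (τ, x)‖ ^ 2 := fun β hβ =>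
    ((mD β hβ).sub (hD β hβ)).integrable_norm_pow two_ne_zero
  have i3 := (integrable_finsetSum _ i2).const_mul
    (2 * ((N * (Lam * N)) ^ 2 * (multiIndices n m).card))
  have mC : MemLp (fun x => coeffApply m (a x)
        (fun β => smoothing (mollifier n k) (fun y => D β (τ, y)) x) α) 2 volume :=
    memLp_coeffApply (ha.measurable α hα) (ha.bounded.mono fun x hx => hx α hα) mD
  have hpt : ∀ᵐ x, ‖smoothing (mollifier n k) (fun y => G α (τ, y)) x - coeffApply m (a x)
        (fun β => smoothing (mollifier n k) (fun y => D β (τ, y)) x) α‖ ^ 2 ≤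
      2 * ‖smoothing (mollifier n k) (fun y => G α (τ, y)) x - G α (τ, x)‖ ^ 2 +
      2 * ((N * (Lam * N)) ^ 2 * (multiIndices n m).card) * ∑ β ∈ multiIndices n m,
        ‖smoothing (mollifier n k) (fun y => D β (τ, y)) x - D β (τ, x)‖ ^ 2 := by
    -- Since `G = A D`, the defect equals `(η * G - G) - A (η * D - D)`. The coefficients are never
    -- mollified, so boundedness suffices.
    filter_upwards [hGD, ha.bounded] with x hx hb
    have h1 := norm_coeffApply_le (hb α hα)
      (fun β => smoothing (mollifier n k) (fun y => D β (τ, y)) x - D β (τ, x))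
    rw [← coeffApply_sub, ← hx] at h1
    have h2 := sq_sum_le_card_mul_sum_sq (s := multiIndices n m)
      (f := fun β => ‖smoothing (mollifier n k) (fun y => D β (τ, y)) x - D β (τ, x)‖)
    have h3 := parallelogram_sub (smoothing (mollifier n k) (fun y => G α (τ, y)) x - G α (τ, x))
      (coeffApply m (a x) (fun β => smoothing (mollifier n k) (fun y => D β (τ, y)) x) α
        - G α (τ, x))
    rw [sub_sub_sub_cancel_right] at h3
    have h4 := pow_le_pow_left₀ (norm_nonneg _) h1 2
    rw [mul_pow] at h4
    have h5 := mul_le_mul_of_nonneg_left h2 (sq_nonneg ((N : ℝ) * (Lam * N)))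
    nlinarith [sq_nonneg ‖smoothing (mollifier n k) (fun y => G α (τ, y)) x - G α (τ, x) +
      (coeffApply m (a x) (fun β => smoothing (mollifier n k) (fun y => D β (τ, y)) x) α
        - G α (τ, x))‖]
  refine (integral_mono_ae ((mG.sub mC).integrable_norm_pow two_ne_zero)
    ((i1.const_mul 2).add i3) hpt).trans (le_of_eq ?_)
  refine (integral_add (i1.const_mul 2) i3).trans ?_
  rw [integral_const_mul, integral_const_mul,
    integral_finsetSum _ i2]
  rfl

/-- The work of the forcing term, expressed by the fluxes. -/
theorem integral_weight_inner_forcing {b : Space n → ℝ} (hb : IsBoundedSmooth b)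
    {η : Space n → ℝ} (hη : ContDiff ℝ ∞ η) (hc : HasCompactSupport η) {τ : ℝ}
    (hG : ∀ α ∈ multiIndices n m, MemLp (fun x => G α (τ, x)) 2 volume)
    {q : Space n → Target N} (hq : IsSobolev q) :
    ∫ x, b x * inner ℝ (forcing m η G (τ, x)) (q x) =
      -∑ α ∈ multiIndices n m, ∫ x, inner ℝ (smoothing η (fun y => G α (τ, y)) x)
        (multiDeriv α (fun y => b y • q y) x) := by
  have hbq := IsSobolev.smul hb hq
  have hW := fun α hα => isSobolev_smoothing hη hc (hG α hα)
  have e1 : ∀ x, b x * inner ℝ (forcing m η G (τ, x)) (q x) =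
      ∑ α ∈ multiIndices n m, -(-1 : ℝ) ^ m *
        innerSL ℝ (multiDeriv α (smoothing η (fun y => G α (τ, y))) x) (b x • q x) := by
    intro x
    simp only [forcing, innerSL_apply_apply, inner_neg_left, inner_smul_left, inner_smul_right, sum_inner,
      Finset.mul_sum, RCLike.conj_to_real]
    rw [← Finset.sum_neg_distrib, Finset.mul_sum]
    refine Finset.sum_congr rfl fun α hα => ?_
    rw [multiDeriv_smoothing hη hc ((hG α hα).locallyIntegrable (by norm_num))]
    ring
  simp only [e1]
  rw [integral_finsetSum _ fun α hα => (integrable_bilin (B := innerSL ℝ)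
    ((hW α hα).multiDeriv α).memLp_two hbq.memLp_two).const_mul _, ← Finset.sum_neg_distrib]
  refine Finset.sum_congr rfl fun α hα => ?_
  have h : ∫ x, inner ℝ (smoothing η (fun y => G α (τ, y)) x)
      (multiDeriv α (fun y => b y • q y) x) = _ :=
    integral_bilin_multiDeriv (innerSL ℝ) (hW α hα) hbq α
  rw [mem_multiIndices.1 hα, smul_eq_mul] at h
  rw [integral_const_mul, h]
  ring

/-- The differential inequality for the weighted energy of the mollified solution, integrated. -/
theorem IsMildSolution.weighted_energy_le {lam Lam : ℝ} (hA : IsElliptic m lam Lam A)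
    (hs : 0 ≤ s) (H : IsMildSolution m A s h u G D) (hh : MemLp h 2 volume) {ψ : Space n → ℝ}
    (hψ : IsBoundedSmooth ψ) {a C : ℝ} (ha : 0 < a) (hC : 0 ≤ C)
    (hED : ∀ a' : Space n → MultiIndex n → MultiIndex n → Fin N → Fin N → ℂ,
      IsEllipticSlice m lam Lam a' →
      ∀ (v : Space n → Target N) (W : MultiIndex n → Space n → Target N), IsSobolev v →
      (∀ α ∈ multiIndices n m, MemLp (W α) 2 volume) →
      -∑ α ∈ multiIndices n m, ∫ x, inner ℝ (W α x)
          (multiDeriv α (fun y => Real.exp (2 * ψ y) • v y) x) ≤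
        a * (∫ x, ‖Real.exp (ψ x) • v x‖ ^ 2) +
        C * ∑ α ∈ multiIndices n m,
          ∫ x, ‖W α x - coeffApply m (a' x) (fun β => multiDeriv β v x) α‖ ^ 2)
    (k : ℕ) {T : ℝ} (hT : s < T) :
    ∫ x, ‖Real.exp (ψ x) • smoothing (mollifier n k) (u T) x‖ ^ 2 ≤
      ((∫ x, ‖Real.exp (ψ x) • smoothing (mollifier n k) h x‖ ^ 2) +
        2 * C * ∫ τ, fluxError m (N * (Lam * N)) k G D τ) * Real.exp (2 * a * (T - s)) := by
  have hη := contDiff_mollifier n k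
  have hc := hasCompactSupport_mollifier n k
  have hb := (hψ.const_mul 2).exp
  obtain ⟨Cb, hCb⟩ := hb.bounded 0
  have hbC : ∀ x, |Real.exp (2 * ψ x)| ≤ Cb := fun x => by simpa using hCb x
  have hw : ∀ (x : Space n) (v : Target N),
      Real.exp (2 * ψ x) * ‖v‖ ^ 2 = ‖Real.exp (ψ x) • v‖ ^ 2 := fun x v => by
    rw [norm_smul, mul_pow, Real.norm_of_nonneg (Real.exp_nonneg _), ← Real.exp_nat_mul]
    norm_num
  set y : ℝ → ℝ := fun t => ∫ x, ‖Real.exp (ψ x) • smoothing (mollifier n k) (u t) x‖ ^ 2 with hy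
  have hyI : IntegrableOn y (Ioc s T) := by
    have h1 : Integrable (fun p : ℝ × Space n =>
        Real.exp (2 * ψ p.2) * ‖smoothedState m s h (mollifier n k) G p‖ ^ 2)
        ((volume.restrict (Ioc s T)).prod volume) :=
      ((H.memLp_smoothedState hh hη hc T).integrable_norm_pow two_ne_zero).bdd_mul
        (hb.smooth.continuous.comp continuous_snd).aestronglyMeasurable
        (Eventually.of_forall fun p => hbC p.2)
    refine h1.integral_prod_left.congr ((ae_restrict_iff' measurableSet_Ioc).2
      (Eventually.of_forall fun τ hτ => ?_))
    refine integral_congr_ae (Eventually.of_forall fun x => ?_)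
    simp only [← hw, H.smoothing_eq hη hc hτ.1]
    rfl
  have hr := H.integrable_fluxError (N * (Lam * N)) k
  have hr0 := fluxError_nonneg m (N * (Lam * N)) k G D
  refine gronwall_integral hT (by positivity) hyI fun t ht => ?_
  obtain ⟨hΦ, hid⟩ := H.energy_identity hh hη hc hb.smooth.continuous hbC ht.1
  simp only [hw] at hid
  have hyt : IntegrableOn y (Ioc s t) := hyI.mono_set (Ioc_subset_Ioc_right ht.2)
  have hsub : Ioc s t ⊆ Ioi s := fun τ hτ => hτ.1
  have hsl := ae_mono (Measure.restrict_mono_set volume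
    (hsub.trans (Ioi_subset_Ioi hs))) hA.ae_isEllipticSlice
  have hsl2 := ae_mono (Measure.restrict_mono_set volume hsub) H.ae_slice
  have hGm : ∀ᵐ τ ∂(volume.restrict (Ioc s t)), ∀ α ∈ multiIndices n m,
      MemLp (fun x => G α (τ, x)) 2 volume ∧ MemLp (fun x => D α (τ, x)) 2 volume :=
    ae_restrict_of_ae ((ae_ball_iff (Finset.countable_toSet _)).2 fun α hα =>
      (ae_memLp_slice (H.measurable_flux α hα) (H.memLp_flux α hα)).and
      (ae_memLp_slice (H.measurable_grad α hα) (H.memLp_grad α hα)))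
  have key : ∀ᵐ τ ∂(volume.restrict (Ioc s t)),
      ∫ x, Real.exp (2 * ψ x) * inner ℝ (forcing m (mollifier n k) G (τ, x))
        (smoothing (mollifier n k) (u τ) x) ≤
      a * y τ + C * fluxError m (N * (Lam * N)) k G D τ := by
    filter_upwards [hsl, hsl2, hGm, ae_restrict_mem measurableSet_Ioc] with τ h1 h2 h3 h4
    have hq := H.isSobolev_smoothing_solution hh hη hc h4.1
    rw [integral_weight_inner_forcing hb hη hc (fun α hα => (h3 α hα).1) hq]
    -- Here `W` is the mollified flux, and its distance to the flux of the mollified solution is the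
    -- error measured by `fluxError`.
    refine (hED _ h1 _ _ hq fun α hα => memLp_smoothing_mollifier (h3 α hα).1 k).trans ?_
    refine add_le_add le_rfl (mul_le_mul_of_nonneg_left (Finset.sum_le_sum fun α hα => ?_) hC)
    refine le_trans (le_of_eq ?_) (integral_sq_norm_smoothing_flux_sub_le h1 k hα (h3 α hα).1
      (fun β hβ => (h3 β hβ).2) (h2 α hα).2)
    refine integral_congr_ae (Eventually.of_forall fun x => ?_)
    simp only
    rw [coeffApply_congr _ (fun β hβ => congrFun ((h2 β hβ).1.multiDeriv_smoothing hη hc) x)]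
  have hI := integral_mono_ae hΦ ((hyt.const_mul a).add (hr.integrableOn.const_mul C)) key
  have e : ∫ τ in Ioc s t, (a * y τ + C * fluxError m (N * (Lam * N)) k G D τ) =
      a * (∫ τ in Ioc s t, y τ) + C * ∫ τ in Ioc s t, fluxError m (N * (Lam * N)) k G D τ := by
    rw [integral_add (hyt.const_mul a) (hr.integrableOn.const_mul C), integral_const_mul,
      integral_const_mul]
  have hI' := hI.trans_eq e
  have hle := mul_le_mul_of_nonneg_left
    (setIntegral_le_integral (s := Ioc s t) hr (Eventually.of_forall hr0)) hC
  simp only [hy] at hid hI' ⊢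
  rw [hid]
  linarith

theorem lintegral_sq_enorm_eq {Ω V : Type*} [MeasurableSpace Ω] {μ : Measure Ω}
    [NormedAddCommGroup V] {f : Ω → V} (hf : MemLp f 2 μ) :
    ∫⁻ x, ‖f x‖ₑ ^ 2 ∂μ = ENNReal.ofReal (∫ x, ‖f x‖ ^ 2 ∂μ) := by
  rw [ofReal_integral_eq_lintegral_ofReal (hf.integrable_norm_pow two_ne_zero)
    (Eventually.of_forall fun x => sq_nonneg _)]
  refine lintegral_congr fun x => ?_
  rw [← ofReal_norm, ENNReal.ofReal_pow (norm_nonneg _)]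

theorem memLp_two_smul {b : Space n → ℝ} (hb : Continuous b) {L : ℝ} (hbL : ∀ x, |b x| ≤ L)
    {f : Space n → Target N} (hf : MemLp f 2 volume) : MemLp (fun x => b x • f x) 2 volume := by
  refine (hf.norm.const_mul L).mono' (hb.aestronglyMeasurable.smul hf.1)
    (Eventually.of_forall fun x => ?_)
  rw [norm_smul]
  exact mul_le_mul_of_nonneg_right (hbL x) (norm_nonneg _)

/-- Davies' method: the weighted `L²` norm of a solution grows at most exponentially. -/
theorem exists_weighted_growth_const (hn : 1 ≤ n) (m : ℕ) {lam : ℝ} (hlam : 0 < lam) (Lam : ℝ)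
    {κ : ℝ} (hκ : 0 ≤ κ) :
    ∃ K : ℝ, 0 < K ∧ ∀ A : Coeff n N, IsElliptic m lam Lam A →
      ∀ (s : ℝ), 0 ≤ s → ∀ h : Space n → Target N, MemLp h 2 volume →
      ∀ u : ℝ → Space n → Target N, IsEnergySolution m A s h u →
      ∀ ρ : ℝ, 0 < ρ → ∀ ψ : Space n → ℝ, IsBoundedSmooth ψ →
      (∀ i, 1 ≤ i → i ≤ m → ∀ x, ‖iteratedFDeriv ℝ i ψ x‖ ≤ (κ * ρ) ^ i) →
      ∀ T, s < T → ∫⁻ x, ‖Real.exp (ψ x) • u T x‖ₑ ^ 2 ≤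
        ENNReal.ofReal (2 * (∫ x, ‖Real.exp (ψ x) • h x‖ ^ 2) *
          Real.exp (K * ρ ^ (2 * m) * (T - s))) := by
  obtain ⟨K, hK, hKL⟩ := exists_energy_dissipation_const (N := N) hn m hlam Lam hκ
  refine ⟨2 * K, by positivity, fun A hA s hs h hh u hu ρ hρ ψ hψ hD T hT => ?_⟩
  obtain ⟨G, D, H⟩ := hu.exists_isMildSolution hA hs hh
  obtain ⟨L, hL⟩ := hψ.exp.bounded 0
  have hL' : ∀ x, |Real.exp (ψ x)| ≤ L := fun x => by simpa using hL x
  have hexp := hψ.exp.smooth.continuous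
  -- Through `L` the constant `C` depends on the weight, which is harmless: it multiplies the flux
  -- error, whose time integral tends to zero.
  obtain ⟨C, hC, hCE⟩ := hKL L
  have hED := fun a ha v W => hCE ρ hρ a ha ψ hψ (fun x => (le_abs_self _).trans (hL' x)) hD v W
  have hstep := fun k => H.weighted_energy_le hA hs hh hψ (a := K * ρ ^ (2 * m)) (by positivity)
    hC hED k hT
  set Y := ∫ x, ‖Real.exp (ψ x) • h x‖ ^ 2 with hY
  -- Comparing the weighted norms of the mollified and the original datum crudely costs the factor
  -- `2` in the conclusion, and the error term vanishes as `k → ∞`.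
  have hY0 : ∀ k, ∫ x, ‖Real.exp (ψ x) • smoothing (mollifier n k) h x‖ ^ 2 ≤
      2 * Y + 2 * L ^ 2 * ∫ x, ‖smoothing (mollifier n k) h x - h x‖ ^ 2 := by
    intro k
    have mk := memLp_smoothing_mollifier hh k
    have i1 := ((memLp_two_smul hexp hL' hh).integrable_norm_pow two_ne_zero).const_mul 2
    have i2 : Integrable fun x => 2 * L ^ 2 * ‖smoothing (mollifier n k) h x - h x‖ ^ 2 :=
      ((mk.sub hh).integrable_norm_pow two_ne_zero).const_mul (2 * L ^ 2)
    rw [hY, ← integral_const_mul, ← integral_const_mul, ← integral_add i1 i2]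
    refine integral_mono ((memLp_two_smul hexp hL' mk).integrable_norm_pow two_ne_zero)
      (i1.add i2) fun x => ?_
    have h1 := parallelogram_sub (Real.exp (ψ x) • h x)
      (Real.exp (ψ x) • (smoothing (mollifier n k) h x - h x))
    rw [← smul_add, add_sub_cancel] at h1
    have h2 : ‖Real.exp (ψ x) • (smoothing (mollifier n k) h x - h x)‖ ^ 2 ≤
        L ^ 2 * ‖smoothing (mollifier n k) h x - h x‖ ^ 2 := by
      rw [norm_smul, mul_pow]
      gcongr
      exact hL' x
    simp only
    linarith [sq_nonneg ‖Real.exp (ψ x) • h x -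
      Real.exp (ψ x) • (smoothing (mollifier n k) h x - h x)‖]
  set R : ℕ → ℝ := fun k => (2 * Y + 2 * L ^ 2 * (∫ x, ‖smoothing (mollifier n k) h x - h x‖ ^ 2) +
    2 * C * ∫ τ, fluxError m (N * (Lam * N)) k G D τ) *
      Real.exp (2 * K * ρ ^ (2 * m) * (T - s)) with hR
  have hRlim : Tendsto R atTop (𝓝 (2 * Y * Real.exp (2 * K * ρ ^ (2 * m) * (T - s)))) := by
    have := ((((tendsto_integral_sq_norm_smoothing_sub hh).const_mul (2 * L ^ 2)).const_add
      (2 * Y)).add ((H.tendsto_integral_fluxError (N * (Lam * N))).const_mul (2 * C))).mul_const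
        (Real.exp (2 * K * ρ ^ (2 * m) * (T - s)))
    simpa using this
  have hle : ∀ k, ∫⁻ x, ‖Real.exp (ψ x) • smoothing (mollifier n k) (u T) x‖ₑ ^ 2 ≤
      ENNReal.ofReal (R k) := by
    intro k
    rw [lintegral_sq_enorm_eq (memLp_two_smul hexp hL' (H.isSobolev_smoothing_solution hh
      (contDiff_mollifier n k) (hasCompactSupport_mollifier n k) hT).memLp_two)]
    refine ENNReal.ofReal_le_ofReal ((hstep k).trans ?_)
    rw [show 2 * (K * ρ ^ (2 * m)) * (T - s) = 2 * K * ρ ^ (2 * m) * (T - s) by ring]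
    exact mul_le_mul_of_nonneg_right (add_le_add_left (hY0 k) _) (Real.exp_nonneg _)
  -- Almost everywhere convergence and Fatou for lower integrals suffice, without knowing beforehand
  -- that `u T` is in `L²`.
  have hlim : ∀ᵐ x, ‖Real.exp (ψ x) • u T x‖ₑ ^ 2 =
      liminf (fun k => ‖Real.exp (ψ x) • smoothing (mollifier n k) (u T) x‖ₑ ^ 2) atTop := by
    filter_upwards [ae_tendsto_smoothing_mollifier (H.locallyIntegrable T hT)] with x hx
    exact ((ENNReal.continuous_pow 2).tendsto _ |>.comp
      (hx.const_smul (Real.exp (ψ x))).enorm).liminf_eq.symm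
  calc ∫⁻ x, ‖Real.exp (ψ x) • u T x‖ₑ ^ 2
      = ∫⁻ x, liminf (fun k => ‖Real.exp (ψ x) • smoothing (mollifier n k) (u T) x‖ₑ ^ 2) atTop :=
        lintegral_congr_ae hlim
    _ ≤ liminf (fun k => ∫⁻ x, ‖Real.exp (ψ x) • smoothing (mollifier n k) (u T) x‖ₑ ^ 2) atTop := by
        refine lintegral_liminf_le fun k => ?_
        have := (hexp.smul (contDiff_smoothing (contDiff_mollifier n k)
          (hasCompactSupport_mollifier n k) (H.locallyIntegrable T hT)).continuous)
        exact this.enorm.measurable.pow_const 2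
    _ ≤ liminf (fun k => ENNReal.ofReal (R k)) atTop :=
        liminf_le_liminf (Eventually.of_forall hle)
    _ = _ := (ENNReal.tendsto_ofReal hRlim).liminf_eq

end WeightedEstimate
-- Smooth weights adapted to the distance from a set
section DistanceWeight

variable {n : ℕ}

/-- Replacing `g (x - y)` by `g x` costs at most `‖y‖`. For a kernel of mean zero the bound does not
see the size of `g` at all. -/
theorem abs_smoothing_sub_le {η : Space n → ℝ} (hη : Continuous η) (hc : HasCompactSupport η)
    {g : Space n → ℝ} (hg : LipschitzWith 1 g) (x : Space n) :
    |smoothing η g x - (∫ y, η y) * g x| ≤ ∫ y, |η y| * ‖y‖ := by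
  have i1 : Integrable fun y => η y * g (x - y) :=
    (hη.mul (hg.continuous.comp (continuous_const.sub continuous_id))).integrable_of_hasCompactSupport
      hc.mul_right
  have i2 : Integrable η := hη.integrable_of_hasCompactSupport hc
  have i3 : Integrable fun y => |η y| * ‖y‖ :=
    (hη.abs.mul continuous_norm).integrable_of_hasCompactSupport
      (HasCompactSupport.mul_right (hc.comp_left (g := fun s : ℝ => |s|) abs_zero))
  rw [smoothing_apply', ← integral_mul_const]
  simp only [smul_eq_mul]
  rw [← integral_sub i1 (i2.mul_const _)]
  refine (abs_integral_le_integral_abs).trans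
    (integral_mono (i1.sub (i2.mul_const _)).abs i3 fun y => ?_)
  simp only [← mul_sub, abs_mul]
  refine mul_le_mul_of_nonneg_left ?_ (abs_nonneg _)
  have := hg.dist_le_mul (x - y) x
  simpa [dist_eq_norm] using this

theorem integral_wordDeriv_eq_zero {η : Space n → ℝ} (hη : ContDiff ℝ ∞ η)
    (hc : HasCompactSupport η) {w : List (Fin n)} (hw : w ≠ []) : ∫ y, wordDeriv w η y = 0 := by
  obtain ⟨k, w, rfl⟩ := List.exists_cons_of_ne_nil hw
  have h := congrFun (partialDeriv_smoothing (contDiff_wordDeriv hη w)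
    (hasCompactSupport_wordDeriv hc w) (g := fun _ => (1 : ℝ))
    continuous_const.locallyIntegrable k) 0
  have e : smoothing (wordDeriv w η) (fun _ => (1 : ℝ)) = fun _ => ∫ y, wordDeriv w η y := by
    funext x
    rw [smoothing_apply']
    simp
  rw [e, smoothing_apply'] at h
  simpa [partialDeriv] using h.symm

/-- All derivatives go to the kernel, which then has mean zero, so only the Lipschitz constant of
`g` enters and `C` is uniform in `g`. -/
theorem exists_norm_iteratedFDeriv_smoothing_le {η : Space n → ℝ} (hη : ContDiff ℝ ∞ η)
    (hc : HasCompactSupport η) (i : ℕ) (w : List (Fin n)) (hiw : 1 ≤ i + w.length) :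
    ∃ C : ℝ, 0 ≤ C ∧ ∀ g : Space n → ℝ, LipschitzWith 1 g →
      ∀ x, ‖iteratedFDeriv ℝ i (smoothing (wordDeriv w η) g) x‖ ≤ C := by
  induction i generalizing w with
  | zero =>
    refine ⟨∫ y, |wordDeriv w η y| * ‖y‖, integral_nonneg fun y => by positivity,
      fun g hg x => ?_⟩
    have h := abs_smoothing_sub_le (contDiff_wordDeriv hη w).continuous
      (hasCompactSupport_wordDeriv hc w) hg x
    rw [integral_wordDeriv_eq_zero hη hc (by rintro rfl; simp at hiw), zero_mul, sub_zero] at h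
    rwa [norm_iteratedFDeriv_zero]
  | succ i ih =>
    choose C hC0 hC using fun k : Fin n => ih (k :: w) (by simp; omega)
    refine ⟨∑ k, C k, Finset.sum_nonneg fun k _ => hC0 k, fun g hg x => ?_⟩
    have hl : LocallyIntegrable g volume := hg.continuous.locallyIntegrable
    have hw := contDiff_wordDeriv hη w
    have hwc := hasCompactSupport_wordDeriv hc w
    refine (norm_iteratedFDeriv_succ_le (contDiff_smoothing hw hwc hl) i x).trans
      (Finset.sum_le_sum fun k _ => ?_)
    rw [partialDeriv_smoothing hw hwc hl]
    exact hC k g hg x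

/-- Smooth bounded approximations of `ρ * min (d(·, F)) d` with scale-invariant bounds. -/
theorem exists_distance_weight (n m : ℕ) :
    ∃ κ c₀ : ℝ, 0 ≤ κ ∧ 0 ≤ c₀ ∧ ∀ (F : Set (Space n)) (d ρ : ℝ), 0 ≤ d → 0 < ρ →
      ∃ ψ : Space n → ℝ, IsBoundedSmooth ψ ∧
        (∀ i, 1 ≤ i → i ≤ m → ∀ x, ‖iteratedFDeriv ℝ i ψ x‖ ≤ (κ * ρ) ^ i) ∧
        (∀ x ∈ F, ψ x ≤ c₀) ∧ ∀ x, d ≤ Metric.infDist x F → ρ * d - c₀ ≤ ψ x := by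
  have hη := contDiff_mollifier n 0
  have hc := hasCompactSupport_mollifier n 0
  have h1 : ∫ y, mollifier n 0 y = 1 := (mollifierBump n 0).integral_normed
  choose C hC0 hC using fun i : ℕ => exists_norm_iteratedFDeriv_smoothing_le hη hc (i + 1) []
    (by simp)
  -- With `κ ≥ 1`, each derivative bound `C j` with `j < m` is at most `κ`, hence at most `κ ^ (j +
  -- 1)`.
  have hκ1 : 1 ≤ 1 + ∑ i ∈ Finset.range m, C i :=
    le_add_of_nonneg_right (Finset.sum_nonneg fun i _ => hC0 i)
  refine ⟨1 + ∑ i ∈ Finset.range m, C i, ∫ y, |mollifier n 0 y| * ‖y‖,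
    zero_le_one.trans hκ1, integral_nonneg fun y => by positivity, fun F d ρ hd hρ => ?_⟩
  -- Work in coordinates dilated by `ρ`: the distance to `ρ • F` is again `1`-Lipschitz, so it can
  -- be mollified at unit scale with fixed constants. Pulling back by `x ↦ ρ • x` multiplies
  -- derivatives of order `i` by `ρ ^ i`. Truncation at `ρ * d` makes the weight bounded.
  open Pointwise in
  set g : Space n → ℝ := fun y => min (Metric.infDist y (ρ • F)) (ρ * d) with hg
  have hgL : LipschitzWith 1 g := (Metric.lipschitz_infDist_pt _).min_const _
  have hgρ : ∀ x, g (ρ • x) = min (ρ * Metric.infDist x F) (ρ * d) := fun x => by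
    simp only [hg]
    rw [infDist_smul₀ hρ.ne', Real.norm_of_nonneg hρ.le]
  have hg0 : ∀ y, |g y| ≤ ρ * d := fun y => by
    rw [abs_of_nonneg (le_min Metric.infDist_nonneg (by positivity))]
    exact min_le_right _ _
  have hS : ContDiff ℝ ∞ (smoothing (mollifier n 0) g) :=
    contDiff_smoothing hη hc hgL.continuous.locallyIntegrable
  have happ := abs_smoothing_sub_le hη.continuous hc hgL
  simp only [h1, one_mul] at happ
  have hder : ∀ (i : ℕ) (x : Space n),
      ‖iteratedFDeriv ℝ i (fun x => smoothing (mollifier n 0) g (ρ • x)) x‖ =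
        ρ ^ i * ‖iteratedFDeriv ℝ i (smoothing (mollifier n 0) g) (ρ • x)‖ := fun i x => by
    rw [iteratedFDeriv_comp_const_smul ρ (hS.of_le (by exact_mod_cast le_top)), norm_smul,
      norm_pow, Real.norm_of_nonneg hρ.le]
  refine ⟨fun x => smoothing (mollifier n 0) g (ρ • x),
    ⟨hS.comp (contDiff_const_smul ρ), fun j => ?_⟩, fun i hi him x => ?_, fun x hx => ?_,
    fun x hx => ?_⟩
  · rcases j with - | j
    · refine ⟨(∫ y, |mollifier n 0 y| * ‖y‖) + ρ * d, fun x => ?_⟩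
      rw [norm_iteratedFDeriv_zero, Real.norm_eq_abs]
      have h2 := happ (ρ • x)
      have h3 := hg0 (ρ • x)
      rw [abs_le] at h2 h3 ⊢
      constructor <;> linarith
    · refine ⟨ρ ^ (j + 1) * C j, fun x => ?_⟩
      rw [hder]
      exact mul_le_mul_of_nonneg_left (hC j g hgL _) (by positivity)
  · obtain ⟨j, rfl⟩ := Nat.exists_eq_add_of_le' hi
    rw [hder, mul_comm, mul_pow]
    refine mul_le_mul_of_nonneg_right ((hC j g hgL _).trans ?_) (by positivity)
    calc C j ≤ ∑ i ∈ Finset.range m, C i :=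
          Finset.single_le_sum (f := C) (fun i _ => hC0 i) (Finset.mem_range.2 him)
      _ ≤ 1 + ∑ i ∈ Finset.range m, C i := by linarith
      _ ≤ _ := le_self_pow₀ hκ1 (by omega)
  · have h2 := happ (ρ • x)
    rw [hgρ, Metric.infDist_zero_of_mem hx, mul_zero, min_eq_left (by positivity), sub_zero] at h2
    exact (le_abs_self _).trans h2
  · have h2 := (abs_le.1 (happ (ρ • x))).1
    rw [hgρ, min_eq_right (mul_le_mul_of_nonneg_left hx hρ.le)] at h2
    linarith

end DistanceWeight
-- Optimising the weight and the off-diagonal bound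
theorem setDist_nonneg {n : ℕ} (E F : Set (Space n)) : 0 ≤ setDist E F :=
  Real.sInf_nonneg (by rintro _ ⟨x, -, y, -, rfl⟩; exact dist_nonneg)

theorem setDist_le_infDist {n : ℕ} {E F : Set (Space n)} {x : Space n} (hx : x ∈ E) :
    setDist E F ≤ Metric.infDist x F := by
  -- For empty `F` both distances take the default value `0`.
  rcases F.eq_empty_or_nonempty with rfl | hF
  · simp [setDist]
  · refine (Metric.le_infDist hF).2 fun y hy => csInf_le ⟨0, ?_⟩ ⟨x, hx, y, hy, rfl⟩
    rintro _ ⟨x, -, y, -, rfl⟩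
    exact dist_nonneg

/-- The optimal choice of the slope of the weight. -/
theorem exists_slope {m : ℕ} (hm : 1 ≤ m) {K σ : ℝ} (hK : 0 < K) (hσ : 0 < σ) (hσ1 : σ ≤ 1)
    (hKσ : K * σ ≤ 1) {d τ : ℝ} (hd : 0 ≤ d) (hτ : 0 < τ) :
    ∃ ρ : ℝ, 0 < ρ ∧ K * ρ ^ (2 * m) * τ - 2 * (ρ * d) ≤
      K - σ * (d / τ ^ (1 / (2 * (m : ℝ)))) ^ (2 * (m : ℝ) / (2 * (m : ℝ) - 1)) := by
  have hm' : (1 : ℝ) ≤ m := by exact_mod_cast hm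
  obtain ⟨p, hp⟩ : ∃ p : ℝ, p = 2 * (m : ℝ) := ⟨_, rfl⟩
  have hp2 : 2 ≤ p := by linarith
  have hcast : ((2 * m : ℕ) : ℝ) = p := by rw [hp]; push_cast; ring
  rw [← hp]
  have hτp : 0 < τ ^ (1 / p) := Real.rpow_pos_of_pos hτ _
  have hpow : (τ ^ (1 / p)) ^ (2 * m) = τ := by
    rw [← Real.rpow_natCast, hcast, ← Real.rpow_mul hτ.le, one_div_mul_cancel (by linarith),
      Real.rpow_one]
  rcases hd.eq_or_lt with rfl | hd
  · refine ⟨1 / τ ^ (1 / p), by positivity, ?_⟩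
    rw [div_pow, one_pow, hpow, zero_div, Real.zero_rpow (div_pos (by linarith) (by linarith)).ne']
    apply le_of_eq
    field_simp
    ring
  · obtain ⟨z, hz⟩ : ∃ z : ℝ, z = d / τ ^ (1 / p) := ⟨_, rfl⟩
    have hz0 : 0 < z := by rw [hz]; positivity
    obtain ⟨X, hX⟩ : ∃ X : ℝ, X = z ^ (p / (p - 1)) := ⟨_, rfl⟩
    have hX0 : 0 < X := hX ▸ Real.rpow_pos_of_pos hz0 _
    have hz1 : z ^ (1 / (p - 1)) * z = X := by
      rw [hX]
      nth_rewrite 2 [← Real.rpow_one z]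
      rw [← Real.rpow_add hz0]
      congr 1
      have : p - 1 ≠ 0 := by linarith
      field_simp
      ring
    have hz2 : (z ^ (1 / (p - 1))) ^ (2 * m) = X := by
      rw [hX, ← Real.rpow_natCast, hcast, ← Real.rpow_mul hz0.le]
      congr 1
      ring
    -- The exponent is the one that makes both competing terms multiples of the same power `X`: `ρ d
    -- = σ X` and `ρ ^ (2m) τ = σ ^ (2m) X`. As `K σ ≤ 1`, the growth term is at most `σ X`, half of
    -- the gain `2 σ X`.
    refine ⟨σ * z ^ (1 / (p - 1)) / τ ^ (1 / p),
      div_pos (mul_pos hσ (Real.rpow_pos_of_pos hz0 _)) hτp, ?_⟩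
    have e1 : σ * z ^ (1 / (p - 1)) / τ ^ (1 / p) * d = σ * X := by
      rw [← hz1, hz]; ring
    have e2 : (σ * z ^ (1 / (p - 1)) / τ ^ (1 / p)) ^ (2 * m) * τ = σ ^ (2 * m) * X := by
      rw [div_pow, mul_pow, hz2, hpow]
      field_simp
    rw [mul_assoc, e1, e2, ← hz, ← hX]
    have h1 : σ ^ (2 * m) ≤ σ ^ 2 := pow_le_pow_of_le_one hσ.le hσ1 (by omega)
    have h2 : K * σ ^ (2 * m) ≤ σ := by
      calc K * σ ^ (2 * m) ≤ K * σ ^ 2 := by gcongr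
        _ = (K * σ) * σ := by ring
        _ ≤ 1 * σ := by gcongr
        _ = σ := one_mul σ
    nlinarith [mul_le_mul_of_nonneg_right h2 hX0.le]

theorem eLpNorm_two_sq {Ω V : Type*} [MeasurableSpace Ω] {μ : Measure Ω} [NormedAddCommGroup V]
    (f : Ω → V) : eLpNorm f 2 μ ^ 2 = ∫⁻ x, ‖f x‖ₑ ^ 2 ∂μ := by
  rw [eLpNorm_eq_lintegral_rpow_enorm_toReal (by norm_num) (by norm_num)]
  simp only [ENNReal.toReal_ofNat, ENNReal.rpow_ofNat]
  rw [← ENNReal.rpow_natCast, ← ENNReal.rpow_mul]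
  norm_num

/-- The off-diagonal estimate in terms of a weight that separates the two sets. -/
theorem lintegral_indicator_le_of_weight {n N : ℕ} {E F : Set (Space n)}
    {f v : Space n → Target N} (hf : MemLp (F.indicator f) 2 volume) {ψ : Space n → ℝ}
    (hψ : IsBoundedSmooth ψ) {c₀ r Q : ℝ} (hF : ∀ x ∈ F, ψ x ≤ c₀) (hE : ∀ x ∈ E, r ≤ ψ x)
    (hv : ∫⁻ x, ‖Real.exp (ψ x) • v x‖ₑ ^ 2 ≤
      ENNReal.ofReal (2 * (∫ x, ‖Real.exp (ψ x) • F.indicator f x‖ ^ 2) * Real.exp Q)) :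
    ∫⁻ x, ‖E.indicator v x‖ₑ ^ 2 ≤
      ENNReal.ofReal (2 * Real.exp (2 * c₀ + Q - 2 * r) * ∫ x, ‖F.indicator f x‖ ^ 2) := by
  have h1 : ∫ x, ‖Real.exp (ψ x) • F.indicator f x‖ ^ 2 ≤
      Real.exp (2 * c₀) * ∫ x, ‖F.indicator f x‖ ^ 2 := by
    obtain ⟨L, hL⟩ := hψ.exp.bounded 0
    have hL' : ∀ x, |Real.exp (ψ x)| ≤ L := fun x => by simpa using hL x
    rw [← integral_const_mul]
    refine integral_mono ((memLp_two_smul hψ.exp.smooth.continuous hL'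
      hf).integrable_norm_pow two_ne_zero) ((hf.integrable_norm_pow two_ne_zero).const_mul _)
      fun x => ?_
    simp only
    by_cases hx : x ∈ F
    · rw [norm_smul, mul_pow, Real.norm_of_nonneg (Real.exp_nonneg _), ← Real.exp_nat_mul]
      refine mul_le_mul_of_nonneg_right (Real.exp_le_exp.2 ?_) (sq_nonneg _)
      push_cast
      linarith [hF x hx]
    · simp [indicator_of_notMem hx]
  have h2 : ∀ x, ‖E.indicator v x‖ₑ ^ 2 ≤
      ENNReal.ofReal (Real.exp (-2 * r)) * ‖Real.exp (ψ x) • v x‖ₑ ^ 2 := by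
    intro x
    by_cases hx : x ∈ E
    · rw [indicator_of_mem hx, ← ofReal_norm, ← ofReal_norm, ← ENNReal.ofReal_pow (norm_nonneg _),
        ← ENNReal.ofReal_pow (norm_nonneg _), ← ENNReal.ofReal_mul (Real.exp_nonneg _)]
      refine ENNReal.ofReal_le_ofReal ?_
      rw [norm_smul, mul_pow, Real.norm_of_nonneg (Real.exp_nonneg _), ← Real.exp_nat_mul,
        ← mul_assoc, ← Real.exp_add]
      refine le_mul_of_one_le_left (sq_nonneg _) (Real.one_le_exp ?_)
      push_cast
      linarith [hE x hx]
    · simp [indicator_of_notMem hx]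
  calc ∫⁻ x, ‖E.indicator v x‖ₑ ^ 2
      ≤ ∫⁻ x, ENNReal.ofReal (Real.exp (-2 * r)) * ‖Real.exp (ψ x) • v x‖ₑ ^ 2 :=
        lintegral_mono h2
    _ = ENNReal.ofReal (Real.exp (-2 * r)) * ∫⁻ x, ‖Real.exp (ψ x) • v x‖ₑ ^ 2 :=
        lintegral_const_mul' _ _ ENNReal.ofReal_ne_top
    _ ≤ ENNReal.ofReal (Real.exp (-2 * r)) *
        ENNReal.ofReal (2 * (∫ x, ‖Real.exp (ψ x) • F.indicator f x‖ ^ 2) * Real.exp Q) := by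
        gcongr
    _ ≤ _ := by
        rw [← ENNReal.ofReal_mul (Real.exp_nonneg _)]
        refine ENNReal.ofReal_le_ofReal ?_
        calc Real.exp (-2 * r) * (2 * (∫ x, ‖Real.exp (ψ x) • F.indicator f x‖ ^ 2) * Real.exp Q)
            ≤ Real.exp (-2 * r) * (2 * (Real.exp (2 * c₀) * ∫ x, ‖F.indicator f x‖ ^ 2) *
              Real.exp Q) := by gcongr
          _ = 2 * (Real.exp (2 * c₀) * Real.exp Q * Real.exp (-2 * r)) *
              ∫ x, ‖F.indicator f x‖ ^ 2 := by ring
          _ = _ := by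
            rw [← Real.exp_add, ← Real.exp_add]
            ring_nf

end HigherOrderParabolic

theorem proposition4p3 (n m N : ℕ) (hn : 1 ≤ n) (hm : 1 ≤ m) (hN : 1 ≤ N)
    (lam Lam : ℝ) (hlam : 0 < lam) (hLam : 0 < Lam) :
    ∃ C c : ℝ, 0 < C ∧ 0 < c ∧
      ∀ A : HigherOrderParabolic.Coeff n N, HigherOrderParabolic.IsElliptic m lam Lam A →
      ∀ E F : Set (HigherOrderParabolic.Space n), IsClosed E → IsClosed F →
      ∀ f : HigherOrderParabolic.Space n → HigherOrderParabolic.Target N, MemLp f 2 volume →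
      ∀ s t : ℝ, 0 ≤ s → s < t →
        eLpNorm (E.indicator (HigherOrderParabolic.propagator m A t s (F.indicator f))) 2 volume ≤
          ENNReal.ofReal (C * Real.exp (-c *
            (HigherOrderParabolic.setDist E F / (t - s) ^ (1 / (2 * (m : ℝ)))) ^
              (2 * (m : ℝ) / (2 * (m : ℝ) - 1)))) *
          eLpNorm (F.indicator f) 2 volume := by
  obtain ⟨κ, c₀, hκ, hc₀, hweight⟩ := HigherOrderParabolic.exists_distance_weight n m
  obtain ⟨K, hK, hgrowth⟩ := HigherOrderParabolic.exists_weighted_growth_const (N := N) hn m hlam Lam hκ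
  obtain ⟨σ, hσ, hσ1, hKσ⟩ : ∃ σ : ℝ, 0 < σ ∧ σ ≤ 1 ∧ K * σ ≤ 1 := by
    refine ⟨min 1 (1 / K), by positivity, min_le_left _ _, ?_⟩
    calc K * min 1 (1 / K) ≤ K * (1 / K) := by gcongr; exact min_le_right _ _
      _ = 1 := by field_simp
  -- These are square roots of the constants for squared norms. With `r = ρ d - c₀` the exponent
  -- there is `4c₀ + Kρ^{2m}(t-s) - 2ρd`, at most `4c₀ + K` minus `σ` times the power of the scaled
  -- distance.
  refine ⟨2 * Real.exp (2 * c₀ + K / 2), σ / 2, by positivity, by positivity,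
    fun A hA E F hE hF f hf s t hs hst => ?_⟩
  have hh : MemLp (F.indicator f) 2 volume := hf.indicator hF.measurableSet
  unfold HigherOrderParabolic.propagator
  -- The growth estimate holds for every energy solution, so it applies to whichever one is chosen;
  -- if there were none, the default value `0` satisfies the bound.
  split_ifs with hu
  swap
  · simp
  obtain ⟨ρ, hρ, hslope⟩ := HigherOrderParabolic.exists_slope hm hK hσ hσ1 hKσ (HigherOrderParabolic.setDist_nonneg E F) (sub_pos.2 hst)
  obtain ⟨ψ, hψ, hD, hψF, hψE⟩ := hweight F (HigherOrderParabolic.setDist E F) ρ (HigherOrderParabolic.setDist_nonneg E F) hρ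
  have key := HigherOrderParabolic.lintegral_indicator_le_of_weight hh hψ hψF
    (fun x hx => hψE x (HigherOrderParabolic.setDist_le_infDist hx))
    (hgrowth A hA s hs _ hh _ hu.choose_spec ρ hρ ψ hψ hD t hst)
  rw [← ENNReal.pow_le_pow_left_iff two_ne_zero, mul_pow, HigherOrderParabolic.eLpNorm_two_sq,
    HigherOrderParabolic.eLpNorm_two_sq, HigherOrderParabolic.lintegral_sq_enorm_eq hh, ← ENNReal.ofReal_pow (by positivity),
    ← ENNReal.ofReal_mul (by positivity)]
  refine key.trans (ENNReal.ofReal_le_ofReal ?_)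
  refine mul_le_mul_of_nonneg_right ?_ (integral_nonneg fun x => sq_nonneg _)
  rw [mul_pow, mul_pow, ← Real.exp_nat_mul, ← Real.exp_nat_mul, mul_assoc (2 ^ 2),
    ← Real.exp_add]
  refine mul_le_mul (by norm_num) (Real.exp_le_exp.2 ?_) (Real.exp_nonneg _) (by norm_num)
  push_cast
  linarith
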